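/- Let $R$ be a Gorenstein normal (noetherian, commutative) local ring with $\dim R\ge 3$; in particular $R$ is a normal domain. Let $\mathrm{Cl}(R)$ be its divisor class group, written additively; its elements are the isomorphism classes of reflexive $R$-modules of rank one, equivalently the classes of divisorial fractional ideals modulo principal ones. A finitely generated $R$-module $M$ is called maximal Cohen--Macaulay if $\operatorname{depth} M_{\mathfrak p}\ge \operatorname{height}\mathfrak p$ for all $\mathfrak p\in\operatorname{Spec}R$ (where $\operatorname{depth}0=\infty$), and a point of $\mathrm{Cl}(R)$ is called maximal Cohen--Macaulay if the reflexive module of rank one representing it is a maximal Cohen--Macaulay module. A proper ideal $\mathfrak a$ of $R$ is called Gorenstein if the ring $R/\mathfrak a$ is Gorenstein. Let $I,J$ be Gorenstein ideals of $R$ of height one, and suppose that $I$ is locally free on the punctured spectrum of $R$, that is, $I_{\mathfrak p}$ is a free $R_{\mathfrak p}$-module for every nonmaximal prime ideal $\mathfrak p$ of $R$. Such ideals $I,J$ are reflexive, and we denote their classes in $\mathrm{Cl}(R)$ again by $I,J$. (1) If the point $J+nI\in\mathrm{Cl}(R)$ is maximal Cohen--Macaulay for some integer $n\ge0$ (resp.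 $n\le0$), then so is $J+iI$ for all integers $i$ with $0\le i\le n$ (resp. $n\le i\le0$). (2) The points $J+2I$ and $J-2I$ of $\mathrm{Cl}(R)$ cannot both be maximal Cohen--Macaulay, unless $I=0$ in $\mathrm{Cl}(R)$, i.e., unless $I$ is principal. -/

import Mathlib

open scoped nonZeroDivisors

universe u

section Depth

/-- The depth of a finitely generated module `M` over a noetherian local ring `A`: the supremum of
the lengths of the sequences in the maximal ideal that are weakly `M`-regular. If `M ≠ 0`, such
sequences are `M`-regular by Nakayama's lemma; the zero module has depth `∞`. -/
noncomputable def moduleDepth (A : Type*) [CommRing A] [IsLocalRing A]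
    (M : Type*) [AddCommGroup M] [Module A M] : ℕ∞ :=
  ⨆ (rs : List A) (_ : (∀ r ∈ rs, r ∈ IsLocalRing.maximalIdeal A) ∧
    RingTheory.Sequence.IsWeaklyRegular M rs), (rs.length : ℕ∞)

/-- A finitely generated `R`-module `M` is maximal Cohen-Macaulay if
`depth M_p ≥ height p` for all prime ideals `p` of `R`. -/
def IsMaximalCohenMacaulay (R : Type*) [CommRing R]
    (M : Type*) [AddCommGroup M] [Module R M] : Prop :=
  Module.Finite R M ∧ ∀ (p : Ideal R) [p.IsPrime],
    p.height ≤ moduleDepth (Localization.AtPrime p) (LocalizedModule p.primeCompl M)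

/-- A module over a local ring is locally free on the punctured spectrum if its localization at
every nonmaximal prime ideal is free. -/
def IsLocallyFreeOnPuncturedSpectrum (R : Type*) [CommRing R] [IsLocalRing R]
    (M : Type*) [AddCommGroup M] [Module R M] : Prop :=
  ∀ (p : Ideal R) [p.IsPrime], p ≠ IsLocalRing.maximalIdeal R →
    Module.Free (Localization.AtPrime p) (LocalizedModule p.primeCompl M)

/-- A Gorenstein local ring: a noetherian local ring that has finite injective dimension as a
module over itself. -/
def IsGorensteinLocalRing (A : Type u) [CommRing A] : Prop :=
  IsNoetherianRing A ∧ IsLocalRing A ∧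
    ∃ n : ℕ, CategoryTheory.HasInjectiveDimensionLE (ModuleCat.of A A) n

/-- A (proper) ideal `I` of a local ring is Gorenstein if `R ⧸ I` is a Gorenstein (local) ring. -/
def Ideal.IsGorenstein {R : Type u} [CommRing R] (I : Ideal R) : Prop :=
  IsGorensteinLocalRing (R ⧸ I)

end Depth

section DivisorClassGroup

variable {R : Type u} [CommRing R] [IsDomain R]

/-- The divisorial (that is, reflexive) hull of a fractional ideal, where `A⁻¹ = (R : A)`. -/
noncomputable def FractionalIdeal.divHull (A : FractionalIdeal R⁰ (FractionRing R)) :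
    FractionalIdeal R⁰ (FractionRing R) := (A⁻¹)⁻¹

variable {A B : FractionalIdeal R⁰ (FractionRing R)}

theorem FractionalIdeal.mul_ne_zero_of_ne_zero (hA : A ≠ 0) (hB : B ≠ 0) : A * B ≠ 0 := by
  obtain ⟨a, ha, ha0⟩ := (Submodule.ne_bot_iff _).mp (fun h ↦ hA (coeToSubmodule_eq_bot.mp h))
  obtain ⟨b, hb, hb0⟩ := (Submodule.ne_bot_iff _).mp (fun h ↦ hB (coeToSubmodule_eq_bot.mp h))
  intro h
  have hab : a * b ∈ A * B := mul_mem_mul ha hb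
  rw [h, mem_zero_iff] at hab
  exact mul_ne_zero ha0 hb0 hab

theorem FractionalIdeal.one_ne_zero_fractionRing :
    (1 : FractionalIdeal R⁰ (FractionRing R)) ≠ 0 := fun h ↦ zero_ne_one h.symm

theorem FractionalIdeal.le_inv_iff_mul_le_one (hB : B ≠ 0) : A ≤ B⁻¹ ↔ A * B ≤ 1 :=
  FractionalIdeal.le_div_iff_mul_le hB

theorem FractionalIdeal.inv_ne_zero_of_ne_zero (hA : A ≠ 0) : A⁻¹ ≠ 0 := by
  intro h
  have := FractionalIdeal.bot_lt_mul_inv hA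
  rw [h, mul_zero] at this
  exact lt_irrefl _ this

theorem FractionalIdeal.le_divHull (hA : A ≠ 0) : A ≤ A.divHull := by
  rw [divHull, le_inv_iff_mul_le_one (inv_ne_zero_of_ne_zero hA), mul_comm,
    ← le_inv_iff_mul_le_one hA]

theorem FractionalIdeal.divHull_ne_zero (hA : A ≠ 0) : A.divHull ≠ 0 :=
  inv_ne_zero_of_ne_zero (inv_ne_zero_of_ne_zero hA)

theorem FractionalIdeal.inv_divHull (hA : A ≠ 0) : A.divHull⁻¹ = A⁻¹ :=
  le_antisymm (inv_anti_mono hA (divHull_ne_zero hA) (le_divHull hA))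
    (le_divHull (inv_ne_zero_of_ne_zero hA))

theorem FractionalIdeal.divHull_divHull (hA : A ≠ 0) : A.divHull.divHull = A.divHull := by
  rw [divHull, inv_divHull hA, divHull]

theorem FractionalIdeal.inv_divHull_mul (hA : A ≠ 0) (hB : B ≠ 0) :
    (A.divHull * B)⁻¹ = (A * B)⁻¹ := by
  refine eq_of_forall_le_iff fun C ↦ ?_
  rw [le_inv_iff_mul_le_one (mul_ne_zero_of_ne_zero (divHull_ne_zero hA) hB),
    le_inv_iff_mul_le_one (mul_ne_zero_of_ne_zero hA hB), mul_comm A.divHull, mul_comm A, ← mul_assoc,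
    ← mul_assoc, ← le_inv_iff_mul_le_one hA, ← le_inv_iff_mul_le_one (divHull_ne_zero hA),
    inv_divHull hA]

theorem FractionalIdeal.divHull_divHull_mul (hA : A ≠ 0) (hB : B ≠ 0) :
    (A.divHull * B).divHull = (A * B).divHull := by
  rw [divHull, inv_divHull_mul hA hB, divHull]

theorem FractionalIdeal.divHull_mul_divHull (hA : A ≠ 0) (hB : B ≠ 0) :
    (A * B.divHull).divHull = (A * B).divHull := by
  rw [mul_comm, divHull_divHull_mul hB hA, mul_comm]

theorem FractionalIdeal.divHull_mul_inv [IsNoetherianRing R] [IsIntegrallyClosed R]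
    (hA : A ≠ 0) : (A * A⁻¹).divHull = 1 := by
  have hA' := inv_ne_zero_of_ne_zero hA
  suffices h : (A * A⁻¹)⁻¹ = 1 by rw [divHull, h, inv_one]
  apply le_antisymm
  · intro x hx
    have h1 : spanSingleton R⁰ x * A⁻¹ ≤ A⁻¹ := by
      rw [le_inv_iff_mul_le_one hA, mul_assoc, mul_comm A⁻¹,
        ← le_inv_iff_mul_le_one (mul_ne_zero_of_ne_zero hA hA'), spanSingleton_le_iff_mem]
      exact hx
    have hfg : (A⁻¹ : FractionalIdeal R⁰ (FractionRing R)).coeToSubmodule.FG := by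
      have := FractionalIdeal.isNoetherian A⁻¹
      exact (Submodule.fg_top _).mp (this.noetherian ⊤)
    have hint : IsIntegral R x :=
      isIntegral_of_smul_mem_submodule
        (A⁻¹ : FractionalIdeal R⁰ (FractionRing R)).coeToSubmodule
        (fun h ↦ hA' (coeToSubmodule_eq_bot.mp h)) hfg x
        (fun n hn ↦ h1 (mul_mem_mul (mem_spanSingleton_self R⁰ x) hn))
    obtain ⟨r, hr⟩ := IsIntegrallyClosed.isIntegral_iff.mp hint
    exact (mem_one_iff _).mpr ⟨r, hr⟩
  · rw [le_inv_iff_mul_le_one (mul_ne_zero_of_ne_zero hA hA'), one_mul]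
    exact mul_one_div_le_one

theorem FractionalIdeal.divHull_spanSingleton (x : FractionRing R) :
    (spanSingleton R⁰ x).divHull = spanSingleton R⁰ x := by
  rw [divHull, spanSingleton_inv, spanSingleton_inv, inv_inv]

variable (R)

/-- Divisorial fractional ideals: nonzero fractional ideals `A` of `R` with `A = (R : (R : A))`.
These are the nonzero fractional ideals that are reflexive as `R`-modules. -/
def DivisorialIdeal : Type u :=
  {A : FractionalIdeal R⁰ (FractionRing R) // A ≠ 0 ∧ A.divHull = A}

variable {R}

namespace DivisorialIdeal

open FractionalIdeal

/-- The divisorial ideal generated by a nonzero fractional ideal. -/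
noncomputable def mk (A : FractionalIdeal R⁰ (FractionRing R)) (hA : A ≠ 0) : DivisorialIdeal R :=
  ⟨A.divHull, divHull_ne_zero hA, divHull_divHull hA⟩

/-- Divisorial fractional ideals of a noetherian integrally closed domain form a group: the product
of `A` and `B` is the divisorial hull of `A * B`, the inverse of `A` is `(R : A)`. -/
noncomputable instance [IsNoetherianRing R] [IsIntegrallyClosed R] :
    CommGroup (DivisorialIdeal R) where
  mul A B := mk (A.1 * B.1) (mul_ne_zero_of_ne_zero A.2.1 B.2.1)
  one := mk 1 one_ne_zero_fractionRing
  inv A := mk A.1⁻¹ (inv_ne_zero_of_ne_zero A.2.1)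
  mul_assoc A B C := Subtype.ext <| by
    change ((A.1 * B.1).divHull * C.1).divHull = (A.1 * (B.1 * C.1).divHull).divHull
    rw [divHull_divHull_mul (mul_ne_zero_of_ne_zero A.2.1 B.2.1) C.2.1,
      divHull_mul_divHull A.2.1 (mul_ne_zero_of_ne_zero B.2.1 C.2.1), mul_assoc]
  one_mul A := Subtype.ext <| by
    change ((1 : FractionalIdeal R⁰ (FractionRing R)).divHull * A.1).divHull = A.1
    rw [divHull_divHull_mul one_ne_zero_fractionRing A.2.1, one_mul, A.2.2]
  mul_one A := Subtype.ext <| by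
    change (A.1 * (1 : FractionalIdeal R⁰ (FractionRing R)).divHull).divHull = A.1
    rw [divHull_mul_divHull A.2.1 one_ne_zero_fractionRing, mul_one, A.2.2]
  mul_comm A B := Subtype.ext <| by
    change (A.1 * B.1).divHull = (B.1 * A.1).divHull
    rw [mul_comm]
  inv_mul_cancel A := Subtype.ext <| by
    change (A.1⁻¹.divHull * A.1).divHull = (1 : FractionalIdeal R⁰ (FractionRing R)).divHull
    rw [divHull_divHull_mul (inv_ne_zero_of_ne_zero A.2.1) A.2.1, mul_comm,
      divHull_mul_inv A.2.1, divHull, inv_one, inv_one]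

variable (R) in
/-- The homomorphism sending a nonzero element `x` of the fraction field to the principal
fractional ideal `R x`. -/
noncomputable def principal [IsNoetherianRing R] [IsIntegrallyClosed R] :
    (FractionRing R)ˣ →* DivisorialIdeal R where
  toFun x := ⟨spanSingleton R⁰ (x : FractionRing R), spanSingleton_ne_zero_iff.mpr x.ne_zero,
    divHull_spanSingleton _⟩
  map_one' := Subtype.ext <| by
    change spanSingleton R⁰ ((1 : (FractionRing R)ˣ) : FractionRing R) =
      (1 : FractionalIdeal R⁰ (FractionRing R)).divHull
    rw [← spanSingleton_one, divHull_spanSingleton, Units.val_one]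
  map_mul' x y := Subtype.ext <| by
    change spanSingleton R⁰ ((x * y : (FractionRing R)ˣ) : FractionRing R) =
      (spanSingleton R⁰ (x : FractionRing R) * spanSingleton R⁰ (y : FractionRing R)).divHull
    rw [spanSingleton_mul_spanSingleton, divHull_spanSingleton, Units.val_mul]

end DivisorialIdeal

variable (R) [IsNoetherianRing R] [IsIntegrallyClosed R]

/-- The divisor class group `Cl(R)` of a noetherian normal domain, written additively: divisorial
fractional ideals modulo principal ones. -/
abbrev DivisorClassGroup : Type u :=
  Additive (DivisorialIdeal R ⧸ (DivisorialIdeal.principal R).range)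

variable {R}

namespace DivisorClassGroup

/-- The class in `Cl(R)` of a divisorial fractional ideal. -/
noncomputable def mk (D : DivisorialIdeal R) : DivisorClassGroup R :=
  Additive.ofMul (QuotientGroup.mk D)

/-- The class in `Cl(R)` of a nonzero ideal `I` of `R`, that is, the class of its divisorial
hull, which is `I` itself if `I` is reflexive. -/
noncomputable def ofIdeal (I : Ideal R) (hI : I ≠ ⊥) : DivisorClassGroup R :=
  mk (DivisorialIdeal.mk (I : FractionalIdeal R⁰ (FractionRing R))
    (FractionalIdeal.coeIdeal_ne_zero.mpr hI))

/-- A point of `Cl(R)` is maximal Cohen-Macaulay if it is represented by a divisorial fractional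
ideal (equivalently, a reflexive module of rank one) that is a maximal Cohen-Macaulay module. -/
def IsMaximalCohenMacaulayPoint (c : DivisorClassGroup R) : Prop :=
  ∃ D : DivisorialIdeal R, mk D = c ∧
    IsMaximalCohenMacaulay R (D.1 : Submodule R (FractionRing R))

end DivisorClassGroup

end DivisorClassGroup

/-- An ideal of height one in a domain is nonzero. -/
theorem Ideal.ne_bot_of_height_one {R : Type u} [CommRing R] [IsDomain R] {I : Ideal R}
    (hI : I.height = 1) : I ≠ ⊥ := by
  rintro rfl
  simp at hI

/-! Let `d = dim R` and let `D`, `E` be the divisorial ideals of `I`, `J`; the points in question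
are the classes of `E * D ^ n`. Since `R` is Gorenstein and `R ⧸ I` is Gorenstein of dimension `d -
1`, the module `Ext¹(R ⧸ I, R)`, a canonical module of `R ⧸ I`, is cyclic. It is `I⁻¹ / R`, so `I⁻¹`
is generated by `1` and one more element `f` (`exists_dual_generator`). For every divisorial `L`
this yields an exact sequence `0 → L * D → L × L → L * D⁻¹` (`IsInvGenerator.exact`). The cokernel
of its last map is supported only at the maximal ideal, because `I` is principal at all other
primes.

(1) Apply `Ext^j(-, R)` with `0 < j < d - 1`. As `Ext^(j+1)` of the cokernel vanishes, the lengths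
`ℓ i` of `Ext^j(E * D ^ i, R)` satisfy `2 ℓ i ≤ ℓ (i - 1) + ℓ (i + 1)` (`two_mul_length_le`). A
convex nonnegative function that vanishes at `0` and `n` vanishes in between. For `j ≥ d - 1` the
`Ext` vanishes because divisorial ideals have depth at least two. Over a Gorenstein ring, vanishing
of `Ext^j(-, R)` for all `j > 0` is the same as depth `d` for divisorial ideals.

(2) Take `L = E⁻¹ * D`. Then `L * D = (E * D ^ (-2))⁻¹` is the dual of a maximal Cohen-Macaulay
module, so it has depth `d ≥ 3`, which forces the cokernel to vanish: `E⁻¹ = L + L f`. But `E⁻¹` is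
also generated by two elements. By `range_eq_top_or_exists_span_pair_eq_top`, either `E⁻¹ = L c`
with `c = 1` or `c = f`, and then `D` is principal, or `E⁻¹ = b D⁻¹` for some `b`. In the latter
case `E` and `D` have the same class, `D * D` is maximal Cohen-Macaulay by (1), and the same
argument with `L = D` gives `1 = a + b f` with `a`, `b f` in `R`. One of them is a unit, so `D` is
principal. -/

/-! ### `Ext` of unbundled modules and its long exact sequences. -/

section ExtToolkit

open CategoryTheory CategoryTheory.Abelian

/-- The `R`-module `Ext^n(M, N)` of two unbundled `R`-modules. -/
abbrev ExtM (R : Type u) [CommRing R] (M N : Type u) [AddCommGroup M] [Module R M]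
    [AddCommGroup N] [Module R N] (n : ℕ) : Type u :=
  Ext.{u} (ModuleCat.of R M) (ModuleCat.of R N) n

namespace ExtM

variable {R : Type u} [CommRing R]
variable {M N X Y Z : Type u} [AddCommGroup M] [Module R M] [AddCommGroup N] [Module R N]
  [AddCommGroup X] [Module R X] [AddCommGroup Y] [Module R Y] [AddCommGroup Z] [Module R Z]

/-- `Ext^n(-, Y)` applied to a linear map. -/
noncomputable def pre (Y : Type u) [AddCommGroup Y] [Module R Y] (f : M →ₗ[R] N) (n : ℕ) :
    ExtM R N Y n →ₗ[R] ExtM R M Y n :=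
  (Ext.mk₀ (ModuleCat.ofHom f)).precompOfLinear R _ (zero_add n)

/-- `Ext^n(X, -)` applied to a linear map. -/
noncomputable def post (X : Type u) [AddCommGroup X] [Module R X] (f : M →ₗ[R] N) (n : ℕ) :
    ExtM R X M n →ₗ[R] ExtM R X N n :=
  (Ext.mk₀ (ModuleCat.ofHom f)).postcompOfLinear R _ (add_zero n)

/-- Left Yoneda multiplication by an extension class. -/
noncomputable def preClass {a : ℕ} (Y : Type u) [AddCommGroup Y] [Module R Y] (e : ExtM R M N a)
    (n : ℕ) : ExtM R N Y n →ₗ[R] ExtM R M Y (a + n) :=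
  e.precompOfLinear R _ rfl

/-- Right Yoneda multiplication by an extension class. -/
noncomputable def postClass {a : ℕ} (X : Type u) [AddCommGroup X] [Module R X]
    (e : ExtM R M N a) (n : ℕ) : ExtM R X M n →ₗ[R] ExtM R X N (n + a) :=
  e.postcompOfLinear R _ rfl

theorem pre_id (n : ℕ) : pre Y (LinearMap.id : M →ₗ[R] M) n = LinearMap.id := by
  ext e
  exact Ext.mk₀_id_comp e

theorem pre_comp (f : M →ₗ[R] N) (g : N →ₗ[R] X) (n : ℕ) :
    pre Y (g ∘ₗ f) n = pre Y f n ∘ₗ pre Y g n := by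
  ext e
  exact (Ext.mk₀_comp_mk₀_assoc (ModuleCat.ofHom f) (ModuleCat.ofHom g) e).symm

theorem pre_smul (r : R) (f : M →ₗ[R] N) (n : ℕ) : pre Y (r • f) n = r • pre Y f n := by
  ext e
  change (Ext.mk₀ (r • ModuleCat.ofHom f)).comp e (zero_add n) =
    r • (Ext.mk₀ (ModuleCat.ofHom f)).comp e (zero_add n)
  rw [Ext.mk₀_smul, Ext.smul_comp]

theorem pre_zero (n : ℕ) : pre Y (0 : M →ₗ[R] N) n = 0 := by
  have := pre_smul (Y := Y) (0 : R) (0 : M →ₗ[R] N) n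
  rwa [zero_smul, zero_smul] at this

theorem pre_smul_id (r : R) (n : ℕ) (e : ExtM R M Y n) :
    pre Y (LinearMap.lsmul R M r) n e = r • e := by
  have : LinearMap.lsmul R M r = r • LinearMap.id := by ext; simp
  rw [this, pre_smul, pre_id]
  rfl

theorem post_smul_id (r : R) (n : ℕ) (e : ExtM R X M n) :
    post X (LinearMap.lsmul R M r) n e = r • e :=
  (Ext.smul_eq_comp_mk₀ e r).symm

theorem post_id (n : ℕ) : post X (LinearMap.id : M →ₗ[R] M) n = LinearMap.id := by
  ext e
  exact Ext.comp_mk₀_id e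

theorem post_comp (f : M →ₗ[R] N) (g : N →ₗ[R] Z) (n : ℕ) :
    post X (g ∘ₗ f) n = post X g n ∘ₗ post X f n := by
  ext e
  have h : Ext.mk₀ (ModuleCat.ofHom (g ∘ₗ f)) =
    (Ext.mk₀ (ModuleCat.ofHom f)).comp (Ext.mk₀ (ModuleCat.ofHom g)) (zero_add 0) := by
    rw [Ext.mk₀_comp_mk₀]; rfl
  change Ext.comp e (Ext.mk₀ (ModuleCat.ofHom (g ∘ₗ f))) (add_zero n) =
    Ext.comp (Ext.comp e (Ext.mk₀ (ModuleCat.ofHom f)) (add_zero n)) (Ext.mk₀ (ModuleCat.ofHom g))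
      (add_zero n)
  rw [h, Ext.comp_assoc_of_third_deg_zero]

variable (R M N) in
/-- `Ext^0(M, N) = Hom(M, N)`. -/
noncomputable def zeroEquiv : (M →ₗ[R] N) ≃ₗ[R] ExtM R M N 0 :=
  (Ext.linearEquiv₀.trans ModuleCat.homLinearEquiv).symm

theorem pre_zeroEquiv (f : X →ₗ[R] M) (g : M →ₗ[R] N) :
    pre N f 0 (zeroEquiv R M N g) = zeroEquiv R X N (g ∘ₗ f) :=
  Ext.mk₀_comp_mk₀ _ _

theorem post_zeroEquiv (f : X →ₗ[R] M) (g : M →ₗ[R] N) :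
    post X g 0 (zeroEquiv R X M f) = zeroEquiv R X N (g ∘ₗ f) :=
  Ext.mk₀_comp_mk₀ _ _

theorem subsingleton_of_free [Module.Free R M] (n : ℕ) (hn : 0 < n) :
    Subsingleton (ExtM R M Y n) := by
  obtain ⟨n, rfl⟩ := Nat.exists_eq_succ_of_ne_zero hn.ne'
  have : Projective (ModuleCat.of R M) := ModuleCat.projective_of_free (Module.Free.chooseBasis R M)
  exact Ext.subsingleton_of_projective _ _ _

theorem subsingleton_congr_left (e : M ≃ₗ[R] N) (n : ℕ) :
    Subsingleton (ExtM R M Y n) ↔ Subsingleton (ExtM R N Y n) := by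
  have key : ∀ {A B : Type u} [AddCommGroup A] [Module R A] [AddCommGroup B] [Module R B],
      (A ≃ₗ[R] B) → Subsingleton (ExtM R A Y n) → Subsingleton (ExtM R B Y n) := by
    intro A B _ _ _ _ e h
    refine subsingleton_of_forall_eq 0 fun x ↦ ?_
    have h1 := LinearMap.congr_fun (pre_comp (Y := Y) e.symm.toLinearMap e.toLinearMap n) x
    rw [LinearEquiv.comp_symm, pre_id] at h1
    rw [LinearMap.id_apply] at h1
    rw [h1, LinearMap.comp_apply, Subsingleton.elim (pre Y e.toLinearMap n x) 0, map_zero]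
  exact ⟨key e, key e.symm⟩

theorem subsingleton_congr_right (e : M ≃ₗ[R] N) (n : ℕ) :
    Subsingleton (ExtM R X M n) ↔ Subsingleton (ExtM R X N n) := by
  have key : ∀ {A B : Type u} [AddCommGroup A] [Module R A] [AddCommGroup B] [Module R B],
      (A ≃ₗ[R] B) → Subsingleton (ExtM R X A n) → Subsingleton (ExtM R X B n) := by
    intro A B _ _ _ _ e h
    refine subsingleton_of_forall_eq 0 fun x ↦ ?_
    have h1 := LinearMap.congr_fun (post_comp (X := X) e.symm.toLinearMap e.toLinearMap n) x
    rw [LinearEquiv.comp_symm, post_id] at h1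
    rw [LinearMap.id_apply] at h1
    rw [h1, LinearMap.comp_apply, Subsingleton.elim (post X e.symm.toLinearMap n x) 0, map_zero]
  exact ⟨key e, key e.symm⟩

theorem subsingleton_of_subsingleton_left [Subsingleton M] (n : ℕ) :
    Subsingleton (ExtM R M Y n) := by
  refine subsingleton_of_forall_eq 0 fun x ↦ ?_
  have h1 := LinearMap.congr_fun (pre_id (R := R) (M := M) (Y := Y) n) x
  rw [Subsingleton.elim (LinearMap.id : M →ₗ[R] M) 0, pre_zero] at h1
  exact h1.symm

theorem smul_eq_zero_left {r : R} (hr : ∀ m : M, r • m = 0) (n : ℕ) (e : ExtM R M Y n) :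
    r • e = 0 := by
  rw [← pre_smul_id, show LinearMap.lsmul R M r = 0 from LinearMap.ext hr, pre_zero]
  rfl

section Sequences

variable {f : M →ₗ[R] N} {g : N →ₗ[R] X} (hf : Function.Injective f) (hg : Function.Surjective g)
  (hfg : Function.Exact f g)

include hf hg hfg

/-- The extension class of a short exact sequence, with the exactness of both long exact
sequences of `Ext`. -/
theorem exists_class : ∃ e : ExtM R X M 1,
    (∀ (Y : Type u) [AddCommGroup Y] [Module R Y] (n : ℕ),
      Function.Exact (pre Y g n) (pre Y f n) ∧ Function.Exact (pre Y f n) (preClass Y e n) ∧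
      Function.Exact (preClass Y e n) (pre Y g (1 + n))) ∧
    (∀ (Y : Type u) [AddCommGroup Y] [Module R Y] (n : ℕ),
      Function.Exact (post Y f n) (post Y g n) ∧ Function.Exact (post Y g n) (postClass Y e n) ∧
      Function.Exact (postClass Y e n) (post Y f (n + 1))) := by
  let S : ShortComplex (ModuleCat.{u} R) :=
    ModuleCat.shortComplexOfCompEqZero f g hfg.linearMap_comp_eq_zero
  have hS : S.ShortExact := ModuleCat.shortComplex_shortExact S hfg hf hg
  refine ⟨hS.extClass, fun Y _ _ n ↦ ⟨?_, ?_, ?_⟩, fun Y _ _ n ↦ ⟨?_, ?_, ?_⟩⟩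
  · exact (ShortComplex.ab_exact_iff_function_exact _).mp
      (Ext.contravariant_sequence_exact₂' hS (ModuleCat.of R Y) n)
  · exact (ShortComplex.ab_exact_iff_function_exact _).mp
      (Ext.contravariant_sequence_exact₁' hS (ModuleCat.of R Y) n (1 + n) rfl)
  · exact (ShortComplex.ab_exact_iff_function_exact _).mp
      (Ext.contravariant_sequence_exact₃' hS (ModuleCat.of R Y) n (1 + n) rfl)
  · exact (ShortComplex.ab_exact_iff_function_exact _).mp
      (Ext.covariant_sequence_exact₂' (ModuleCat.of R Y) hS n)
  · exact (ShortComplex.ab_exact_iff_function_exact _).mp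
      (Ext.covariant_sequence_exact₃' (ModuleCat.of R Y) hS n (n + 1) rfl)
  · exact (ShortComplex.ab_exact_iff_function_exact _).mp
      (Ext.covariant_sequence_exact₁' (ModuleCat.of R Y) hS n (n + 1) rfl)

variable (T : Type u) [AddCommGroup T] [Module R T]

theorem pre_exact (n : ℕ) : Function.Exact (pre T g n) (pre T f n) := by
  obtain ⟨e, h, -⟩ := exists_class hf hg hfg
  exact (h T n).1

theorem exists_pre_connecting (n : ℕ) : ∃ δ : ExtM R M T n →ₗ[R] ExtM R X T (n + 1),
    Function.Exact (pre T f n) δ ∧ Function.Exact δ (pre T g (n + 1)) := by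
  obtain ⟨e, h, -⟩ := exists_class hf hg hfg
  rw [add_comm n 1]
  exact ⟨_, (h T n).2⟩

theorem post_exact (n : ℕ) : Function.Exact (post T f n) (post T g n) := by
  obtain ⟨e, -, h⟩ := exists_class hf hg hfg
  exact (h T n).1

theorem exists_post_connecting (n : ℕ) : ∃ δ : ExtM R T X n →ₗ[R] ExtM R T M (n + 1),
    Function.Exact (post T g n) δ ∧ Function.Exact δ (post T f (n + 1)) := by
  obtain ⟨e, -, h⟩ := exists_class hf hg hfg
  exact ⟨_, (h T n).2⟩

theorem pre_surjective (n : ℕ) (h : Subsingleton (ExtM R X T (n + 1))) :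
    Function.Surjective (pre T f n) := by
  obtain ⟨δ, h1, -⟩ := exists_pre_connecting hf hg hfg T n
  exact fun x ↦ (h1 x).mp (Subsingleton.elim _ _)

theorem pre_injective (n : ℕ) (h : Subsingleton (ExtM R M T n)) :
    Function.Injective (pre T g (n + 1)) := by
  obtain ⟨δ, -, h1⟩ := exists_pre_connecting hf hg hfg T n
  refine (injective_iff_map_eq_zero _).mpr fun x hx ↦ ?_
  obtain ⟨y, rfl⟩ := (h1 x).mp hx
  rw [Subsingleton.elim y 0, map_zero]

theorem post_surjective (n : ℕ) (h : Subsingleton (ExtM R T M (n + 1))) :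
    Function.Surjective (post T g n) := by
  obtain ⟨δ, h1, -⟩ := exists_post_connecting hf hg hfg T n
  exact fun x ↦ (h1 x).mp (Subsingleton.elim _ _)

theorem post_injective (n : ℕ) (h : Subsingleton (ExtM R T X n)) :
    Function.Injective (post T f (n + 1)) := by
  obtain ⟨δ, -, h1⟩ := exists_post_connecting hf hg hfg T n
  refine (injective_iff_map_eq_zero _).mpr fun x hx ↦ ?_
  obtain ⟨y, rfl⟩ := (h1 x).mp hx
  rw [Subsingleton.elim y 0, map_zero]

theorem pre_subsingleton₂ (n : ℕ) (h1 : Subsingleton (ExtM R M T n))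
    (h3 : Subsingleton (ExtM R X T n)) : Subsingleton (ExtM R N T n) := by
  refine subsingleton_of_forall_eq 0 fun x ↦ ?_
  obtain ⟨y, rfl⟩ := (pre_exact hf hg hfg T n x).mp (Subsingleton.elim _ _)
  rw [Subsingleton.elim y 0, map_zero]

theorem pre_subsingleton₁ (n : ℕ) (h2 : Subsingleton (ExtM R N T n))
    (h3 : Subsingleton (ExtM R X T (n + 1))) : Subsingleton (ExtM R M T n) :=
  (pre_surjective hf hg hfg T n h3).subsingleton

theorem pre_subsingleton₃ (n : ℕ) (h1 : Subsingleton (ExtM R M T n))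
    (h2 : Subsingleton (ExtM R N T (n + 1))) : Subsingleton (ExtM R X T (n + 1)) :=
  (pre_injective hf hg hfg T n h1).subsingleton

theorem post_subsingleton₂ (n : ℕ) (h1 : Subsingleton (ExtM R T M n))
    (h3 : Subsingleton (ExtM R T X n)) : Subsingleton (ExtM R T N n) := by
  refine subsingleton_of_forall_eq 0 fun x ↦ ?_
  obtain ⟨y, rfl⟩ := (post_exact hf hg hfg T n x).mp (Subsingleton.elim _ _)
  rw [Subsingleton.elim y 0, map_zero]

theorem post_subsingleton₃ (n : ℕ) (h2 : Subsingleton (ExtM R T N n))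
    (h1 : Subsingleton (ExtM R T M (n + 1))) : Subsingleton (ExtM R T X n) :=
  (post_surjective hf hg hfg T n h1).subsingleton

theorem post_subsingleton₁ (n : ℕ) (h3 : Subsingleton (ExtM R T X n))
    (h2 : Subsingleton (ExtM R T N (n + 1))) : Subsingleton (ExtM R T M (n + 1)) :=
  (post_injective hf hg hfg T n h3).subsingleton

end Sequences

theorem post_zero_injective {f : M →ₗ[R] N} (hf : Function.Injective f) :
    Function.Injective (post Y f 0) := by
  refine (injective_iff_map_eq_zero _).mpr fun x hx ↦ ?_
  obtain ⟨φ, rfl⟩ := (zeroEquiv R Y M).surjective x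
  rw [post_zeroEquiv, LinearEquiv.map_eq_zero_iff] at hx
  rw [LinearEquiv.map_eq_zero_iff]
  exact LinearMap.ext fun y ↦ hf (by simpa using LinearMap.congr_fun hx y)

theorem post_subsingleton_prod (n : ℕ) (hM : Subsingleton (ExtM R Y M n))
    (hN : Subsingleton (ExtM R Y N n)) : Subsingleton (ExtM R Y (M × N) n) :=
  post_subsingleton₂ (f := LinearMap.inl R M N) (g := LinearMap.snd R M N)
    LinearMap.inl_injective LinearMap.snd_surjective Function.Exact.inl_snd Y n hM hN

theorem prod_pre_surjective (n : ℕ) :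
    Function.Surjective ((pre Y (LinearMap.inl R M N) n).prod (pre Y (LinearMap.inr R M N) n)) := by
  rintro ⟨a, b⟩
  refine ⟨pre Y (LinearMap.fst R M N) n a + pre Y (LinearMap.snd R M N) n b, ?_⟩
  have h1 := LinearMap.congr_fun (pre_comp (Y := Y) (LinearMap.inl R M N) (LinearMap.fst R M N) n) a
  have h2 := LinearMap.congr_fun (pre_comp (Y := Y) (LinearMap.inr R M N) (LinearMap.fst R M N) n) a
  have h3 := LinearMap.congr_fun (pre_comp (Y := Y) (LinearMap.inl R M N) (LinearMap.snd R M N) n) b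
  have h4 := LinearMap.congr_fun (pre_comp (Y := Y) (LinearMap.inr R M N) (LinearMap.snd R M N) n) b
  rw [LinearMap.fst_comp_inl, pre_id] at h1
  rw [LinearMap.fst_comp_inr, pre_zero] at h2
  rw [LinearMap.snd_comp_inl, pre_zero] at h3
  rw [LinearMap.snd_comp_inr, pre_id] at h4
  simp only [LinearMap.comp_apply, LinearMap.id_apply, LinearMap.zero_apply] at h1 h2 h3 h4
  refine Prod.ext ?_ ?_
  · change pre Y (LinearMap.inl R M N) n _ = a
    rw [map_add, ← h1, ← h3, add_zero]
  · change pre Y (LinearMap.inr R M N) n _ = b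
    rw [map_add, ← h2, ← h4, zero_add]

end ExtM

end ExtToolkit

/-! ### Regular sequences and `Ext`: Nakayama arguments and Rees' theorem. -/

section RegularSequences

open RingTheory.Sequence IsLocalRing Pointwise

variable {R : Type u} [CommRing R]
variable {M N X Y : Type u} [AddCommGroup M] [Module R M] [AddCommGroup N] [Module R N]
  [AddCommGroup X] [Module R X] [AddCommGroup Y] [Module R Y]

theorem subsingleton_of_smul_surjective [IsLocalRing R] [Module.Finite R M] {x : R}
    (hx : x ∈ maximalIdeal R) (h : ∀ m : M, ∃ m', x • m' = m) : Subsingleton M := by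
  rw [← Submodule.subsingleton_iff R, ← subsingleton_iff_bot_eq_top, eq_comm]
  refine Submodule.eq_bot_of_le_smul_of_le_jacobson_bot (maximalIdeal R) ⊤
    Module.Finite.fg_top (fun m _ ↦ ?_) (maximalIdeal_le_jacobson _)
  obtain ⟨m', rfl⟩ := h m
  exact Submodule.smul_mem_smul hx trivial

namespace ExtM

theorem pre_surjective_of_injective {f : M →ₗ[R] N} (hf : Function.Injective f) (n : ℕ)
    (h : Subsingleton (ExtM R (N ⧸ LinearMap.range f) Y (n + 1))) :
    Function.Surjective (pre Y f n) :=
  pre_surjective hf (Submodule.mkQ_surjective _) (LinearMap.exact_map_mkQ_range f) Y n h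

section QuotSMulTop

variable {x : R} (hx : IsSMulRegular M x)

include hx

theorem smul_surjective_of_subsingleton (n : ℕ)
    (h : Subsingleton (ExtM R (QuotSMulTop x M) Y (n + 1))) (e : ExtM R M Y n) :
    ∃ e', x • e' = e := by
  obtain ⟨e', he'⟩ := pre_surjective (f := LinearMap.lsmul R M x) hx
    (Submodule.mkQ_surjective _) (LinearMap.exact_lsmul_mkQ_smul_top M x) Y n h e
  exact ⟨e', by rw [← he', pre_smul_id]⟩

theorem subsingleton_of_quotSMulTop [IsNoetherianRing R] [IsLocalRing R] [Module.Finite R M]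
    [Module.Finite R Y] (hxm : x ∈ maximalIdeal R) (n : ℕ)
    (h : Subsingleton (ExtM R (QuotSMulTop x M) Y (n + 1))) : Subsingleton (ExtM R M Y n) :=
  subsingleton_of_smul_surjective hxm (smul_surjective_of_subsingleton hx n h)

end QuotSMulTop

/-- When `Ext^(j+1)(N / xN, Y)` vanishes, `x` acts surjectively on `Ext^j(N, Y)`, which is then zero
by Nakayama. Each regular element thus lowers the vanishing bound by one. -/
theorem subsingleton_of_isWeaklyRegular [IsNoetherianRing R] [IsLocalRing R] [Module.Finite R Y]
    {n : ℕ} (hY : ∀ (N : Type u) [AddCommGroup N] [Module R N] [Module.Finite R N] (j : ℕ),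
      n < j → Subsingleton (ExtM R N Y j)) (rs : List R) (hrs : ∀ r ∈ rs, r ∈ maximalIdeal R)
    (N : Type u) [AddCommGroup N] [Module R N] [Module.Finite R N] (h : IsWeaklyRegular N rs)
    (j : ℕ) (hj : n < j + rs.length) : Subsingleton (ExtM R N Y j) := by
  induction rs generalizing N j with
  | nil => exact hY N j hj
  | cons x rs ih =>
    rw [isWeaklyRegular_cons_iff] at h
    refine subsingleton_of_quotSMulTop h.1 (hrs x (by simp)) j
      (ih (fun r hr ↦ hrs r (by simp [hr])) _ h.2 (j + 1) ?_)
    rw [List.length_cons] at hj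
    omega

/-- If `Ext^i` into `Y` vanishes on finite length modules in degrees `< d`, then it vanishes on
modules with a system of regular elements with finite length quotient in degrees `< d - length`. -/
theorem subsingleton_of_lt_of_isWeaklyRegular [IsNoetherianRing R] [IsLocalRing R]
    [Module.Finite R Y] (d : ℕ) (rs : List R) (hrs : ∀ r ∈ rs, r ∈ maximalIdeal R)
    (N : Type u) [AddCommGroup N] [Module R N] [Module.Finite R N] (h : IsWeaklyRegular N rs)
    (hN : ∀ j < d, Subsingleton (ExtM R (N ⧸ (Ideal.ofList rs • ⊤ : Submodule R N)) Y j))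
    (j : ℕ) (hj : j + rs.length < d) : Subsingleton (ExtM R N Y j) := by
  induction rs generalizing N j with
  | nil =>
    have e : (N ⧸ (Ideal.ofList ([] : List R) • ⊤ : Submodule R N)) ≃ₗ[R] N :=
      Submodule.quotEquivOfEqBot _ (by simp)
    exact (subsingleton_congr_left e j).mp (hN j hj)
  | cons x rs ih =>
    rw [isWeaklyRegular_cons_iff] at h
    refine subsingleton_of_quotSMulTop h.1 (hrs x (by simp)) j
      (ih (fun r hr ↦ hrs r (by simp [hr])) _ h.2 (fun i hi ↦ ?_) (j + 1) ?_)
    · exact (subsingleton_congr_left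
        (Submodule.quotOfListConsSMulTopEquivQuotSMulTopInner N x rs) i).mp (hN i hi)
    · rw [List.length_cons] at hj
      omega

theorem subsingleton_quotient_of_isWeaklyRegular (a : ℕ) (rs : List R)
    (N : Type u) [AddCommGroup N] [Module R N] (h : IsWeaklyRegular N rs)
    (hN : ∀ j, a < j → Subsingleton (ExtM R N Y j)) (j : ℕ) (hj : a + rs.length < j) :
    Subsingleton (ExtM R (N ⧸ (Ideal.ofList rs • ⊤ : Submodule R N)) Y j) := by
  induction rs generalizing N a with
  | nil =>
    have e : (N ⧸ (Ideal.ofList ([] : List R) • ⊤ : Submodule R N)) ≃ₗ[R] N :=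
      Submodule.quotEquivOfEqBot _ (by simp)
    exact (subsingleton_congr_left e j).mpr (hN j hj)
  | cons x rs ih =>
    rw [isWeaklyRegular_cons_iff] at h
    refine (subsingleton_congr_left
        (Submodule.quotOfListConsSMulTopEquivQuotSMulTopInner N x rs) j).mpr
      (ih (a + 1) _ h.2 (fun i hi ↦ ?_) (by rw [List.length_cons] at hj; omega))
    obtain ⟨i, rfl⟩ : ∃ i', i = i' + 1 := ⟨i - 1, by omega⟩
    exact pre_subsingleton₃ (f := LinearMap.lsmul R N x) h.1
      (Submodule.mkQ_surjective _) (LinearMap.exact_lsmul_mkQ_smul_top N x) Y i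
      (hN i (by omega)) (hN (i + 1) (by omega))

/-- Rees: `Ext^i(N, M) = 0` for `i < length rs` if `rs` is weakly `M`-regular and kills `N`. -/
theorem subsingleton_of_lt_length (rs : List R) (M : Type u) [AddCommGroup M] [Module R M]
    (h : IsWeaklyRegular M rs) (hN : ∀ r ∈ rs, ∀ n : N, r • n = 0) (i : ℕ) (hi : i < rs.length) :
    Subsingleton (ExtM R N M i) := by
  induction rs generalizing M i with
  | nil => simp at hi
  | cons x rs ih =>
    rw [isWeaklyRegular_cons_iff] at h
    have hxN := hN x (by simp)
    cases i with
    | zero =>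
      refine (zeroEquiv R N M).symm.toEquiv.subsingleton_congr.mpr
        (subsingleton_of_forall_eq 0 fun φ ↦ LinearMap.ext fun n ↦ h.1 ?_)
      change x • φ n = x • (0 : M)
      rw [← map_smul, hxN, map_zero, smul_zero]
    | succ i =>
      have hinj := post_injective (f := LinearMap.lsmul R M x) h.1
        (Submodule.mkQ_surjective _) (LinearMap.exact_lsmul_mkQ_smul_top M x) N i
        (ih _ h.2 (fun r hr ↦ hN r (by simp [hr])) i (by simpa using hi))
      refine subsingleton_of_forall_eq 0 fun e ↦ hinj ?_
      rw [post_smul_id, smul_eq_zero_left hxN, map_zero]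

/-- Rees: a weakly `M`-regular sequence `rs` gives a class in `Ext^r(M / rs M, M)` inducing
bijections `Hom(N, M / rs M) → Ext^r(N, M)` for all modules `N` killed by `rs`. -/
theorem exists_class_of_isWeaklyRegular (rs : List R) (M : Type u) [AddCommGroup M] [Module R M]
    (h : IsWeaklyRegular M rs) :
    ∃ e : ExtM R (M ⧸ (Ideal.ofList rs • ⊤ : Submodule R M)) M rs.length,
      ∀ (N : Type u) [AddCommGroup N] [Module R N], (∀ r ∈ rs, ∀ n : N, r • n = 0) →
        Function.Bijective fun φ : N →ₗ[R] M ⧸ (Ideal.ofList rs • ⊤ : Submodule R M) ↦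
          pre M φ rs.length e := by
  induction rs generalizing M with
  | nil =>
    let E : (M ⧸ (Ideal.ofList ([] : List R) • ⊤ : Submodule R M)) ≃ₗ[R] M :=
      Submodule.quotEquivOfEqBot _ (by simp)
    refine ⟨zeroEquiv R _ M E.toLinearMap, fun N _ _ _ ↦ ?_⟩
    have h1 : (fun φ : N →ₗ[R] M ⧸ (Ideal.ofList ([] : List R) • ⊤ : Submodule R M) ↦
        pre M φ ([] : List R).length (zeroEquiv R _ M E.toLinearMap)) =
        fun φ ↦ zeroEquiv R N M (E.congrRight φ) :=
      funext fun φ ↦ pre_zeroEquiv φ E.toLinearMap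
    rw [h1]
    exact (zeroEquiv R N M).bijective.comp (LinearEquiv.bijective _)
  | cons x rs ih =>
    rw [isWeaklyRegular_cons_iff] at h
    obtain ⟨e', he'⟩ := ih _ h.2
    obtain ⟨c, -, hc⟩ := exists_class (f := LinearMap.lsmul R M x) h.1
        (Submodule.mkQ_surjective _) (LinearMap.exact_lsmul_mkQ_smul_top M x)
    let E := Submodule.quotOfListConsSMulTopEquivQuotSMulTopInner M x rs
    refine ⟨pre M E.toLinearMap _ (postClass _ c rs.length e'), fun N _ _ hN ↦ ?_⟩
    -- Since `x` kills `N`, the connecting map `Ext^r(N, M / xM) → Ext^(r+1)(N, M)` is bijective: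
    -- the term before it vanishes by `subsingleton_of_lt_length`, and multiplication by `x` after
    -- it is zero.
    have hbij : Function.Bijective (postClass N c rs.length) := by
      constructor
      · refine (injective_iff_map_eq_zero _).mpr fun y hy ↦ ?_
        obtain ⟨z, rfl⟩ := ((hc N rs.length).2.1 y).mp hy
        have := subsingleton_of_lt_length (x :: rs) M
          ((isWeaklyRegular_cons_iff M x rs).mpr h) hN rs.length (by simp)
        rw [Subsingleton.elim z 0, map_zero]
      · refine fun y ↦ ((hc N rs.length).2.2 y).mp ?_
        rw [post_smul_id, smul_eq_zero_left (hN x (by simp))]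
    have h1 : (fun φ : N →ₗ[R] M ⧸ (Ideal.ofList (x :: rs) • ⊤ : Submodule R M) ↦
        pre M φ (x :: rs).length (pre M E.toLinearMap _ (postClass _ c rs.length e'))) =
        (postClass N c rs.length) ∘ (fun ψ ↦ pre _ ψ rs.length e') ∘ E.congrRight := by
      funext φ
      have h2 : pre M φ (rs.length + 1) (pre M E.toLinearMap _ (postClass _ c rs.length e')) =
          pre M (E.toLinearMap ∘ₗ φ) _ (postClass _ c rs.length e') := by
        rw [pre_comp]; rfl
      refine h2.trans ?_
      exact (CategoryTheory.Abelian.Ext.comp_assoc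
        (CategoryTheory.Abelian.Ext.mk₀ (ModuleCat.ofHom (E.toLinearMap ∘ₗ φ))) e' c
        (zero_add _) rfl (by omega)).symm
    rw [h1]
    exact hbij.comp ((he' N fun r hr ↦ hN r (by simp [hr])).comp (LinearEquiv.bijective _))

end ExtM

theorem isWeaklyRegular_of_subsingleton [Subsingleton M] (rs : List R) : IsWeaklyRegular M rs := by
  induction rs generalizing M with
  | nil => exact IsWeaklyRegular.nil R M
  | cons x rs ih =>
    exact (isWeaklyRegular_cons_iff M x rs).mpr ⟨Function.injective_of_subsingleton _, ih⟩

/-- Used with `I = ⊤`, which imposes nothing, and with `I` the annihilator of a module supported at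
the maximal ideal, which makes the sequence kill that module. In both cases only the maximal ideal
contains `maximalIdeal R ⊓ I`, as needed for the homological criterion. -/
theorem exists_isWeaklyRegular_of_subsingleton_ext [IsNoetherianRing R] [IsLocalRing R]
    [Module.Finite R M] (I : Ideal R) (hI : ∀ p : Ideal R, p.IsPrime → I ≤ p → p = maximalIdeal R)
    (n : ℕ) (h : ∀ i < n, Subsingleton (ExtM R (R ⧸ maximalIdeal R) M i)) :
    ∃ rs : List R, rs.length = n ∧ (∀ r ∈ rs, r ∈ maximalIdeal R ∧ r ∈ I) ∧
      IsWeaklyRegular M rs := by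
  rcases subsingleton_or_nontrivial M with hM | hM
  -- On the zero module any sequence is weakly regular.
  · exact ⟨List.replicate n 0, by simp, fun r hr ↦ by simp [List.eq_of_mem_replicate hr],
      isWeaklyRegular_of_subsingleton _⟩
  · have hlt : (maximalIdeal R ⊓ I) • (⊤ : Submodule R M) < ⊤ := by
      refine lt_top_iff_ne_top.mpr fun h ↦ bot_ne_top (α := Submodule R M) ?_
      refine (Submodule.eq_bot_of_le_smul_of_le_jacobson_bot (maximalIdeal R) ⊤
        Module.Finite.fg_top ?_ (maximalIdeal_le_jacobson _)).symm
      rw [← h]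
      exact (Submodule.smul_mono_left inf_le_left).trans (by rw [h])
    obtain ⟨rs, h1, h2, h3⟩ := ModuleCat.exists_isRegular_of_exists_subsingleton_ext
      (maximalIdeal R ⊓ I) n (ModuleCat.of R M) hlt (ModuleCat.of R (R ⧸ maximalIdeal R)) (by
        change Module.support R (R ⧸ maximalIdeal R) = _
        rw [Module.support_eq_zeroLocus, Ideal.annihilator_quotient]
        ext p
        simp only [PrimeSpectrum.mem_zeroLocus, SetLike.coe_subset_coe]
        refine ⟨fun h ↦ inf_le_left.trans h, fun h ↦ ?_⟩
        rcases (Ideal.IsPrime.inf_le p.2).mp h with h | h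
        · exact h
        · rw [hI p.asIdeal p.2 h]) h
    exact ⟨rs, h1, h2, h3.toIsWeaklyRegular⟩

end RegularSequences

/-! ### From finite injective dimension to depth, dimension and vanishing. -/

section GorensteinRings

open RingTheory.Sequence IsLocalRing Pointwise

variable {R : Type u} [CommRing R]

/-- The data of a Gorenstein local ring of dimension `d` used below: `Ext` into `R` vanishes in
degrees above `d = dim R`, and there is a regular sequence of length `d` generating an ideal
primary to the maximal ideal. -/
structure IsGorensteinOfDim (R : Type u) [CommRing R] [IsLocalRing R] (d : ℕ) : Prop where
  ringKrullDim_eq : ringKrullDim R = d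
  subsingleton_ext (N : Type u) [AddCommGroup N] [Module R N] [Module.Finite R N] (j : ℕ) :
    d < j → Subsingleton (ExtM R N R j)
  exists_isWeaklyRegular : ∃ rs : List R, rs.length = d ∧ (∀ r ∈ rs, r ∈ maximalIdeal R) ∧
    IsWeaklyRegular R rs ∧
    ∀ p : Ideal R, p.IsPrime → Ideal.ofList rs ≤ p → p = maximalIdeal R

theorem mem_maximalIdeal_of_forall_smul_eq_zero {N : Type*} [AddCommGroup N] [Module R N]
    [IsLocalRing R] {n : N} (hn : n ≠ 0) (h : ∀ r ∈ maximalIdeal R, r • n = 0) {r : R} :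
    r • n = 0 ↔ r ∈ maximalIdeal R := by
  refine ⟨fun hr ↦ ?_, h r⟩
  by_contra hr'
  rw [mem_maximalIdeal, mem_nonunits_iff, not_not] at hr'
  exact hn ((hr'.smul_eq_zero).mp hr)

theorem injective_of_quotient_maximalIdeal [IsLocalRing R] {N : Type*} [AddCommGroup N] [Module R N]
    {φ : (R ⧸ maximalIdeal R) →ₗ[R] N} (h : φ ≠ 0) : Function.Injective φ := by
  have : IsSimpleModule R (R ⧸ maximalIdeal R) :=
    isSimpleModule_iff_isCoatom.mpr (maximalIdeal.isMaximal R).out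
  exact LinearMap.injective_of_ne_zero h

theorem isSMulRegular_quotient_of_notMem {p : Ideal R} (hp : p.IsPrime) {x : R} (hx : x ∉ p) :
    IsSMulRegular (R ⧸ p) x := by
  refine isSMulRegular_iff_right_eq_zero_of_smul.mpr fun m hm ↦ ?_
  obtain ⟨r, rfl⟩ := Ideal.Quotient.mk_surjective m
  rw [Algebra.smul_def, Ideal.Quotient.algebraMap_eq, ← map_mul, Ideal.Quotient.eq_zero_iff_mem] at hm
  exact Ideal.Quotient.eq_zero_iff_mem.mpr ((hp.mem_or_mem hm).resolve_left hx)

theorem exists_mem_maximalIdeal_notMem [IsLocalRing R] {p : Ideal R} (hp : p.IsPrime)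
    (h : p ≠ maximalIdeal R) : ∃ x ∈ maximalIdeal R, x ∉ p :=
  SetLike.exists_of_lt ((le_maximalIdeal hp.ne_top).lt_of_ne h)

theorem subsingleton_ext_quotient_prime [IsNoetherianRing R] [IsLocalRing R] {j : ℕ}
    (hj : ∀ (N : Type u) [AddCommGroup N] [Module R N] [Module.Finite R N],
      Subsingleton (ExtM R N R (j + 1))) {p : Ideal R} (hp : p.IsPrime) (h : p ≠ maximalIdeal R) :
    Subsingleton (ExtM R (R ⧸ p) R j) := by
  obtain ⟨x, hx, hxp⟩ := exists_mem_maximalIdeal_notMem hp h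
  exact ExtM.subsingleton_of_quotSMulTop (isSMulRegular_quotient_of_notMem hp hxp) hx j (hj _)

/-- Dévissage along a prime filtration: quotients by nonmaximal primes are covered by
`subsingleton_ext_quotient_prime`, so only the residue field has to be checked. -/
theorem subsingleton_ext_of_residueField [IsNoetherianRing R] [IsLocalRing R] {j : ℕ}
    (hj : ∀ (N : Type u) [AddCommGroup N] [Module R N] [Module.Finite R N],
      Subsingleton (ExtM R N R (j + 1)))
    (hk : Subsingleton (ExtM R (R ⧸ maximalIdeal R) R j))
    (N : Type u) [AddCommGroup N] [Module R N] [hN : Module.Finite R N] :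
    Subsingleton (ExtM R N R j) := by
  induction hN using IsNoetherianRing.induction_on_isQuotientEquivQuotientPrime R with
  | subsingleton N => exact ExtM.subsingleton_of_subsingleton_left j
  | quotient N p e =>
    refine (ExtM.subsingleton_congr_left e j).mpr ?_
    by_cases h : p.asIdeal = maximalIdeal R
    · rw [h]; exact hk
    · exact subsingleton_ext_quotient_prime hj p.2 h
  | exact N₁ N₂ N₃ f g hf hg hfg h1 h3 => exact ExtM.pre_subsingleton₂ hf hg hfg R j h1 h3

/-- The number `d` is found as the depth `t`, the least degree in which `Ext(k, R)` is nonzero. A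
regular sequence `rs` of length `t` then has `Hom(k, R / rs) ≃ Ext^t(k, R) ≠ 0`, and an embedding `k
→ R / rs` bounds the injective dimension by `t` and shows that `R / rs` has dimension zero. -/
theorem IsGorensteinLocalRing.exists_isGorensteinOfDim [IsLocalRing R]
    (hR : IsGorensteinLocalRing R) : ∃ d, IsGorensteinOfDim R d := by
  classical
  obtain ⟨hnoeth, -, n, hn⟩ := hR
  have hvan : ∀ (N : Type u) [AddCommGroup N] [Module R N] [Module.Finite R N] (j : ℕ),
      n < j → Subsingleton (ExtM R N R j) := fun N _ _ _ j hj ↦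
    CategoryTheory.HasInjectiveDimensionLT.subsingleton (ModuleCat.of R R) (n + 1) j hj _
  have hmax : ∀ p : Ideal R, p.IsPrime → (⊤ : Ideal R) ≤ p → p = maximalIdeal R :=
    fun p hp h ↦ (hp.ne_top (top_le_iff.mp h)).elim
  -- Otherwise there would be a regular sequence of length `n + 1`, and this would make `Ext^0(R, R)
  -- = Hom(R, R)` vanish.
  have hex : ∃ i, ¬ Subsingleton (ExtM R (R ⧸ maximalIdeal R) R i) := by
    by_contra! hcon
    obtain ⟨rs, h1, h2, h3⟩ := exists_isWeaklyRegular_of_subsingleton_ext (M := R) ⊤ hmax (n + 1)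
      (fun i _ ↦ hcon i)
    have h0 := ExtM.subsingleton_of_isWeaklyRegular hvan rs (fun r hr ↦ (h2 r hr).1) R h3 0
      (by omega)
    have : Subsingleton (R →ₗ[R] R) := (ExtM.zeroEquiv R R R).toEquiv.subsingleton_congr.mpr h0
    have h10 := LinearMap.congr_fun (Subsingleton.elim (LinearMap.id : R →ₗ[R] R) 0) 1
    exact one_ne_zero h10
  let t := Nat.find hex
  have ht : ¬ Subsingleton (ExtM R (R ⧸ maximalIdeal R) R t) := Nat.find_spec hex
  obtain ⟨rs, hlen, hmem, hreg⟩ := exists_isWeaklyRegular_of_subsingleton_ext (M := R) ⊤ hmax t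
    (fun i hi ↦ not_not.mp (Nat.find_min hex hi))
  replace hmem : ∀ r ∈ rs, r ∈ maximalIdeal R := fun r hr ↦ (hmem r hr).1
  obtain ⟨e, he⟩ := ExtM.exists_class_of_isWeaklyRegular rs R hreg
  have hkill : ∀ p : Ideal R, Ideal.ofList rs ≤ p → ∀ r ∈ rs, ∀ x : R ⧸ p, r • x = 0 := by
    intro p hp r hr x
    obtain ⟨y, rfl⟩ := Ideal.Quotient.mk_surjective x
    rw [Algebra.smul_def, Ideal.Quotient.algebraMap_eq, ← map_mul, Ideal.Quotient.eq_zero_iff_mem]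
    exact p.mul_mem_right _ (hp (Ideal.subset_span hr))
  have hle : Ideal.ofList rs ≤ maximalIdeal R := Ideal.span_le.mpr hmem
  obtain ⟨φ, hφ⟩ : ∃ φ : (R ⧸ maximalIdeal R) →ₗ[R] R ⧸ (Ideal.ofList rs • ⊤ : Submodule R R),
      φ ≠ 0 := by
    by_contra! hcon
    have hsub : Subsingleton ((R ⧸ maximalIdeal R) →ₗ[R]
        R ⧸ (Ideal.ofList rs • ⊤ : Submodule R R)) := subsingleton_of_forall_eq 0 hcon
    apply ht
    rw [← hlen]
    exact (Equiv.ofBijective _ (he _ (hkill _ hle))).subsingleton_congr.mp hsub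
  -- Descending induction from the known bound `n`: for `j > t`, the group `Ext^j(k, R)` is a
  -- quotient of `Ext^j(R / rs, R)`, which vanishes because `R / rs` is resolved by a regular
  -- sequence of length `t`.
  have hvan' : ∀ (N : Type u) [AddCommGroup N] [Module R N] [Module.Finite R N] (j : ℕ),
      t < j → Subsingleton (ExtM R N R j) := by
    suffices H : ∀ a : ℕ, ∀ (N : Type u) [AddCommGroup N] [Module R N] [Module.Finite R N] (j : ℕ),
        t < j → n < j + a → Subsingleton (ExtM R N R j) from
      fun N _ _ _ j hj ↦ H (n + 1) N j hj (by omega)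
    intro a
    induction a with
    | zero => exact fun N _ _ _ j _ hj ↦ hvan N j hj
    | succ a ih =>
      intro N _ _ _ j hj hja
      refine subsingleton_ext_of_residueField (fun N _ _ _ ↦ ih N (j + 1) (by omega) (by omega)) ?_ N
      have hQ := ExtM.subsingleton_quotient_of_isWeaklyRegular (Y := R) 0 rs R hreg
        (fun i hi ↦ ExtM.subsingleton_of_free i hi) j (by omega)
      exact (ExtM.pre_surjective_of_injective (injective_of_quotient_maximalIdeal hφ) j
        (ih _ (j + 1) (by omega) (by omega))).subsingleton
  -- For a nonmaximal prime `p` above `rs`, `Hom(R / p, R / rs) ≃ Ext^t(R / p, R) = 0`, but the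
  -- composite `R / p → k → R / rs` is not zero.
  have hprime : ∀ p : Ideal R, p.IsPrime → Ideal.ofList rs ≤ p → p = maximalIdeal R := by
    intro p hp hrs
    by_contra hne
    have h0 := subsingleton_ext_quotient_prime (fun N _ _ _ ↦ hvan' N (t + 1) (by omega)) hp hne
    rw [← hlen] at h0
    have hsub : Subsingleton ((R ⧸ p) →ₗ[R] R ⧸ (Ideal.ofList rs • ⊤ : Submodule R R)) :=
      (Equiv.ofBijective _ (he _ (hkill _ hrs))).subsingleton_congr.mpr h0
    have hpm : p ≤ LinearMap.ker (maximalIdeal R).mkQ := by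
      rw [Submodule.ker_mkQ]; exact le_maximalIdeal hp.ne_top
    have hz := Subsingleton.elim (φ ∘ₗ p.liftQ (maximalIdeal R).mkQ hpm) 0
    apply hφ
    refine LinearMap.ext fun x ↦ ?_
    obtain ⟨y, rfl⟩ := Submodule.mkQ_surjective _ x
    exact LinearMap.congr_fun hz (p.mkQ y)
  refine ⟨t, ?_, hvan', rs, hlen, hmem, hreg, hprime⟩
  have hdim := ringKrullDim_add_length_eq_ringKrullDim_of_isRegular rs
    ((isRegular_iff_isWeaklyRegular_of_subset_maximalIdeal hmem).mpr hreg)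
  have h0 : ringKrullDim (R ⧸ Ideal.ofList rs) = 0 := by
    have : Nontrivial (R ⧸ Ideal.ofList rs) :=
      Ideal.Quotient.nontrivial_iff.mpr fun h ↦ (Ideal.IsPrime.ne_top'
        (I := maximalIdeal R)) (top_le_iff.mp (h ▸ hle))
    have : Ring.KrullDimLE 0 (R ⧸ Ideal.ofList rs) := by
      refine Ring.krullDimLE_zero_iff.mpr fun J hJ ↦ ?_
      have h1 := hprime (J.comap (Ideal.Quotient.mk _)) (hJ.comap _) (fun x hx ↦ by
        rw [Ideal.mem_comap, Ideal.Quotient.eq_zero_iff_mem.mpr hx]; exact J.zero_mem)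
      have h2 : (J.comap (Ideal.Quotient.mk (Ideal.ofList rs))).IsMaximal := by
        rw [h1]; infer_instance
      have h3 := Ideal.map_comap_of_surjective _ Ideal.Quotient.mk_surjective J
      rw [← h3]
      exact (Ideal.map_eq_top_or_isMaximal_of_surjective _ Ideal.Quotient.mk_surjective
        h2).resolve_left (by rw [h3]; exact hJ.ne_top)
    exact ringKrullDimZero_iff_ringKrullDim_eq_zero.mp this
  rw [h0, zero_add, hlen] at hdim
  exact hdim.symm

end GorensteinRings

/-! ### Self-injectivity, socles and cyclic `Ext` modules. -/

section GorensteinQuotients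

open RingTheory.Sequence IsLocalRing Pointwise

variable {R : Type u} [CommRing R]

/-- An associated prime contains the annihilator, so it is the maximal ideal. -/
theorem exists_ne_zero_smul_eq_zero [IsNoetherianRing R] [IsLocalRing R] (N : Type*)
    [AddCommGroup N] [Module R N] [Nontrivial N]
    (h : ∀ p : Ideal R, p.IsPrime → Module.annihilator R N ≤ p → p = maximalIdeal R) :
    ∃ n : N, n ≠ 0 ∧ ∀ r ∈ maximalIdeal R, r • n = 0 := by
  obtain ⟨p, hp⟩ := associatedPrimes.nonempty R N
  obtain ⟨hprime, n, hn⟩ := isAssociatedPrime_iff.mp hp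
  have hmem : ∀ r, r ∈ p ↔ r • n = 0 := fun r ↦ by
    rw [hn, Submodule.mem_colon_singleton, Submodule.mem_bot]
  have hpm := h p hprime fun r hr ↦ (hmem r).mpr (Module.mem_annihilator.mp hr n)
  refine ⟨n, fun h0 ↦ hprime.ne_top ((Ideal.eq_top_iff_one _).mpr ?_), fun r hr ↦ ?_⟩
  · rw [hmem, h0, smul_zero]
  · rwa [← hmem, hpm]

/-- The map from the residue field sending `1` to an element killed by the maximal ideal. -/
noncomputable def residueFieldMap [IsLocalRing R] {N : Type*} [AddCommGroup N] [Module R N] (n : N)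
    (hn : ∀ r ∈ maximalIdeal R, r • n = 0) : (R ⧸ maximalIdeal R) →ₗ[R] N :=
  (maximalIdeal R).liftQ (LinearMap.toSpanSingleton R N n) hn

theorem residueFieldMap_mk [IsLocalRing R] {N : Type*} [AddCommGroup N] [Module R N] (n : N)
    (hn : ∀ r ∈ maximalIdeal R, r • n = 0) (r : R) :
    residueFieldMap n hn (Submodule.Quotient.mk r) = r • n := rfl

theorem residueFieldMap_one [IsLocalRing R] {N : Type*} [AddCommGroup N] [Module R N] (n : N)
    (hn : ∀ r ∈ maximalIdeal R, r • n = 0) :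
    residueFieldMap n hn (Submodule.Quotient.mk 1) = n := one_smul R n

theorem ext_class_quotient_ofList {rs : List R} (h : IsWeaklyRegular R rs) :
    ∃ e : ExtM R (R ⧸ Ideal.ofList rs) R rs.length,
      ∀ (N : Type u) [AddCommGroup N] [Module R N], (∀ r ∈ rs, ∀ n : N, r • n = 0) →
        Function.Bijective fun φ : N →ₗ[R] R ⧸ Ideal.ofList rs ↦ ExtM.pre R φ rs.length e := by
  have h1 := ExtM.exists_class_of_isWeaklyRegular rs R h
  rwa [show (Ideal.ofList rs • ⊤ : Submodule R R) = Ideal.ofList rs by simp] at h1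

theorem smul_quotient_ofList_eq_zero (rs : List R) (r : R) (hr : r ∈ rs) (x : R ⧸ Ideal.ofList rs) :
    r • x = 0 := by
  obtain ⟨y, rfl⟩ := Ideal.Quotient.mk_surjective x
  rw [Algebra.smul_def, Ideal.Quotient.algebraMap_eq, ← map_mul, Ideal.Quotient.eq_zero_iff_mem]
  exact Ideal.mul_mem_right _ _ (Ideal.subset_span hr)

/-- This is the self-injectivity of `R / rs`: on modules killed by `rs`, `Hom(-, R / rs)` is
`Ext^r(-, R)` with `r` the length, and this functor is right exact because `Ext^(r+1)` vanishes. -/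
theorem exists_extension_of_forall_subsingleton {rs : List R} (hreg : IsWeaklyRegular R rs)
    (hvan : ∀ (N : Type u) [AddCommGroup N] [Module R N] [Module.Finite R N] (j : ℕ),
      rs.length < j → Subsingleton (ExtM R N R j))
    {X Y : Type u} [AddCommGroup X] [Module R X] [AddCommGroup Y] [Module R Y] [Module.Finite R Y]
    {f : X →ₗ[R] Y} (hf : Function.Injective f) (hY : ∀ r ∈ rs, ∀ y : Y, r • y = 0)
    (φ : X →ₗ[R] R ⧸ Ideal.ofList rs) : ∃ ψ : Y →ₗ[R] R ⧸ Ideal.ofList rs, ψ ∘ₗ f = φ := by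
  obtain ⟨e, he⟩ := ext_class_quotient_ofList hreg
  obtain ⟨y, hy⟩ := ExtM.pre_surjective_of_injective hf rs.length
    (hvan _ _ (Nat.lt_succ_self _)) (ExtM.pre R φ rs.length e)
  obtain ⟨ψ, rfl⟩ := (he Y hY).2 y
  refine ⟨ψ, (he X fun r hr x ↦ hf (by rw [map_smul, hY r hr, map_zero])).1 ?_⟩
  change ExtM.pre R (ψ ∘ₗ f) _ e = _
  rw [ExtM.pre_comp]
  exact hy

theorem linearMap_quotient_apply {I : Ideal R} (ψ : (R ⧸ I) →ₗ[R] R ⧸ I) :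
    ∃ c : R, ∀ x, ψ x = c • x := by
  obtain ⟨c, hc⟩ := Ideal.Quotient.mk_surjective (ψ 1)
  refine ⟨c, fun x ↦ ?_⟩
  obtain ⟨y, rfl⟩ := Ideal.Quotient.mk_surjective x
  have : Ideal.Quotient.mk I y = y • (1 : R ⧸ I) := by
    rw [Algebra.smul_def, mul_one]; rfl
  rw [this, map_smul, ← hc, smul_comm]
  congr 1
  rw [Algebra.smul_def, mul_one]; rfl

/-- The quotient of a Gorenstein local ring by a maximal regular sequence has simple socle. -/
theorem exists_sub_mul_mem_of_socle [IsLocalRing R] {rs : List R} (hreg : IsWeaklyRegular R rs)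
    (hvan : ∀ (N : Type u) [AddCommGroup N] [Module R N] [Module.Finite R N] (j : ℕ),
      rs.length < j → Subsingleton (ExtM R N R j)) {a b : R ⧸ Ideal.ofList rs}
    (ha : ∀ r ∈ maximalIdeal R, r • a = 0) (hb : ∀ r ∈ maximalIdeal R, r • b = 0) (ha0 : a ≠ 0) :
    ∃ c : R, b = c • a := by
  by_contra! hcon
  let k := R ⧸ maximalIdeal R
  -- If `b` is not a multiple of `a`, then `k × k` embeds in the socle. The map killing `a` and
  -- sending `b` to `a` extends to multiplication by some `c`; from `c • a = 0` follows `c ∈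
  -- maximalIdeal R`, hence `a = c • b = 0`.
  let ι : (k × k) →ₗ[R] R ⧸ Ideal.ofList rs :=
    (residueFieldMap a ha).coprod (residueFieldMap b hb)
  have hι : Function.Injective ι := by
    refine (injective_iff_map_eq_zero _).mpr ?_
    rintro ⟨u, v⟩ huv
    obtain ⟨u, rfl⟩ := Submodule.Quotient.mk_surjective _ u
    obtain ⟨v, rfl⟩ := Submodule.Quotient.mk_surjective _ v
    replace huv : u • a + v • b = 0 := huv
    have hv : v ∈ maximalIdeal R := by
      by_contra hv
      rw [mem_maximalIdeal, mem_nonunits_iff, not_not] at hv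
      obtain ⟨w, rfl⟩ := hv
      refine hcon (-(↑w⁻¹ * u)) ?_
      have h1 : (↑w⁻¹ : R) • (u • a + (w : R) • b) = 0 := by rw [huv, smul_zero]
      rw [smul_add, smul_smul, smul_smul, Units.inv_mul, one_smul] at h1
      rw [neg_smul]
      exact eq_neg_of_add_eq_zero_right h1
    rw [hb v hv, add_zero, mem_maximalIdeal_of_forall_smul_eq_zero ha0 ha] at huv
    exact Prod.ext ((Submodule.Quotient.mk_eq_zero _).mpr huv)
      ((Submodule.Quotient.mk_eq_zero _).mpr hv)
  obtain ⟨ψ, hψ⟩ := exists_extension_of_forall_subsingleton hreg hvan hι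
    (smul_quotient_ofList_eq_zero rs) (residueFieldMap a ha ∘ₗ LinearMap.snd R k k)
  obtain ⟨c, hc⟩ := linearMap_quotient_apply ψ
  have h1 : c • a = 0 := by
    have := LinearMap.congr_fun hψ (Submodule.Quotient.mk 1, 0)
    simp only [LinearMap.comp_apply, LinearMap.snd_apply, map_zero, hc, ι,
      LinearMap.coprod_apply, residueFieldMap_mk, one_smul, add_zero] at this
    exact this
  have h2 : c • b = a := by
    have := LinearMap.congr_fun hψ (0, Submodule.Quotient.mk 1)
    simp only [LinearMap.comp_apply, LinearMap.snd_apply, map_zero, hc, ι,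
      LinearMap.coprod_apply, residueFieldMap_mk, one_smul, zero_add] at this
    exact (congrArg (c • ·) (residueFieldMap_one b hb)).symm.trans this
  rw [mem_maximalIdeal_of_forall_smul_eq_zero ha0 ha] at h1
  exact ha0 (h2 ▸ hb c h1)

namespace IsGorensteinOfDim

variable [IsLocalRing R] [IsNoetherianRing R] {d : ℕ} (hR : IsGorensteinOfDim R d)

include hR

theorem subsingleton_ext_residueField (i : ℕ) (hi : i < d) :
    Subsingleton (ExtM R (R ⧸ maximalIdeal R) R i) := by
  obtain ⟨rs, rfl, hmem, hreg, -⟩ := hR.exists_isWeaklyRegular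
  refine ExtM.subsingleton_of_lt_length rs R hreg (fun r hr n ↦ ?_) i hi
  obtain ⟨y, rfl⟩ := Ideal.Quotient.mk_surjective n
  rw [Algebra.smul_def, Ideal.Quotient.algebraMap_eq, ← map_mul, Ideal.Quotient.eq_zero_iff_mem]
  exact Ideal.mul_mem_right _ _ (hmem r hr)

theorem not_subsingleton_ext_residueField :
    ¬ Subsingleton (ExtM R (R ⧸ maximalIdeal R) R d) := by
  obtain ⟨rs, rfl, hmem, hreg, hprime⟩ := hR.exists_isWeaklyRegular
  have hle : Ideal.ofList rs ≤ maximalIdeal R := Ideal.span_le.mpr hmem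
  have : Nontrivial (R ⧸ Ideal.ofList rs) := Ideal.Quotient.nontrivial_iff.mpr fun h ↦
    (Ideal.IsPrime.ne_top' (I := maximalIdeal R)) (top_le_iff.mp (h ▸ hle))
  obtain ⟨n, hn0, hn⟩ := exists_ne_zero_smul_eq_zero (R ⧸ Ideal.ofList rs) fun p hp h ↦
    hprime p hp (by rwa [Ideal.annihilator_quotient] at h)
  obtain ⟨e, he⟩ := ext_class_quotient_ofList hreg
  intro hsub
  have h1 := (he (R ⧸ maximalIdeal R) fun r hr n ↦ by
    obtain ⟨y, rfl⟩ := Ideal.Quotient.mk_surjective n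
    rw [Algebra.smul_def, Ideal.Quotient.algebraMap_eq, ← map_mul, Ideal.Quotient.eq_zero_iff_mem]
    exact Ideal.mul_mem_right _ _ (hmem r hr)).1
  have h2 : residueFieldMap n hn = 0 := h1 (Subsingleton.elim _ _)
  have h3 := LinearMap.congr_fun h2 (Submodule.Quotient.mk 1)
  rw [residueFieldMap_mk, one_smul] at h3
  exact hn0 h3

/-- A finite length module with simple socle over a Gorenstein local ring of dimension `d` has
cyclic `Ext^d` into the ring. -/
theorem exists_generator_ext_of_socle (C : Type u) [AddCommGroup C] [Module R C] [Module.Finite R C]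
    (hsupp : ∀ p : Ideal R, p.IsPrime → Module.annihilator R C ≤ p → p = maximalIdeal R)
    (hsoc : ∀ a b : C, (∀ r ∈ maximalIdeal R, r • a = 0) → (∀ r ∈ maximalIdeal R, r • b = 0) →
      a ≠ 0 → ∃ c : R, b = c • a) :
    ∃ ε : ExtM R C R d, ∀ x, ∃ r : R, r • ε = x := by
  rcases subsingleton_or_nontrivial C with hC | hC
  · have := ExtM.subsingleton_of_subsingleton_left (R := R) (M := C) (Y := R) d
    exact ⟨0, fun x ↦ ⟨0, Subsingleton.elim _ _⟩⟩
  -- The regular sequence is taken inside the annihilator of `C`, so that `Ext^d(C, R)` becomes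
  -- `Hom(C, R / rs)`.
  obtain ⟨rs, hlen, hmem, hreg⟩ := exists_isWeaklyRegular_of_subsingleton_ext (M := R)
    (Module.annihilator R C) hsupp d hR.subsingleton_ext_residueField
  subst hlen
  have hkill : ∀ r ∈ rs, ∀ c : C, r • c = 0 := fun r hr ↦ Module.mem_annihilator.mp (hmem r hr).2
  obtain ⟨a, ha0, ha⟩ := exists_ne_zero_smul_eq_zero C hsupp
  obtain ⟨e, he⟩ := ext_class_quotient_ofList hreg
  have hk : ∀ r ∈ rs, ∀ c : R ⧸ maximalIdeal R, r • c = 0 := fun r hr n ↦ by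
    obtain ⟨y, rfl⟩ := Ideal.Quotient.mk_surjective n
    rw [Algebra.smul_def, Ideal.Quotient.algebraMap_eq, ← map_mul, Ideal.Quotient.eq_zero_iff_mem]
    exact Ideal.mul_mem_right _ _ (hmem r hr).1
  obtain ⟨β, hβ⟩ : ∃ β : (R ⧸ maximalIdeal R) →ₗ[R] R ⧸ Ideal.ofList rs, β ≠ 0 := by
    by_contra! hcon
    exact hR.not_subsingleton_ext_residueField
      ((Equiv.ofBijective _ (he _ hk)).subsingleton_congr.mp (subsingleton_of_forall_eq 0 hcon))
  have hα : Function.Injective (residueFieldMap a ha) := by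
    refine injective_of_quotient_maximalIdeal fun h ↦ ha0 ?_
    exact (residueFieldMap_one a ha).symm.trans (LinearMap.congr_fun h (Submodule.Quotient.mk 1))
  obtain ⟨ψ, hψ⟩ := exists_extension_of_forall_subsingleton hreg hR.subsingleton_ext hα hkill β
  -- A nonzero kernel would contain a socle element of `C`; the socle being simple, `ψ` would kill
  -- `a`, and `β` would be zero.
  have hinj : Function.Injective ψ := by
    rw [← LinearMap.ker_eq_bot]
    by_contra hker
    have : Nontrivial (LinearMap.ker ψ) := Submodule.nontrivial_iff_ne_bot.mpr hker
    obtain ⟨b, hb0, hb⟩ := exists_ne_zero_smul_eq_zero (LinearMap.ker ψ) fun p hp h ↦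
      hsupp p hp (((LinearMap.ker ψ).subtype.annihilator_le_of_injective
        (Submodule.subtype_injective _)).trans h)
    obtain ⟨c, hc⟩ := hsoc (b : C) a (fun r hr ↦ by
      rw [← Submodule.coe_smul, hb r hr, Submodule.coe_zero]) ha (by simpa using hb0)
    apply hβ
    rw [← hψ]
    refine LinearMap.ext fun x ↦ ?_
    obtain ⟨r, rfl⟩ := Submodule.Quotient.mk_surjective _ x
    rw [LinearMap.comp_apply, residueFieldMap_mk, hc, map_smul, map_smul, b.2, smul_zero, smul_zero]
    rfl
  refine ⟨ExtM.pre R ψ rs.length e, fun x ↦ ?_⟩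
  obtain ⟨χ, rfl⟩ := (he C hkill).2 x
  -- By self-injectivity every `χ : C → R / rs` extends along `ψ` to an endomorphism of `R / rs`,
  -- that is, to multiplication by some `c`. So `ψ` generates `Hom(C, R / rs)`.
  obtain ⟨θ, hθ⟩ := exists_extension_of_forall_subsingleton hreg hR.subsingleton_ext hinj
    (smul_quotient_ofList_eq_zero rs) χ
  obtain ⟨c, hc⟩ := linearMap_quotient_apply θ
  refine ⟨c, ?_⟩
  have : χ = c • ψ := by
    rw [← hθ]; ext x; simp [hc]
  change _ = ExtM.pre R χ rs.length e
  rw [this, ExtM.pre_smul]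
  rfl

/-- Because `Ext^(i+1)(N, R) = 0`, the connecting map identifies `Ext^i(N, R)` modulo `x` with
`Ext^(i+1)(N / xN, R)`, and Nakayama lifts a generator. -/
theorem exists_generator_ext_of_isWeaklyRegular (rs : List R)
    (hmem : ∀ r ∈ rs, r ∈ maximalIdeal R) (N : Type u) [AddCommGroup N] [Module R N]
    [Module.Finite R N] (hreg : IsWeaklyRegular N rs) (i : ℕ) (hi : i + rs.length = d)
    (h : ∃ ε : ExtM R (N ⧸ (Ideal.ofList rs • ⊤ : Submodule R N)) R d, ∀ x, ∃ r : R, r • ε = x) :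
    ∃ ε : ExtM R N R i, ∀ x, ∃ r : R, r • ε = x := by
  have transport : ∀ {A B : Type u} [AddCommGroup A] [Module R A] [AddCommGroup B] [Module R B]
      (_ : A ≃ₗ[R] B) (i : ℕ), (∃ ε : ExtM R A R i, ∀ x, ∃ r : R, r • ε = x) →
      ∃ ε : ExtM R B R i, ∀ x, ∃ r : R, r • ε = x := by
    rintro A B _ _ _ _ E i ⟨ε, hε⟩
    refine ⟨ExtM.pre R E.symm.toLinearMap i ε, fun x ↦ ?_⟩
    obtain ⟨r, hr⟩ := hε (ExtM.pre R E.toLinearMap i x)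
    refine ⟨r, ?_⟩
    rw [← map_smul, hr, ← LinearMap.comp_apply, ← ExtM.pre_comp, LinearEquiv.comp_symm,
      ExtM.pre_id, LinearMap.id_apply]
  induction rs generalizing N i with
  | nil =>
    obtain rfl : i = d := by simpa using hi
    exact transport (Submodule.quotEquivOfEqBot _ (by simp)) i h
  | cons x rs ih =>
    have hreg' := (isWeaklyRegular_cons_iff N x rs).mp hreg
    have hx := hmem x (by simp)
    rw [List.length_cons] at hi
    obtain ⟨ε, hε⟩ := ih (fun r hr ↦ hmem r (by simp [hr])) (QuotSMulTop x N) hreg'.2 (i + 1)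
      (by omega) (transport (Submodule.quotOfListConsSMulTopEquivQuotSMulTopInner N x rs) d h)
    obtain ⟨δ, hδ1, hδ2⟩ := ExtM.exists_pre_connecting (f := LinearMap.lsmul R N x) hreg'.1
      (Submodule.mkQ_surjective _) (LinearMap.exact_lsmul_mkQ_smul_top N x) R i
    have hsub := ExtM.subsingleton_of_isWeaklyRegular hR.subsingleton_ext (x :: rs) hmem N hreg
      (i + 1) (by rw [List.length_cons]; omega)
    obtain ⟨ε', rfl⟩ := (hδ2 ε).mp (Subsingleton.elim _ _)
    refine ⟨ε', fun y ↦ ?_⟩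
    have htop : (⊤ : Submodule R (ExtM R N R i)) ≤ Submodule.span R {ε'} := by
      refine Submodule.le_of_le_smul_of_le_jacobson_bot Module.Finite.fg_top
        (maximalIdeal_le_jacobson ⊥) fun y _ ↦ ?_
      obtain ⟨r, hr⟩ := hε (δ y)
      obtain ⟨z, hz⟩ := (hδ1 (y - r • ε')).mp (by rw [map_sub, map_smul, hr, sub_self])
      rw [ExtM.pre_smul_id] at hz
      rw [← sub_add_cancel y (r • ε'), ← hz]
      exact add_mem (Submodule.mem_sup_right (Submodule.smul_mem_smul hx trivial))
        (Submodule.mem_sup_left (Submodule.smul_mem _ _ (Submodule.mem_span_singleton_self _)))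
    exact Submodule.mem_span_singleton.mp (htop trivial)

end IsGorensteinOfDim

end GorensteinQuotients

/-! ### `Ext(R ⧸ I, R)` for a Gorenstein ideal `I`. -/

section GorensteinIdeals

open RingTheory.Sequence IsLocalRing Pointwise

variable {R : Type u} [CommRing R] [IsLocalRing R] [IsNoetherianRing R] {d : ℕ}

theorem IsGorensteinOfDim.subsingleton_ext_of_support (hR : IsGorensteinOfDim R d)
    (C : Type u) [AddCommGroup C] [Module R C]
    (hsupp : ∀ p : Ideal R, p.IsPrime → Module.annihilator R C ≤ p → p = maximalIdeal R)
    (j : ℕ) (hj : j < d) : Subsingleton (ExtM R C R j) := by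
  obtain ⟨rs, rfl, hmem, hreg⟩ := exists_isWeaklyRegular_of_subsingleton_ext (M := R)
    (Module.annihilator R C) hsupp d hR.subsingleton_ext_residueField
  exact ExtM.subsingleton_of_lt_length rs R hreg
    (fun r hr ↦ Module.mem_annihilator.mp (hmem r hr).2) j hj

omit [IsNoetherianRing R] in
theorem mem_maximalIdeal_of_mk_mem {I : Ideal R} [IsLocalRing (R ⧸ I)] {r : R} :
    Ideal.Quotient.mk I r ∈ maximalIdeal (R ⧸ I) ↔ r ∈ maximalIdeal R := by
  have : IsLocalHom (Ideal.Quotient.mk I) := IsLocalHom.of_surjective _ Ideal.Quotient.mk_surjective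
  rw [mem_maximalIdeal, mem_maximalIdeal, mem_nonunits_iff, mem_nonunits_iff, isUnit_map_iff]

/-- Change of rings: the maximal regular sequence of `R ⧸ I` is lifted to `R`, so that the simple
socle found over `R ⧸ I` can be fed into the computation of `Ext` over `R`. -/
theorem IsGorensteinOfDim.exists_isWeaklyRegular_quotient {I : Ideal R} [IsLocalRing (R ⧸ I)]
    {s : ℕ} (hI : IsGorensteinOfDim (R ⧸ I) s) :
    ∃ rs : List R, rs.length = s ∧ (∀ r ∈ rs, r ∈ maximalIdeal R) ∧ IsWeaklyRegular (R ⧸ I) rs ∧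
      (∀ p : Ideal R, p.IsPrime → Module.annihilator R
        ((R ⧸ I) ⧸ (Ideal.ofList rs • ⊤ : Submodule R (R ⧸ I))) ≤ p → p = maximalIdeal R) ∧
      ∀ a b : (R ⧸ I) ⧸ (Ideal.ofList rs • ⊤ : Submodule R (R ⧸ I)),
        (∀ r ∈ maximalIdeal R, r • a = 0) → (∀ r ∈ maximalIdeal R, r • b = 0) →
        a ≠ 0 → ∃ c : R, b = c • a := by
  obtain ⟨ys, rfl, hmem, hreg, hprime⟩ := hI.exists_isWeaklyRegular
  obtain ⟨rs, rfl⟩ := List.map_surjective_iff.mpr (Ideal.Quotient.mk_surjective (I := I)) ys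
  have hrs : ∀ r ∈ rs, r ∈ maximalIdeal R := fun r hr ↦
    mem_maximalIdeal_of_mk_mem.mp (hmem _ (List.mem_map_of_mem hr))
  have hK : (Ideal.ofList rs • ⊤ : Submodule R (R ⧸ I)) =
      (Ideal.ofList (rs.map (Ideal.Quotient.mk I))).restrictScalars R := by
    have h1 := Ideal.smul_restrictScalars (S := R ⧸ I) (Ideal.ofList rs) (⊤ : Ideal (R ⧸ I))
    rw [Submodule.restrictScalars_top] at h1
    rw [← h1, smul_eq_mul, Ideal.mul_top, ← Ideal.map_ofList]
    rfl
  refine ⟨rs, by simp, hrs, ?_, ?_, ?_⟩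
  · exact (isWeaklyRegular_map_algebraMap_iff (R ⧸ I) (R ⧸ I) rs).mp hreg
  · intro p hp h
    rw [hK] at h
    have hle : ∀ x : R, Ideal.Quotient.mk I x ∈ Ideal.ofList (rs.map (Ideal.Quotient.mk I)) →
        x ∈ p := by
      refine fun x hx ↦ h (Module.mem_annihilator.mpr fun m ↦ ?_)
      obtain ⟨m, rfl⟩ := Submodule.Quotient.mk_surjective _ m
      rw [← Submodule.Quotient.mk_smul, Submodule.Quotient.mk_eq_zero]
      rw [Submodule.restrictScalars_mem, Algebra.smul_def]
      exact Ideal.mul_mem_right _ _ hx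
    have hIp : RingHom.ker (Ideal.Quotient.mk I) ≤ p := fun x hx ↦ hle x (by
      rw [(RingHom.mem_ker).mp hx]; exact zero_mem _)
    have h1 := hprime (p.map (Ideal.Quotient.mk I))
      (Ideal.map_isPrime_of_surjective Ideal.Quotient.mk_surjective hIp) (by
        intro x hx
        obtain ⟨x, rfl⟩ := Ideal.Quotient.mk_surjective x
        exact Ideal.mem_map_of_mem _ (hle x hx))
    ext x
    rw [← mem_maximalIdeal_of_mk_mem (I := I), ← h1, ← Ideal.mem_comap,
      Ideal.comap_map_of_surjective _ Ideal.Quotient.mk_surjective]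
    rw [show Ideal.comap (Ideal.Quotient.mk I) ⊥ = RingHom.ker (Ideal.Quotient.mk I) from rfl,
      sup_eq_left.mpr hIp]
  · rw [hK]
    intro a b ha hb ha0
    obtain ⟨a, rfl⟩ := Submodule.Quotient.mk_surjective _ a
    obtain ⟨b, rfl⟩ := Submodule.Quotient.mk_surjective _ b
    have key : ∀ z : R ⧸ I, (∀ r ∈ maximalIdeal R, r • (Submodule.Quotient.mk z :
        (R ⧸ I) ⧸ (Ideal.ofList (rs.map (Ideal.Quotient.mk I))).restrictScalars R) = 0) →
        ∀ r ∈ maximalIdeal (R ⧸ I), r • (Submodule.Quotient.mk z :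
          (R ⧸ I) ⧸ Ideal.ofList (rs.map (Ideal.Quotient.mk I))) = 0 := by
      intro z hz r hr
      obtain ⟨r, rfl⟩ := Ideal.Quotient.mk_surjective r
      have := hz r (mem_maximalIdeal_of_mk_mem.mp hr)
      rw [← Submodule.Quotient.mk_smul, Submodule.Quotient.mk_eq_zero,
        Submodule.restrictScalars_mem, Algebra.smul_def] at this
      rw [← Submodule.Quotient.mk_smul, Submodule.Quotient.mk_eq_zero]
      exact this
    obtain ⟨c, hc⟩ := exists_sub_mul_mem_of_socle hreg hI.subsingleton_ext (key a ha) (key b hb)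
      (fun h ↦ ha0 (by
        rw [Submodule.Quotient.mk_eq_zero] at h ⊢
        exact h))
    obtain ⟨c, rfl⟩ := Ideal.Quotient.mk_surjective c
    refine ⟨c, ?_⟩
    rw [← Submodule.Quotient.mk_smul, Submodule.Quotient.eq] at hc ⊢
    exact hc

/-- In this degree `Ext(R ⧸ I, R)` is the canonical module of `R ⧸ I`, which is free of rank one for
a Gorenstein ring; only cyclicity is needed. -/
theorem IsGorensteinOfDim.exists_generator_ext_quotient (hR : IsGorensteinOfDim R d)
    {I : Ideal R} [IsLocalRing (R ⧸ I)] {s : ℕ} (hI : IsGorensteinOfDim (R ⧸ I) s) (i : ℕ)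
    (hi : i + s = d) : ∃ ε : ExtM R (R ⧸ I) R i, ∀ x, ∃ r : R, r • ε = x := by
  obtain ⟨rs, rfl, hmem, hreg, hsupp, hsoc⟩ := hI.exists_isWeaklyRegular_quotient
  exact hR.exists_generator_ext_of_isWeaklyRegular rs hmem _ hreg i hi
    (hR.exists_generator_ext_of_socle _ hsupp hsoc)

theorem IsGorensteinOfDim.subsingleton_ext_quotient_of_lt (hR : IsGorensteinOfDim R d)
    {I : Ideal R} [IsLocalRing (R ⧸ I)] {s : ℕ} (hI : IsGorensteinOfDim (R ⧸ I) s) (i : ℕ)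
    (hi : i + s < d) : Subsingleton (ExtM R (R ⧸ I) R i) := by
  obtain ⟨rs, rfl, hmem, hreg, hsupp, hsoc⟩ := hI.exists_isWeaklyRegular_quotient
  exact ExtM.subsingleton_of_lt_of_isWeaklyRegular d rs hmem _ hreg
    (hR.subsingleton_ext_of_support _ hsupp) i hi

theorem IsGorensteinOfDim.subsingleton_ext_quotient_of_gt (hR : IsGorensteinOfDim R d)
    {I : Ideal R} [IsLocalRing (R ⧸ I)] {s : ℕ} (hI : IsGorensteinOfDim (R ⧸ I) s) (i : ℕ)
    (hi : d < i + s) : Subsingleton (ExtM R (R ⧸ I) R i) := by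
  obtain ⟨rs, rfl, hmem, hreg, -, -⟩ := hI.exists_isWeaklyRegular_quotient
  exact ExtM.subsingleton_of_isWeaklyRegular hR.subsingleton_ext rs hmem _ hreg i hi

/-- An ideal of height one in a noetherian domain has a multiplier `I → R` that is not
multiplication by an element of the ring. -/
theorem exists_linearMap_of_height_eq_one [IsDomain R] {I : Ideal R} (hI : I.height = 1) :
    ∃ φ : I →ₗ[R] R, ∀ r : R, φ ≠ r • I.subtype := by
  have hbot := Ideal.ne_bot_of_height_one hI
  obtain ⟨a, haI, ha0⟩ := Submodule.exists_mem_ne_zero_of_ne_bot hbot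
  obtain ⟨p, hpp, hpI, hp1⟩ := Ideal.exists_isPrime_height_eq (n := 1) (by exact_mod_cast hI)
  have hap : a ∈ p := hpI haI
  -- A height one prime `p ⊇ I` is minimal over `a`, hence associated to `R / (a)`, say `p = (a :
  -- b)`. The multiplier is `b / a`; if it lay in `R`, then `1 ∈ p`.
  have hmin : p ∈ (Module.annihilator R (R ⧸ Ideal.span {a})).minimalPrimes := by
    rw [Ideal.annihilator_quotient]
    refine Ideal.mem_minimalPrimes_of_height_le ((Ideal.span_singleton_le_iff_mem p).mpr hap) ?_
    rw [hp1]
    exact Ideal.one_le_height_span_singleton_of_mem_nonZeroDivisors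
      (mem_nonZeroDivisors_of_ne_zero ha0)
  have hass := Module.associatedPrimes.minimalPrimes_annihilator_subset_associatedPrimes R _ hmin
  obtain ⟨-, b, hb⟩ := isAssociatedPrime_iff.mp hass
  obtain ⟨b, rfl⟩ := Ideal.Quotient.mk_surjective b
  have hb' : ∀ r, r ∈ p ↔ a ∣ r * b := fun r ↦ by
    rw [hb, Submodule.mem_colon_singleton, Submodule.mem_bot, ← Ideal.mem_span_singleton,
      ← Ideal.Quotient.eq_zero_iff_mem, map_mul]
    rfl
  choose! f hf using fun r hr ↦ (hb' r).mp hr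
  let φ : I →ₗ[R] R :=
    { toFun x := f x
      map_add' x y := mul_left_cancel₀ ha0 (by
        rw [mul_add, ← hf _ (hpI x.2), ← hf _ (hpI y.2), ← hf _ (hpI (x + y).2),
          Submodule.coe_add, add_mul])
      map_smul' r x := mul_left_cancel₀ ha0 (by
        rw [← hf _ (hpI (r • x).2), RingHom.id_apply, smul_eq_mul, mul_left_comm a,
          ← hf _ (hpI x.2), Submodule.coe_smul, smul_eq_mul, mul_assoc]) }
  refine ⟨φ, fun r hr ↦ hpp.ne_top ((Ideal.eq_top_iff_one p).mpr ((hb' 1).mpr ?_))⟩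
  have h1 : f a = r * a := LinearMap.congr_fun hr ⟨a, haI⟩
  have h2 := hf a hap
  rw [h1] at h2
  exact ⟨r, mul_left_cancel₀ ha0 (by rw [one_mul, h2, mul_comm r a])⟩

end GorensteinIdeals

/-! ### Duality into a Gorenstein ring. -/

section Duality

open RingTheory.Sequence IsLocalRing Pointwise

variable {R : Type u} [CommRing R]

theorem exists_comp_eq_of_subsingleton_ext {M N Y : Type u} [AddCommGroup M] [Module R M]
    [AddCommGroup N] [Module R N] [AddCommGroup Y] [Module R Y] {f : M →ₗ[R] N}
    (hf : Function.Injective f) (h : Subsingleton (ExtM R (N ⧸ LinearMap.range f) Y 1))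
    (φ : M →ₗ[R] Y) : ∃ ψ : N →ₗ[R] Y, ψ ∘ₗ f = φ := by
  obtain ⟨y, hy⟩ := ExtM.pre_surjective_of_injective hf 0 h (ExtM.zeroEquiv R M Y φ)
  obtain ⟨ψ, rfl⟩ := (ExtM.zeroEquiv R N Y).surjective y
  rw [ExtM.pre_zeroEquiv] at hy
  exact ⟨ψ, (ExtM.zeroEquiv R M Y).injective hy⟩

theorem exists_comp_eq_of_exact {M N P Y : Type u} [AddCommGroup M] [Module R M]
    [AddCommGroup N] [Module R N] [AddCommGroup P] [Module R P] [AddCommGroup Y] [Module R Y]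
    {f : M →ₗ[R] N} {g : N →ₗ[R] P} (hf : Function.Injective f) (hg : Function.Surjective g)
    (hfg : Function.Exact f g) (h : Subsingleton (ExtM R P Y 1)) (φ : M →ₗ[R] Y) :
    ∃ ψ : N →ₗ[R] Y, ψ ∘ₗ f = φ := by
  refine exists_comp_eq_of_subsingleton_ext hf ((ExtM.subsingleton_congr_left ?_ 1).mpr h) φ
  exact (Submodule.quotEquivOfEq _ _ (LinearMap.exact_iff.mp hfg).symm).trans
    (g.quotKerEquivOfSurjective hg)

theorem dualMap_exact {M N P : Type*} [AddCommGroup M] [Module R M]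
    [AddCommGroup N] [Module R N] [AddCommGroup P] [Module R P] {f : M →ₗ[R] N} {g : N →ₗ[R] P}
    (hg : Function.Surjective g) (hfg : Function.Exact f g) :
    Function.Exact g.dualMap f.dualMap := by
  intro φ
  constructor
  · intro h
    have hker : LinearMap.ker g ≤ LinearMap.ker φ := by
      intro x hx
      obtain ⟨y, rfl⟩ := (hfg x).mp hx
      exact LinearMap.congr_fun h y
    refine ⟨(LinearMap.ker g).liftQ φ hker ∘ₗ (g.quotKerEquivOfSurjective hg).symm.toLinearMap, ?_⟩
    ext x
    have : (g.quotKerEquivOfSurjective hg).symm (g x) = Submodule.Quotient.mk x := by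
      rw [LinearEquiv.symm_apply_eq]; rfl
    change (LinearMap.ker g).liftQ φ hker ((g.quotKerEquivOfSurjective hg).symm (g x)) = φ x
    rw [this]
    rfl
  · rintro ⟨ψ, rfl⟩
    ext x
    change ψ (g (f x)) = 0
    rw [hfg.apply_apply_eq_zero, map_zero]

namespace IsGorensteinOfDim

variable [IsLocalRing R] [IsNoetherianRing R] {d : ℕ} (hR : IsGorensteinOfDim R d)

include hR

theorem subsingleton_ext_residueField_free (F : Type u) [AddCommGroup F] [Module R F]
    [Module.Free R F] (i : ℕ) (hi : i < d) :
    Subsingleton (ExtM R (R ⧸ maximalIdeal R) F i) := by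
  obtain ⟨rs, rfl, hmem, hreg, -⟩ := hR.exists_isWeaklyRegular
  have hreg' : IsWeaklyRegular F rs :=
    ((TensorProduct.rid R F).isWeaklyRegular_congr rs).mp (hreg.isWeaklyRegular_lTensor (M₂ := F))
  refine ExtM.subsingleton_of_lt_length rs F hreg' (fun r hr n ↦ ?_) i hi
  obtain ⟨y, rfl⟩ := Ideal.Quotient.mk_surjective n
  rw [Algebra.smul_def, Ideal.Quotient.algebraMap_eq, ← map_mul, Ideal.Quotient.eq_zero_iff_mem]
  exact Ideal.mul_mem_right _ _ (hmem r hr)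

/-- The passage from depth to vanishing of `Ext` into `R`; `subsingleton_ext_dual` goes in the
opposite direction, at the price of dualising. -/
theorem subsingleton_ext_of_depth (N : Type u) [AddCommGroup N] [Module R N] [Module.Finite R N]
    (r : ℕ) (h : ∀ i < r, Subsingleton (ExtM R (R ⧸ maximalIdeal R) N i)) (j : ℕ)
    (hj : d < j + r) : Subsingleton (ExtM R N R j) := by
  obtain ⟨rs, rfl, hmem, hreg⟩ := exists_isWeaklyRegular_of_subsingleton_ext (M := N) ⊤
    (fun p hp h ↦ (hp.ne_top (top_le_iff.mp h)).elim) r h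
  exact ExtM.subsingleton_of_isWeaklyRegular hR.subsingleton_ext rs (fun r hr ↦ (hmem r hr).1) N
    hreg j hj

/-- The dual of a module without higher `Ext` into `R` has maximal depth. -/
theorem subsingleton_ext_dual (M : Type u) [AddCommGroup M] [Module R M] [Module.Finite R M]
    (hM : ∀ j, 0 < j → Subsingleton (ExtM R M R j)) (i : ℕ) (hi : i < d) :
    Subsingleton (ExtM R (R ⧸ maximalIdeal R) (Module.Dual R M) i) := by
  induction i generalizing M with
  | zero =>
    obtain ⟨n, g, hg⟩ := Module.Finite.exists_fin' R M
    have := hR.subsingleton_ext_residueField_free (Module.Dual R (Fin n → R)) 0 hi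
    exact (ExtM.post_zero_injective (LinearMap.dualMap_injective_of_surjective hg)).subsingleton
  | succ i ih =>
    obtain ⟨n, g, hg⟩ := Module.Finite.exists_fin' R M
    have hex := LinearMap.exact_subtype_ker_map g
    -- As `Ext¹(M, R) = 0`, the dual of `0 → ker g → R^n → M → 0` is again exact. The syzygy
    -- inherits the hypothesis on `M`, so the depth bound for its dual, raised by one, passes to the
    -- dual of `M`.
    have hsurj : Function.Surjective (LinearMap.ker g).subtype.dualMap := fun φ ↦
      exists_comp_eq_of_exact (Submodule.subtype_injective _) hg hex (hM 1 one_pos) φ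
    refine ExtM.post_subsingleton₁ (LinearMap.dualMap_injective_of_surjective hg) hsurj
      (dualMap_exact hg hex) _ i (ih (LinearMap.ker g) (fun j hj ↦ ?_) (by omega))
      (hR.subsingleton_ext_residueField_free _ _ hi)
    exact ExtM.pre_subsingleton₁ (Submodule.subtype_injective _) hg hex R j
      (ExtM.subsingleton_of_free j hj) (hM (j + 1) (by omega))

/-- A dual module over a ring of depth at least two has depth at least two. -/
theorem subsingleton_ext_dual_of_lt_two (hd : 2 ≤ d) (M : Type u) [AddCommGroup M] [Module R M]
    [Module.Finite R M] (i : ℕ) (hi : i < 2) :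
    Subsingleton (ExtM R (R ⧸ maximalIdeal R) (Module.Dual R M) i) := by
  have key : ∀ (M : Type u) [AddCommGroup M] [Module R M] [Module.Finite R M],
      Subsingleton (ExtM R (R ⧸ maximalIdeal R) (Module.Dual R M) 0) := by
    intro M _ _ _
    obtain ⟨n, g, hg⟩ := Module.Finite.exists_fin' R M
    have := hR.subsingleton_ext_residueField_free (Module.Dual R (Fin n → R)) 0 (by omega)
    exact (ExtM.post_zero_injective (LinearMap.dualMap_injective_of_surjective hg)).subsingleton
  obtain rfl | rfl : i = 0 ∨ i = 1 := by omega
  · exact key M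
  obtain ⟨n, g, hg⟩ := Module.Finite.exists_fin' R M
  have hex := dualMap_exact hg (LinearMap.exact_subtype_ker_map g)
  have := key (LinearMap.ker g)
  -- The dual of `M` is the kernel of `(R^n)^* → (ker g)^*`, whose image has depth at least one as a
  -- submodule of a dual.
  have hrange : Subsingleton (ExtM R (R ⧸ maximalIdeal R)
      (LinearMap.range (LinearMap.ker g).subtype.dualMap) 0) := by
    have hinj : Function.Injective (LinearMap.range (LinearMap.ker g).subtype.dualMap).subtype :=
      Submodule.subtype_injective _
    exact (ExtM.post_zero_injective hinj).subsingleton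
  refine ExtM.post_subsingleton₁ (g := (LinearMap.ker g).subtype.dualMap.rangeRestrict)
    (LinearMap.dualMap_injective_of_surjective hg) (LinearMap.surjective_rangeRestrict _)
    (fun x ↦ ?_) _ 0
    hrange
    (hR.subsingleton_ext_residueField_free _ 1 (by omega))
  rw [← hex x, Subtype.ext_iff]
  rfl

/-- A module without higher `Ext` into `R` surjects onto its bidual. -/
theorem exists_eval_eq (M : Type u) [AddCommGroup M] [Module R M] [Module.Finite R M]
    (hM : ∀ j, 0 < j → Subsingleton (ExtM R M R j)) (ψ : Module.Dual R M →ₗ[R] R) :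
    ∃ m : M, ∀ φ, ψ φ = φ m := by
  obtain ⟨n, g, hg⟩ := Module.Finite.exists_fin' R M
  have hex := LinearMap.exact_subtype_ker_map g
  have hsurj : Function.Surjective (LinearMap.ker g).subtype.dualMap := fun φ ↦
    exists_comp_eq_of_exact (Submodule.subtype_injective _) hg hex (hM 1 one_pos) φ
  -- The dual of the syzygy has full depth, so its `Ext¹` into `R` vanishes and `ψ` extends to the
  -- dual of `R^n`, where it is evaluation at a vector.
  have hK := hR.subsingleton_ext_of_depth _ d (hR.subsingleton_ext_dual (LinearMap.ker g)
    fun j hj ↦ ExtM.pre_subsingleton₁ (Submodule.subtype_injective _) hg hex R j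
      (ExtM.subsingleton_of_free j hj) (hM (j + 1) (by omega))) 1 (by omega)
  obtain ⟨Ψ, hΨ⟩ := exists_comp_eq_of_exact (LinearMap.dualMap_injective_of_surjective hg) hsurj
    (dualMap_exact hg hex) hK ψ
  obtain ⟨v, rfl⟩ := (Module.evalEquiv R (Fin n → R)).surjective Ψ
  refine ⟨g v, fun φ ↦ ?_⟩
  rw [← hΨ]
  rfl

end IsGorensteinOfDim

end Duality

/-! ### Gorenstein ideals of height one: dimension of the quotient, two-generated dual. -/

section GorensteinHeightOne

open RingTheory.Sequence IsLocalRing Pointwise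

variable {R : Type u} [CommRing R] [IsLocalRing R] [IsNoetherianRing R] [IsDomain R] {d : ℕ}

namespace IsGorensteinOfDim

variable (hR : IsGorensteinOfDim R d) {I : Ideal R} (hI : I.IsGorenstein) (hI1 : I.height = 1)

include hR hI hI1

/-- A nonzero element of `I` gives `s + 1 ≤ d`. If the inequality were strict, `Ext¹(R ⧸ I, R)`
would vanish and every map `I → R` would be multiplication by a ring element, against
`exists_linearMap_of_height_eq_one`. -/
theorem exists_isGorensteinOfDim_quotient : ∃ (_ : IsLocalRing (R ⧸ I)) (s : ℕ),
    s + 1 = d ∧ IsGorensteinOfDim (R ⧸ I) s := by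
  have hloc : IsLocalRing (R ⧸ I) := hI.2.1
  obtain ⟨s, hs⟩ := IsGorensteinLocalRing.exists_isGorensteinOfDim hI
  refine ⟨hloc, s, le_antisymm ?_ ?_, hs⟩
  · obtain ⟨a, haI, ha0⟩ := Submodule.exists_mem_ne_zero_of_ne_bot (Ideal.ne_bot_of_height_one hI1)
    have h1 := ringKrullDim_quotient_succ_le_of_nonZeroDivisor (mem_nonZeroDivisors_of_ne_zero ha0)
    have h2 : ringKrullDim (R ⧸ I) ≤ ringKrullDim (R ⧸ Ideal.span {a}) :=
      ringKrullDim_le_of_surjective (Ideal.Quotient.factor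
        ((Ideal.span_singleton_le_iff_mem I).mpr haI)) (Ideal.Quotient.factor_surjective _)
    have h3 := (add_le_add_left h2 1).trans h1
    rw [hs.ringKrullDim_eq, hR.ringKrullDim_eq] at h3
    exact_mod_cast h3
  · by_contra! hlt
    have h1 := hR.subsingleton_ext_quotient_of_lt hs 1 (by omega)
    obtain ⟨φ, hφ⟩ := exists_linearMap_of_height_eq_one hI1
    obtain ⟨ψ, hψ⟩ := exists_comp_eq_of_exact (Submodule.subtype_injective I)
      (Submodule.mkQ_surjective I) (LinearMap.exact_subtype_mkQ I) h1 φ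
    refine hφ (ψ 1) ?_
    rw [← hψ]
    ext x
    have := ψ.map_smul (x : R) 1
    rw [smul_eq_mul, mul_one] at this
    change ψ x = ψ 1 • (x : R)
    rw [this, smul_eq_mul, smul_eq_mul, mul_comm]

/-- The multipliers of a Gorenstein ideal of height one are generated by two elements, one of
which is the inclusion. -/
theorem exists_dual_generator : ∃ f : I →ₗ[R] R, ∀ φ : I →ₗ[R] R, ∃ a b : R,
    φ = a • I.subtype + b • f := by
  obtain ⟨_, s, hs, hB⟩ := hR.exists_isGorensteinOfDim_quotient hI hI1
  obtain ⟨ε, hε⟩ := hR.exists_generator_ext_quotient hB 1 (by omega)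
  obtain ⟨δ, hδ1, hδ2⟩ := ExtM.exists_pre_connecting (Submodule.subtype_injective I)
      (Submodule.mkQ_surjective I) (LinearMap.exact_subtype_mkQ I) R 0
  have := ExtM.subsingleton_of_free (R := R) (M := R) (Y := R) 1 one_pos
  -- The sequence `Hom(R, R) → Hom(I, R) → Ext¹(R ⧸ I, R) → 0` lets `f` be a preimage of the
  -- generator; the remaining ambiguity is a multiple of the inclusion.
  obtain ⟨f, hf⟩ := (hδ2 ε).mp (Subsingleton.elim _ _)
  obtain ⟨f, rfl⟩ := (ExtM.zeroEquiv R I R).surjective f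
  refine ⟨f, fun φ ↦ ?_⟩
  obtain ⟨b, hb⟩ := hε (δ (ExtM.zeroEquiv R I R φ))
  obtain ⟨ψ, hψ⟩ := (hδ1 (ExtM.zeroEquiv R I R (φ - b • f))).mp (by
    rw [map_sub, map_sub, map_smul, map_smul, hf, hb, sub_self])
  obtain ⟨ψ, rfl⟩ := (ExtM.zeroEquiv R R R).surjective ψ
  rw [ExtM.pre_zeroEquiv, EmbeddingLike.apply_eq_iff_eq] at hψ
  refine ⟨ψ 1, b, ?_⟩
  rw [← sub_eq_iff_eq_add, ← hψ]
  ext x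
  have := ψ.map_smul (x : R) 1
  rw [smul_eq_mul, mul_one] at this
  change ψ x = ψ 1 • (x : R)
  rw [this, smul_eq_mul, smul_eq_mul, mul_comm]

/-- `Ext^j(I, R)` is `Ext^(j+1)(R ⧸ I, R)`, which vanishes above degree `d - dim (R ⧸ I) = 1`. -/
theorem subsingleton_ext_ideal (j : ℕ) (hj : 0 < j) : Subsingleton (ExtM R I R j) := by
  obtain ⟨_, s, hs, hB⟩ := hR.exists_isGorensteinOfDim_quotient hI hI1
  exact ExtM.pre_subsingleton₁ (Submodule.subtype_injective I)
      (Submodule.mkQ_surjective I) (LinearMap.exact_subtype_mkQ I) R j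
      (ExtM.subsingleton_of_free j hj) (hR.subsingleton_ext_quotient_of_gt hB (j + 1) (by omega))

end IsGorensteinOfDim

end GorensteinHeightOne

/-! ### Arithmetic of divisorial ideals, their duals and local principality. -/

section Divisorial

open FractionalIdeal

variable {R : Type u} [CommRing R] [IsDomain R]

theorem FractionalIdeal.divHull_mono {A B : FractionalIdeal R⁰ (FractionRing R)} (hA : A ≠ 0)
    (hB : B ≠ 0) (h : A ≤ B) : A.divHull ≤ B.divHull :=
  inv_anti_mono (inv_ne_zero_of_ne_zero hB) (inv_ne_zero_of_ne_zero hA) (inv_anti_mono hA hB h)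

namespace DivisorialIdeal

/-- The underlying `R`-submodule of the fraction field. -/
abbrev mod (D : DivisorialIdeal R) : Submodule R (FractionRing R) := (D.1 : Submodule R _)

variable [IsNoetherianRing R]

instance (D : DivisorialIdeal R) : Module.Finite R D.mod := by
  have := FractionalIdeal.isNoetherian D.1
  exact Module.IsNoetherian.finite R D.mod

variable [IsIntegrallyClosed R]

theorem mul_val (D E : DivisorialIdeal R) : (D * E).1 = (D.1 * E.1).divHull := rfl

theorem mul_mem {D E : DivisorialIdeal R} {x y : FractionRing R} (hx : x ∈ D.1) (hy : y ∈ E.1) :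
    x * y ∈ (D * E).1 :=
  le_divHull (mul_ne_zero_of_ne_zero D.2.1 E.2.1) (mul_mem_mul hx hy)

theorem mem_one {x : FractionRing R} :
    x ∈ (1 : DivisorialIdeal R).1 ↔ ∃ r : R, algebraMap R (FractionRing R) r = x := by
  rw [← mem_one_iff R⁰]
  change x ∈ (1 : FractionalIdeal R⁰ (FractionRing R)).divHull ↔ _
  rw [divHull, inv_one, inv_one]

theorem mem_principal {x : (FractionRing R)ˣ} {y : FractionRing R} :
    y ∈ (principal R x).1 ↔ ∃ r : R, r • (x : FractionRing R) = y :=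
  mem_spanSingleton R⁰

theorem mul_mono {D D' E : DivisorialIdeal R} (h : D.1 ≤ D'.1) : (D * E).1 ≤ (D' * E).1 :=
  divHull_mono (mul_ne_zero_of_ne_zero D.2.1 E.2.1) (mul_ne_zero_of_ne_zero D'.2.1 E.2.1)
    (mul_le_mul_left h _)

theorem mem_mul_inv_iff {D E : DivisorialIdeal R} {x : FractionRing R} :
    x ∈ (D * E⁻¹).1 ↔ ∀ y ∈ E.1, x * y ∈ D.1 := by
  refine ⟨fun hx y hy ↦ by simpa using mul_mem hx hy, fun h ↦ ?_⟩
  rcases eq_or_ne x 0 with rfl | hx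
  · exact zero_mem _
  have h1 : (principal R (Units.mk0 x hx) * E).1 ≤ D.1 := by
    rw [mul_val, ← D.2.2]
    refine divHull_mono (mul_ne_zero_of_ne_zero (principal R _).2.1 E.2.1) D.2.1 ?_
    rw [FractionalIdeal.mul_le]
    rintro i hi j hj
    obtain ⟨r, rfl⟩ := mem_principal.mp hi
    rw [smul_mul_assoc]
    exact Submodule.smul_mem D.mod r (h j hj)
  have h2 := mul_mono (E := E⁻¹) h1
  rw [mul_inv_cancel_right] at h2
  exact h2 (mem_principal.mpr ⟨1, one_smul _ _⟩)

theorem mem_inv_iff {E : DivisorialIdeal R} {x : FractionRing R} :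
    x ∈ (E⁻¹).1 ↔ ∀ y ∈ E.1, ∃ r : R, algebraMap R (FractionRing R) r = x * y := by
  rw [← one_mul E⁻¹, mem_mul_inv_iff]
  exact forall₂_congr fun y _ ↦ mem_one

omit [IsNoetherianRing R] [IsIntegrallyClosed R] in
theorem ext_mem {D E : DivisorialIdeal R} (h : ∀ x, x ∈ D.1 ↔ x ∈ E.1) : D = E :=
  Subtype.ext (FractionalIdeal.ext h)

/-- Multiplication by an element of `E` from `D` to a divisorial ideal containing `D * E`. -/
noncomputable def mulMap {D D' E : DivisorialIdeal R} (h : D * E = D') (x : FractionRing R)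
    (hx : x ∈ E.1) : D.mod →ₗ[R] D'.mod where
  toFun y := ⟨y * x, h ▸ mul_mem y.2 hx⟩
  map_add' y z := Subtype.ext (add_mul _ _ _)
  map_smul' r y := Subtype.ext (smul_mul_assoc _ _ _)

theorem mulMap_apply {D D' E : DivisorialIdeal R} (h : D * E = D') (x : FractionRing R)
    (hx : x ∈ E.1) (y : D.mod) : (mulMap h x hx y : FractionRing R) = y * x := rfl

theorem mulMap_injective {D D' E : DivisorialIdeal R} (h : D * E = D') (x : FractionRing R)
    (hx : x ∈ E.1) (hx0 : x ≠ 0) : Function.Injective (mulMap h x hx) := fun y z hyz ↦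
  Subtype.ext (mul_right_cancel₀ hx0 (congrArg Subtype.val hyz))

omit [IsNoetherianRing R] [IsIntegrallyClosed R] in
theorem exists_ne_zero (D : DivisorialIdeal R) : ∃ x ∈ D.1, x ≠ 0 := by
  by_contra! h
  exact D.2.1 (FractionalIdeal.eq_zero_iff.mpr h)

/-- `D⁻¹` is the dual of `D`. -/
noncomputable def invToDual (D : DivisorialIdeal R) : (D⁻¹).mod →ₗ[R] Module.Dual R D.mod where
  toFun x :=
    { toFun y := (mem_inv_iff.mp x.2 y y.2).choose
      map_add' y z := by
        apply IsFractionRing.injective R (FractionRing R)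
        rw [map_add, (mem_inv_iff.mp x.2 _ (y + z).2).choose_spec,
          (mem_inv_iff.mp x.2 _ y.2).choose_spec, (mem_inv_iff.mp x.2 _ z.2).choose_spec,
          Submodule.coe_add, mul_add]
      map_smul' r y := by
        apply IsFractionRing.injective R (FractionRing R)
        rw [(mem_inv_iff.mp x.2 _ (r • y).2).choose_spec, RingHom.id_apply, smul_eq_mul, map_mul,
          (mem_inv_iff.mp x.2 _ y.2).choose_spec, Submodule.coe_smul, Algebra.smul_def,
          mul_left_comm] }
  map_add' x x' := by
    ext y
    apply IsFractionRing.injective R (FractionRing R)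
    simp only [LinearMap.coe_mk, AddHom.coe_mk, LinearMap.add_apply, map_add]
    rw [(mem_inv_iff.mp x.2 _ y.2).choose_spec, (mem_inv_iff.mp x'.2 _ y.2).choose_spec,
      (mem_inv_iff.mp (x + x').2 _ y.2).choose_spec, Submodule.coe_add, add_mul]
  map_smul' r x := by
    ext y
    apply IsFractionRing.injective R (FractionRing R)
    simp only [LinearMap.coe_mk, AddHom.coe_mk, LinearMap.smul_apply, RingHom.id_apply,
      smul_eq_mul, map_mul]
    rw [(mem_inv_iff.mp x.2 _ y.2).choose_spec, (mem_inv_iff.mp (r • x).2 _ y.2).choose_spec,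
      Submodule.coe_smul, Algebra.smul_def, mul_assoc]

theorem algebraMap_invToDual (D : DivisorialIdeal R) (x : (D⁻¹).mod) (y : D.mod) :
    algebraMap R (FractionRing R) (invToDual D x y) = (x : FractionRing R) * y :=
  (mem_inv_iff.mp x.2 y y.2).choose_spec

omit [IsNoetherianRing R] [IsIntegrallyClosed R] in
-- Any two elements of the fraction field satisfy a linear relation over `R`, so the ratio `φ x / x`
-- is constant: linear forms on rank one modules are multiplications.
theorem linearMap_mul_eq {N : Submodule R (FractionRing R)} (φ : N →ₗ[R] R) (x y : N) :
    (y : FractionRing R) * algebraMap R _ (φ x) = x * algebraMap R _ (φ y) := by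
  obtain ⟨⟨a, s⟩, ha⟩ := IsLocalization.surj R⁰ (x : FractionRing R)
  obtain ⟨⟨b, t⟩, hb⟩ := IsLocalization.surj R⁰ (y : FractionRing R)
  have hs : algebraMap R (FractionRing R) s ≠ 0 :=
    IsFractionRing.to_map_ne_zero_of_mem_nonZeroDivisors s.2
  have ht : algebraMap R (FractionRing R) t ≠ 0 :=
    IsFractionRing.to_map_ne_zero_of_mem_nonZeroDivisors t.2
  have h1 : (b * (s : R)) • x = (a * (t : R)) • y := by
    apply Subtype.ext
    rw [Submodule.coe_smul, Submodule.coe_smul, Algebra.smul_def, Algebra.smul_def, map_mul,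
      map_mul, mul_assoc, mul_assoc, mul_comm _ (x : FractionRing R), ha, mul_comm _
      (y : FractionRing R), hb, mul_comm]
  have h2 := congrArg φ h1
  rw [map_smul, map_smul, smul_eq_mul, smul_eq_mul] at h2
  have h3 := congrArg (algebraMap R (FractionRing R)) h2
  rw [map_mul, map_mul, map_mul, map_mul, ← ha, ← hb] at h3
  apply mul_right_cancel₀ (mul_ne_zero hs ht)
  linear_combination h3

theorem invToDual_bijective (D : DivisorialIdeal R) : Function.Bijective (invToDual D) := by
  obtain ⟨y, hy, hy0⟩ := D.exists_ne_zero
  constructor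
  · intro x x' h
    have h1 := algebraMap_invToDual D x ⟨y, hy⟩
    rw [h, algebraMap_invToDual] at h1
    exact Subtype.ext (mul_right_cancel₀ hy0 h1.symm)
  · intro φ
    have key : ∀ z : D.mod, algebraMap R (FractionRing R) (φ z) =
        algebraMap R _ (φ ⟨y, hy⟩) / y * z := fun z ↦ by
      have := linearMap_mul_eq φ ⟨y, hy⟩ z
      rw [div_mul_eq_mul_div, eq_div_iff hy0, mul_comm, ← this, mul_comm]
    refine ⟨⟨algebraMap R _ (φ ⟨y, hy⟩) / y, mem_inv_iff.mpr fun z hz ↦ ⟨φ ⟨z, hz⟩, key ⟨z, hz⟩⟩⟩, ?_⟩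
    ext z
    apply IsFractionRing.injective R (FractionRing R)
    exact (algebraMap_invToDual D _ z).trans (key z).symm

/-- `D⁻¹` is the dual of `D`. -/
noncomputable def invEquivDual (D : DivisorialIdeal R) : (D⁻¹).mod ≃ₗ[R] Module.Dual R D.mod :=
  LinearEquiv.ofBijective _ (invToDual_bijective D)

/-- Divisorial ideals that are equal are isomorphic modules. -/
noncomputable def equivOfMkEq {D E : DivisorialIdeal R}
    (h : DivisorClassGroup.mk D = DivisorClassGroup.mk E) : D.mod ≃ₗ[R] E.mod := by
  have h1 : D⁻¹ * E ∈ (principal R).range := QuotientGroup.eq.mp (Additive.ofMul.injective h)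
  let x := h1.choose
  have hx : principal R x = D⁻¹ * E := h1.choose_spec
  have hmem : (x : FractionRing R) ∈ (principal R x).1 := mem_principal.mpr ⟨1, one_smul _ _⟩
  have hDE : D * principal R x = E := by rw [hx, mul_inv_cancel_left]
  refine LinearEquiv.ofBijective (mulMap hDE x hmem)
    ⟨mulMap_injective _ _ _ x.ne_zero, fun y ↦ ?_⟩
  have h2 : (y : FractionRing R) * (x⁻¹ : (FractionRing R)ˣ) ∈ D.1 := by
    have : (y : FractionRing R) * (x⁻¹ : (FractionRing R)ˣ) ∈ (E * principal R x⁻¹).1 :=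
      mul_mem y.2 (mem_principal.mpr ⟨1, one_smul _ _⟩)
    have hED : E * principal R x⁻¹ = D := by rw [map_inv, ← hDE, mul_inv_cancel_right]
    rwa [hED] at this
  refine ⟨⟨_, h2⟩, Subtype.ext ?_⟩
  rw [mulMap_apply, mul_assoc, Units.inv_mul, mul_one]

/-- The divisorial ideals that become principal at a prime `p`. -/
def locallyPrincipal (p : Ideal R) [hp : p.IsPrime] : Subgroup (DivisorialIdeal R) where
  -- The condition says `s D ⊆ R u ⊆ D` with `s ∉ p`. It avoids localising and is visibly stable
  -- under products and inverses.
  carrier := {D | ∃ u : FractionRing R, ∃ s : R, u ≠ 0 ∧ s ∉ p ∧ u ∈ D.1 ∧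
    algebraMap R (FractionRing R) s / u ∈ (D⁻¹).1}
  mul_mem' := by
    rintro D E ⟨u, s, hu, hs, hu', hs'⟩ ⟨v, t, hv, ht, hv', ht'⟩
    refine ⟨u * v, s * t, mul_ne_zero hu hv, fun h ↦ (hp.mem_or_mem h).elim hs ht,
      mul_mem hu' hv', ?_⟩
    rw [mul_inv, map_mul, mul_div_mul_comm]
    exact mul_mem hs' ht'
  one_mem' := ⟨1, 1, one_ne_zero, fun h ↦ hp.ne_top ((Ideal.eq_top_iff_one p).mpr h),
    mem_one.mpr ⟨1, map_one _⟩, by rw [inv_one]; exact mem_one.mpr ⟨1, by simp⟩⟩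
  inv_mem' := by
    rintro D ⟨u, s, hu, hs, hu', hs'⟩
    have hs0 : algebraMap R (FractionRing R) s ≠ 0 := fun h ↦ hs (by
      rw [(IsFractionRing.injective R (FractionRing R)) (h.trans (map_zero _).symm)]
      exact zero_mem _)
    refine ⟨_, s, div_ne_zero hs0 hu, hs, hs', ?_⟩
    rwa [inv_inv, div_div_cancel₀ hs0]

/-- Multiplication by `u` and by `s / u` are inverse to each other up to `s`, hence isomorphisms at
`p`. -/
theorem exists_maps_of_mem_locallyPrincipal {p : Ideal R} [p.IsPrime] {D E F : DivisorialIdeal R}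
    (hD : D ∈ locallyPrincipal p) (h : E * D = F) :
    ∃ (φ : E.mod →ₗ[R] F.mod) (ψ : F.mod →ₗ[R] E.mod) (s : R), s ∉ p ∧
      φ ∘ₗ ψ = LinearMap.lsmul R _ s ∧ ψ ∘ₗ φ = LinearMap.lsmul R _ s := by
  obtain ⟨u, s, hu, hs, hu', hs'⟩ := hD
  refine ⟨mulMap h u hu', mulMap (by rw [← h, mul_inv_cancel_right]) _ hs', s, hs, ?_, ?_⟩
  · ext y
    simp only [LinearMap.comp_apply, mulMap_apply, LinearMap.lsmul_apply, Submodule.coe_smul,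
      Algebra.smul_def]
    field_simp
  · ext y
    simp only [LinearMap.comp_apply, mulMap_apply, LinearMap.lsmul_apply, Submodule.coe_smul,
      Algebra.smul_def]
    field_simp

end DivisorialIdeal

end Divisorial

/-! ### Depth, its localisation and its description by `Ext`. -/

section ModuleDepth

open RingTheory.Sequence IsLocalRing

theorem moduleDepth_congr {A : Type*} [CommRing A] [IsLocalRing A] {M N : Type*} [AddCommGroup M]
    [Module A M] [AddCommGroup N] [Module A N] (e : M ≃ₗ[A] N) :
    moduleDepth A M = moduleDepth A N := by
  simp only [moduleDepth, e.isWeaklyRegular_congr]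

theorem natCast_le_moduleDepth_iff {A : Type*} [CommRing A] [IsLocalRing A] {M : Type*}
    [AddCommGroup M] [Module A M] {n : ℕ} : (n : ℕ∞) ≤ moduleDepth A M ↔
      ∃ rs : List A, rs.length = n ∧ (∀ r ∈ rs, r ∈ maximalIdeal A) ∧ IsWeaklyRegular M rs := by
  constructor
  · intro h
    rcases n with _ | n
    · exact ⟨[], rfl, by simp, .nil A M⟩
    have h1 : (n : ℕ∞) < moduleDepth A M := lt_of_lt_of_le (by exact_mod_cast n.lt_succ_self) h
    obtain ⟨rs, h2⟩ := lt_iSup_iff.mp h1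
    obtain ⟨⟨hmem, hreg⟩, h3⟩ := lt_iSup_iff.mp h2
    have h4 : n + 1 ≤ rs.length := by exact_mod_cast h3
    -- The supremum only provides a sequence of length at least `n + 1`; an initial segment is still
    -- weakly regular.
    rw [← List.take_append_drop (n + 1) rs, isWeaklyRegular_append_iff] at hreg
    exact ⟨rs.take (n + 1), by simp [h4], fun r hr ↦ hmem r (List.mem_of_mem_take hr), hreg.1⟩
  · rintro ⟨rs, rfl, hmem, hreg⟩
    exact le_iSup₂_of_le rs ⟨hmem, hreg⟩ le_rfl

variable {R : Type u} [CommRing R]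

theorem localizedModule_map_bijective {M N : Type u} [AddCommGroup M] [Module R M]
    [AddCommGroup N] [Module R N] (S : Submonoid R) (φ : M →ₗ[R] N) (ψ : N →ₗ[R] M) (s : S)
    (h1 : φ ∘ₗ ψ = LinearMap.lsmul R _ s) (h2 : ψ ∘ₗ φ = LinearMap.lsmul R _ s) :
    Function.Bijective (LocalizedModule.map S φ) := by
  have key : ∀ {M N : Type u} [AddCommGroup M] [Module R M] [AddCommGroup N] [Module R N]
      (φ : M →ₗ[R] N) (ψ : N →ₗ[R] M) (_ : φ ∘ₗ ψ = LinearMap.lsmul R _ s)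
      (x : LocalizedModule S N), LocalizedModule.map S φ (LocalizedModule.map S ψ x) =
        (s : R) • x := by
    intro M N _ _ _ _ φ ψ h x
    induction x using LocalizedModule.induction_on with | _ m t
    rw [LocalizedModule.map_mk, LocalizedModule.map_mk, LocalizedModule.smul'_mk]
    exact congrArg (LocalizedModule.mk · t) (LinearMap.congr_fun h m)
  have hs : ∀ {N : Type u} [AddCommGroup N] [Module R N],
      Function.Bijective fun x : LocalizedModule S N ↦ (s : R) • x := fun {N} _ _ ↦
    (Module.End.isUnit_iff _).mp (IsLocalizedModule.map_units (LocalizedModule.mkLinearMap S N) s)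
  refine ⟨fun x y hxy ↦ hs.1 ?_, fun y ↦ ?_⟩
  · dsimp only
    rw [← key ψ φ h2, ← key ψ φ h2, hxy]
  · obtain ⟨z, rfl⟩ := hs.2 y
    exact ⟨_, key φ ψ h1 z⟩

theorem moduleDepth_localizedModule_congr {M N : Type u} [AddCommGroup M] [Module R M]
    [AddCommGroup N] [Module R N] (p : Ideal R) [p.IsPrime] (φ : M →ₗ[R] N) (ψ : N →ₗ[R] M)
    (s : R) (hs : s ∉ p) (h1 : φ ∘ₗ ψ = LinearMap.lsmul R _ s)
    (h2 : ψ ∘ₗ φ = LinearMap.lsmul R _ s) :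
    moduleDepth (Localization.AtPrime p) (LocalizedModule p.primeCompl M) =
      moduleDepth (Localization.AtPrime p) (LocalizedModule p.primeCompl N) :=
  moduleDepth_congr (LinearEquiv.ofBijective _
    (localizedModule_map_bijective p.primeCompl φ ψ ⟨s, hs⟩ h1 h2))

theorem IsMaximalCohenMacaulay.congr {M N : Type u} [AddCommGroup M] [Module R M]
    [AddCommGroup N] [Module R N] (e : M ≃ₗ[R] N) (h : IsMaximalCohenMacaulay R M) :
    IsMaximalCohenMacaulay R N := by
  have := h.1
  refine ⟨Module.Finite.equiv e, fun p hp ↦ (h.2 p).trans_eq ?_⟩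
  refine moduleDepth_localizedModule_congr p e.toLinearMap e.symm.toLinearMap 1
    (fun h ↦ hp.ne_top ((Ideal.eq_top_iff_one p).mpr h)) ?_ ?_ <;> ext <;> simp

variable [IsLocalRing R]

theorem moduleDepth_localizedModule_maximalIdeal (M : Type*) [AddCommGroup M] [Module R M] :
    moduleDepth (Localization.AtPrime (maximalIdeal R))
      (LocalizedModule (maximalIdeal R).primeCompl M) = moduleDepth R M := by
  have hunit : ∀ x ∈ (maximalIdeal R).primeCompl, IsUnit x := fun x hx ↦ by simpa using hx
  have hsurj : Function.Surjective (algebraMap R (Localization.AtPrime (maximalIdeal R))) :=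
    (IsLocalization.atUnits R _ hunit).surjective
  have hbij : Function.Bijective (LocalizedModule.mkLinearMap (maximalIdeal R).primeCompl M) := by
    constructor
    · refine (injective_iff_map_eq_zero _).mpr fun m hm ↦ ?_
      obtain ⟨s, hs⟩ := (IsLocalizedModule.eq_zero_iff (maximalIdeal R).primeCompl _).mp hm
      exact (hunit s s.2).smul_eq_zero.mp hs
    · intro x
      induction x using LocalizedModule.induction_on with | _ m s
      obtain ⟨u, hu⟩ := hunit s s.2
      refine ⟨(↑u⁻¹ : R) • m, ?_⟩
      rw [LocalizedModule.mkLinearMap_apply, LocalizedModule.mk_eq]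
      refine ⟨1, ?_⟩
      simp only [one_smul]
      rw [Submonoid.smul_def, ← hu, smul_smul, Units.mul_inv, one_smul]
  refine le_antisymm ?_ ?_ <;> refine ENat.forall_natCast_le_iff_le.mp fun n hn ↦ ?_
  · obtain ⟨rs, hlen, hmem, hreg⟩ := natCast_le_moduleDepth_iff.mp hn
    obtain ⟨rs, rfl⟩ := List.map_surjective_iff.mpr hsurj rs
    rw [isWeaklyRegular_map_algebraMap_iff, ← (LinearEquiv.ofBijective _ hbij).isWeaklyRegular_congr]
      at hreg
    refine natCast_le_moduleDepth_iff.mpr ⟨rs, by simpa using hlen, fun r hr ↦ ?_, hreg⟩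
    exact (IsLocalization.AtPrime.to_map_mem_maximal_iff (Localization.AtPrime (maximalIdeal R))
      (maximalIdeal R) r).mp (hmem _ (List.mem_map_of_mem hr))
  · obtain ⟨rs, hlen, hmem, hreg⟩ := natCast_le_moduleDepth_iff.mp hn
    rw [(LinearEquiv.ofBijective _ hbij).isWeaklyRegular_congr,
      ← isWeaklyRegular_map_algebraMap_iff (S := Localization.AtPrime (maximalIdeal R))] at hreg
    refine natCast_le_moduleDepth_iff.mpr ⟨_, by simpa using hlen, fun r hr ↦ ?_, hreg⟩
    obtain ⟨r, hr', rfl⟩ := List.mem_map.mp hr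
    exact (IsLocalization.AtPrime.to_map_mem_maximal_iff (Localization.AtPrime (maximalIdeal R))
      (maximalIdeal R) r).mpr (hmem r hr')

variable [IsNoetherianRing R] {M : Type u} [AddCommGroup M] [Module R M] {d : ℕ}

theorem natCast_le_moduleDepth_iff_subsingleton_ext [Module.Finite R M] {n : ℕ} :
    (n : ℕ∞) ≤ moduleDepth R M ↔
      ∀ i < n, Subsingleton (ExtM R (R ⧸ maximalIdeal R) M i) := by
  rw [natCast_le_moduleDepth_iff]
  constructor
  · rintro ⟨rs, rfl, hmem, hreg⟩ i hi
    refine ExtM.subsingleton_of_lt_length rs M hreg (fun r hr x ↦ ?_) i hi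
    obtain ⟨x, rfl⟩ := Submodule.mkQ_surjective _ x
    rw [← map_smul, Submodule.mkQ_apply, Submodule.Quotient.mk_eq_zero]
    exact Ideal.mul_mem_right _ _ (hmem r hr)
  · intro h
    obtain ⟨rs, hlen, hmem, hreg⟩ := exists_isWeaklyRegular_of_subsingleton_ext (M := M) ⊤
      (fun p hp h ↦ (hp.ne_top (top_le_iff.mp h)).elim) n h
    exact ⟨rs, hlen, fun r hr ↦ (hmem r hr).1, hreg⟩

theorem IsMaximalCohenMacaulay.subsingleton_ext (hd : ringKrullDim R = d)
    (h : IsMaximalCohenMacaulay R M) (i : ℕ) (hi : i < d) :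
    Subsingleton (ExtM R (R ⧸ maximalIdeal R) M i) := by
  have := h.1
  have h1 := h.2 (maximalIdeal R)
  have h2 : (maximalIdeal R).height = d := by
    exact_mod_cast maximalIdeal_height_eq_ringKrullDim.trans hd
  rw [moduleDepth_localizedModule_maximalIdeal, h2] at h1
  exact natCast_le_moduleDepth_iff_subsingleton_ext.mp h1 i hi

theorem isMaximalCohenMacaulay_of_subsingleton_ext (hd : ringKrullDim R = d) [Module.Finite R M]
    (h : ∀ i < d, Subsingleton (ExtM R (R ⧸ maximalIdeal R) M i))
    (h' : ∀ (p : Ideal R) [p.IsPrime], p ≠ maximalIdeal R → p.height ≤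
      moduleDepth (Localization.AtPrime p) (LocalizedModule p.primeCompl M)) :
    IsMaximalCohenMacaulay R M := by
  refine ⟨inferInstance, fun p hp ↦ ?_⟩
  rcases eq_or_ne p (maximalIdeal R) with rfl | hpm
  · have h2 : (maximalIdeal R).height = d := by
      exact_mod_cast maximalIdeal_height_eq_ringKrullDim.trans hd
    rw [moduleDepth_localizedModule_maximalIdeal, h2]
    exact natCast_le_moduleDepth_iff_subsingleton_ext.mpr h
  · exact h' p hpm

end ModuleDepth

/-! ### The divisorial hull of an ideal; Gorenstein ideals of height one are reflexive. -/

section IdealHull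

open FractionalIdeal IsLocalRing

variable {R : Type u} [CommRing R] [IsDomain R] [IsNoetherianRing R] [IsIntegrallyClosed R]

namespace DivisorialIdeal

/-- The divisorial hull of a nonzero ideal. -/
noncomputable abbrev ofIdeal (I : Ideal R) (hI : I ≠ ⊥) : DivisorialIdeal R :=
  mk (I : FractionalIdeal R⁰ (FractionRing R)) (coeIdeal_ne_zero.mpr hI)

variable {I : Ideal R} (hI : I ≠ ⊥)

omit [IsNoetherianRing R] [IsIntegrallyClosed R] in
theorem algebraMap_mem_ofIdeal {x : R} (hx : x ∈ I) :
    algebraMap R (FractionRing R) x ∈ (ofIdeal I hI).1 :=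
  le_divHull (coeIdeal_ne_zero.mpr hI) (mem_coeIdeal_of_mem _ hx)

theorem mem_ofIdeal_inv_iff {x : FractionRing R} : x ∈ ((ofIdeal I hI)⁻¹).1 ↔
    ∀ y ∈ I, ∃ r, algebraMap R (FractionRing R) r = x * algebraMap R _ y := by
  have h0 := coeIdeal_ne_zero (K := FractionRing R).mpr hI
  have h1 : ((ofIdeal I hI)⁻¹).1 = (I : FractionalIdeal R⁰ (FractionRing R))⁻¹ := by
    change ((I : FractionalIdeal R⁰ (FractionRing R)).divHull⁻¹).divHull = _
    rw [inv_divHull h0, divHull]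
    exact inv_divHull h0
  rw [h1, FractionalIdeal.mem_inv_iff h0]
  constructor
  · exact fun h y hy ↦ (mem_one_iff _).mp (h _ (mem_coeIdeal_of_mem _ hy))
  · rintro h y hy
    obtain ⟨y, hy, rfl⟩ := (mem_coeIdeal _).mp hy
    exact (mem_one_iff _).mpr (h y (by simpa using hy))

theorem algebraMap_mem_ofIdeal_inv (r : R) :
    algebraMap R (FractionRing R) r ∈ ((ofIdeal I hI)⁻¹).1 :=
  (mem_ofIdeal_inv_iff hI).mpr fun y _ ↦ ⟨r * y, map_mul _ _ _⟩

theorem exists_mem_inv_of_linearMap (φ : I →ₗ[R] R) : ∃ x ∈ ((ofIdeal I hI)⁻¹).1,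
    ∀ y : I, algebraMap R (FractionRing R) (φ y) = x * algebraMap R _ (y : R) := by
  obtain ⟨i, hi, hi0⟩ := Submodule.exists_mem_ne_zero_of_ne_bot hI
  have hi0' : algebraMap R (FractionRing R) i ≠ 0 := by
    simpa using hi0
  have key : ∀ y : I, algebraMap R (FractionRing R) (φ y) =
      algebraMap R _ (φ ⟨i, hi⟩) / algebraMap R _ i * algebraMap R _ (y : R) := fun y ↦ by
    have h1 : i • y = (y : R) • (⟨i, hi⟩ : I) := Subtype.ext (mul_comm _ _)
    have h2 := congrArg φ h1
    rw [map_smul, map_smul, smul_eq_mul, smul_eq_mul] at h2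
    rw [div_mul_eq_mul_div, eq_div_iff hi0', ← map_mul, ← map_mul, mul_comm, h2, mul_comm]
  exact ⟨_, (mem_ofIdeal_inv_iff hI).mpr fun y hy ↦ ⟨_, key ⟨y, hy⟩⟩, key⟩

omit [IsNoetherianRing R] [IsIntegrallyClosed R] in
include hI in
theorem eq_of_forall_mul_eq {x x' : FractionRing R}
    (h : ∀ y ∈ I, x * algebraMap R _ y = x' * algebraMap R _ y) : x = x' := by
  obtain ⟨i, hi, hi0⟩ := Submodule.exists_mem_ne_zero_of_ne_bot hI
  have hi0' : algebraMap R (FractionRing R) i ≠ 0 := by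
    simpa using hi0
  exact mul_right_cancel₀ hi0' (h i hi)

/-- An element of the inverse of the hull of an ideal as a linear form on the ideal. -/
theorem exists_linearMap_of_mem_inv {x : FractionRing R} (hx : x ∈ ((ofIdeal I hI)⁻¹).1) :
    ∃ φ : I →ₗ[R] R, ∀ y : I, algebraMap R (FractionRing R) (φ y) = x * algebraMap R _ (y : R) := by
  have h := (mem_ofIdeal_inv_iff hI).mp hx
  choose! φ hφ using h
  refine ⟨{ toFun y := φ y, map_add' y z := ?_, map_smul' r y := ?_ }, fun y ↦ hφ y y.2⟩
  · apply IsFractionRing.injective R (FractionRing R)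
    rw [map_add, hφ _ y.2, hφ _ z.2, hφ _ (y + z).2, Submodule.coe_add, map_add, mul_add]
  · apply IsFractionRing.injective R (FractionRing R)
    rw [RingHom.id_apply, smul_eq_mul, map_mul, hφ _ y.2, hφ _ (r • y).2, Submodule.coe_smul,
      smul_eq_mul, map_mul, mul_left_comm]

/-- Up to a factor outside `p`, a basis vector of `I_p` comes from some `y ∈ I`, and each element of
`I` is a multiple of `y` after multiplication by a factor outside `p`. Finite generation of `I /
(y)` makes that factor uniform. -/
theorem ofIdeal_mem_locallyPrincipal (p : Ideal R) [p.IsPrime]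
    [Module.Free (Localization.AtPrime p) (LocalizedModule p.primeCompl I)] :
    ofIdeal I hI ∈ locallyPrincipal p := by
  obtain ⟨x₀, hx₀, hx₀0⟩ := Submodule.exists_mem_ne_zero_of_ne_bot hI
  let b := Module.Free.chooseBasis (Localization.AtPrime p) (LocalizedModule p.primeCompl I)
  let g := LocalizedModule.mkLinearMap p.primeCompl I
  have hne : Nonempty (Module.Free.ChooseBasisIndex (Localization.AtPrime p)
      (LocalizedModule p.primeCompl I)) := by
    by_contra hempty
    rw [not_nonempty_iff] at hempty
    have := b.repr.toEquiv.subsingleton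
    obtain ⟨s, hs⟩ := (IsLocalizedModule.eq_zero_iff p.primeCompl g (m := ⟨x₀, hx₀⟩)).mp
      (Subsingleton.elim _ _)
    rcases mul_eq_zero.mp (congrArg Subtype.val hs) with h | h
    · exact s.2 (by rw [h]; exact zero_mem p)
    · exact hx₀0 h
  obtain ⟨i⟩ := hne
  obtain ⟨⟨y, t⟩, hy⟩ := IsLocalizedModule.surj p.primeCompl g (b i)
  have hinj : Function.Injective (algebraMap R (Localization.AtPrime p)) :=
    IsLocalization.injective _ p.primeCompl_le_nonZeroDivisors
  -- The relation `x • g y = y • g x` is read in the single coordinate `i`, so the rank of `I_p`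
  -- need not be known.
  have key : ∀ x : I, ∃ s : R, s ∉ p ∧ ∃ r : R, s * x = r * y := fun x ↦ by
    obtain ⟨⟨r, s⟩, hr⟩ := IsLocalization.surj p.primeCompl (b.coord i (g x))
    refine ⟨s * t, fun h ↦ (Ideal.IsPrime.mem_or_mem ‹_› h).elim s.2 t.2, r, hinj ?_⟩
    have h1 : (x : R) • g y = (y : R) • g x := by
      rw [← map_smul, ← map_smul]
      exact congrArg g (Subtype.ext (mul_comm _ _))
    have h2 := congrArg (b.coord i) h1
    rw [← hy, Submonoid.smul_def, ← algebraMap_smul (Localization.AtPrime p),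
      ← algebraMap_smul (Localization.AtPrime p) (t : R),
      ← algebraMap_smul (Localization.AtPrime p) (y : R), map_smul, map_smul, map_smul] at h2
    simp only [Module.Basis.coord_apply, Module.Basis.repr_self, Finsupp.single_eq_same, smul_eq_mul,
      mul_one] at h2 hr
    rw [map_mul, map_mul, map_mul, ← hr]
    linear_combination algebraMap R (Localization.AtPrime p) s * h2
  have hsupp : (⟨p, inferInstance⟩ : PrimeSpectrum R) ∉
      Module.support R (I ⧸ Submodule.span R {y}) := by
    rw [Module.notMem_support_iff']
    intro m
    obtain ⟨x, rfl⟩ := Submodule.mkQ_surjective _ m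
    obtain ⟨s, hs, r, hr⟩ := key x
    refine ⟨s, hs, ?_⟩
    rw [← map_smul, Submodule.mkQ_apply, Submodule.Quotient.mk_eq_zero]
    exact Submodule.mem_span_singleton.mpr ⟨r, Subtype.ext hr.symm⟩
  rw [Module.mem_support_iff_of_finite, SetLike.not_le_iff_exists] at hsupp
  obtain ⟨s, hs, hsp⟩ := hsupp
  have hall : ∀ x : I, ∃ r : R, r * (y : R) = s * x := fun x ↦ by
    have h1 := Module.mem_annihilator.mp hs (Submodule.Quotient.mk x)
    rw [← Submodule.Quotient.mk_smul, Submodule.Quotient.mk_eq_zero] at h1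
    obtain ⟨r, hr⟩ := Submodule.mem_span_singleton.mp h1
    exact ⟨r, congrArg Subtype.val hr⟩
  have hy0 : (y : R) ≠ 0 := fun h ↦ by
    obtain ⟨r, hr⟩ := hall ⟨x₀, hx₀⟩
    rw [h, mul_zero] at hr
    rcases mul_eq_zero.mp hr.symm with h | h
    · exact hsp (by rw [h]; exact zero_mem p)
    · exact hx₀0 h
  have hy0' : algebraMap R (FractionRing R) y ≠ 0 := by simpa using hy0
  refine ⟨algebraMap R _ y, s, hy0', hsp, algebraMap_mem_ofIdeal hI y.2, ?_⟩
  refine (mem_ofIdeal_inv_iff hI).mpr fun x hx ↦ ?_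
  obtain ⟨r, hr⟩ := hall ⟨x, hx⟩
  refine ⟨r, ?_⟩
  rw [div_mul_eq_mul_div, eq_div_iff hy0', ← map_mul, ← map_mul, hr]

variable [IsLocalRing R] {d : ℕ}

/-- An element `x` of the hull is a linear form `φ ↦ x φ` on the dual of `I`. By `exists_eval_eq` it
is evaluation at some `m ∈ I`, and testing on the inclusion gives `x = m`. -/
theorem mem_ofIdeal_iff (hR : IsGorensteinOfDim R d) (hI' : I.IsGorenstein) (hI1 : I.height = 1)
    {x : FractionRing R} :
    x ∈ (ofIdeal I hI).1 ↔ ∃ y ∈ I, algebraMap R _ y = x := by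
  refine ⟨fun hx ↦ ?_, fun ⟨y, hy, h⟩ ↦ h ▸ algebraMap_mem_ofIdeal hI hy⟩
  choose e he heq using exists_mem_inv_of_linearMap hI
  have h1 : ∀ φ, ∃ r : R, algebraMap R (FractionRing R) r = x * e φ := fun φ ↦ by
    rw [mul_comm]
    exact mem_inv_iff.mp (he φ) x hx
  choose ψ hψ using h1
  have hadd : ∀ φ φ', e (φ + φ') = e φ + e φ' := fun φ φ' ↦
    eq_of_forall_mul_eq hI fun y hy ↦ by
      rw [← heq _ ⟨y, hy⟩, add_mul, ← heq _ ⟨y, hy⟩, ← heq _ ⟨y, hy⟩, LinearMap.add_apply, map_add]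
  have hsmul : ∀ (r : R) φ, e (r • φ) = algebraMap R _ r * e φ := fun r φ ↦
    eq_of_forall_mul_eq hI fun y hy ↦ by
      rw [← heq _ ⟨y, hy⟩, mul_assoc, ← heq _ ⟨y, hy⟩, LinearMap.smul_apply, smul_eq_mul, map_mul]
  have hone : e I.subtype = 1 := eq_of_forall_mul_eq hI fun y hy ↦ by
    rw [← heq _ ⟨y, hy⟩, one_mul, Submodule.subtype_apply]
  let Ψ : Module.Dual R I →ₗ[R] R :=
    { toFun := ψ
      map_add' φ φ' := by
        apply IsFractionRing.injective R (FractionRing R)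
        rw [map_add, hψ, hψ, hψ, hadd, mul_add]
      map_smul' r φ := by
        apply IsFractionRing.injective R (FractionRing R)
        rw [RingHom.id_apply, smul_eq_mul, map_mul, hψ, hψ, hsmul, mul_left_comm] }
  obtain ⟨m, hm⟩ := hR.exists_eval_eq I (hR.subsingleton_ext_ideal hI' hI1) Ψ
  refine ⟨m, m.2, ?_⟩
  have h2 := congrArg (algebraMap R (FractionRing R)) (hm I.subtype)
  rw [Submodule.subtype_apply] at h2
  rw [← h2]
  exact (hψ _).trans (by rw [hone, mul_one])

theorem subsingleton_ext_ofIdeal (hR : IsGorensteinOfDim R d) (hI' : I.IsGorenstein)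
    (hI1 : I.height = 1) (j : ℕ) (hj : 0 < j) :
    Subsingleton (ExtM R (ofIdeal I hI).mod R j) := by
  let ι : I →ₗ[R] (ofIdeal I hI).mod :=
    ((Algebra.linearMap R (FractionRing R)).comp I.subtype).codRestrict _
      fun y ↦ algebraMap_mem_ofIdeal hI y.2
  have hι : Function.Bijective ι := by
    refine ⟨fun y z h ↦ Subtype.ext ?_, fun x ↦ ?_⟩
    · exact IsFractionRing.injective R (FractionRing R) (congrArg Subtype.val h)
    · obtain ⟨y, hy, h⟩ := (mem_ofIdeal_iff hI hR hI' hI1).mp x.2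
      exact ⟨⟨y, hy⟩, Subtype.ext h⟩
  exact (ExtM.subsingleton_congr_left (LinearEquiv.ofBijective ι hι) j).mp
    (hR.subsingleton_ext_ideal hI' hI1 j hj)

theorem exists_generator_ofIdeal_inv (hR : IsGorensteinOfDim R d) (hI' : I.IsGorenstein)
    (hI1 : I.height = 1) : ∃ f ∈ ((ofIdeal I hI)⁻¹).1, ∀ x ∈ ((ofIdeal I hI)⁻¹).1,
      ∃ a b : R, x = algebraMap R _ a + algebraMap R _ b * f := by
  obtain ⟨φ, hφ⟩ := hR.exists_dual_generator hI' hI1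
  obtain ⟨f, hf, hf'⟩ := exists_mem_inv_of_linearMap hI φ
  refine ⟨f, hf, fun x hx ↦ ?_⟩
  obtain ⟨χ, hχ⟩ := exists_linearMap_of_mem_inv hI hx
  obtain ⟨a, b, hab⟩ := hφ χ
  refine ⟨a, b, eq_of_forall_mul_eq hI fun y hy ↦ ?_⟩
  rw [← hχ ⟨y, hy⟩, hab, add_mul, mul_assoc, ← hf' ⟨y, hy⟩]
  simp

end DivisorialIdeal

end IdealHull

/-! ### Lengths of `Ext` modules and a discrete convexity lemma. -/

section FiniteLength

open IsLocalRing

variable {R : Type u} [CommRing R]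

theorem ExtM.finite [IsNoetherianRing R] (M N : Type u) [AddCommGroup M] [Module R M]
    [Module.Finite R M] [AddCommGroup N] [Module R N] [Module.Finite R N] (n : ℕ) :
    Module.Finite R (ExtM R M N n) := by
  induction n generalizing M with
  | zero =>
    obtain ⟨m, g, hg⟩ := Module.Finite.exists_fin' R M
    have : Module.Finite R (M →ₗ[R] N) :=
      Module.Finite.of_injective (LinearMap.lcomp R N g) fun φ ψ h ↦ by
        rw [← LinearMap.cancel_right hg]
        exact h
    exact Module.Finite.equiv (ExtM.zeroEquiv R M N)
  | succ n ih =>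
    obtain ⟨m, g, hg⟩ := Module.Finite.exists_fin' R M
    obtain ⟨δ, -, h⟩ := ExtM.exists_pre_connecting (Submodule.subtype_injective (LinearMap.ker g)) hg
      (LinearMap.exact_subtype_ker_map g) N n
    have := ih (LinearMap.ker g)
    have := ExtM.subsingleton_of_free (R := R) (M := Fin m → R) (Y := N) (n + 1) n.succ_pos
    exact Module.Finite.of_surjective δ fun x ↦ (h x).mp (Subsingleton.elim _ _)

theorem Module.length_ne_top_of_support [IsNoetherianRing R] [IsLocalRing R] (E : Type*)
    [AddCommGroup E] [Module R E] [Module.Finite R E]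
    (h : ∀ p : Ideal R, p.IsPrime → Module.annihilator R E ≤ p → p = maximalIdeal R) :
    Module.length R E ≠ ⊤ := by
  let A := R ⧸ Module.annihilator R E
  have hA : Ring.KrullDimLE 0 A := Ring.krullDimLE_zero_iff.mpr fun P hP ↦ by
    have h1 : P.comap (Ideal.Quotient.mk (Module.annihilator R E)) = maximalIdeal R := by
      refine h _ (hP.comap _) fun r hr ↦ ?_
      rw [Ideal.mem_comap, Ideal.Quotient.eq_zero_iff_mem.mpr hr]
      exact zero_mem P
    have h2 := Ideal.map_eq_top_or_isMaximal_of_surjective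
      (Ideal.Quotient.mk (Module.annihilator R E)) Ideal.Quotient.mk_surjective
      (maximalIdeal.isMaximal R)
    rw [← h1, Ideal.map_comap_of_surjective _ Ideal.Quotient.mk_surjective] at h2
    exact h2.resolve_left hP.ne_top
  have : IsArtinianRing A := IsNoetherianRing.isArtinianRing_of_krullDimLE_zero
  let : Module A E := Module.quotientAnnihilator
  have : IsScalarTower R A E := ⟨fun r a e ↦ by
    obtain ⟨a, rfl⟩ := Ideal.Quotient.mk_surjective a
    exact mul_smul r a e⟩
  have : Module.Finite A E := Module.Finite.of_restrictScalars_finite R A E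
  rw [Module.length_eq_of_surjective (R := A) Ideal.Quotient.mk_surjective]
  exact Module.length_ne_top

theorem ExtM.length_prod_le {M N Y : Type u} [AddCommGroup M] [Module R M] [AddCommGroup N]
    [Module R N] [AddCommGroup Y] [Module R Y] (n : ℕ) :
    Module.length R (ExtM R M Y n) + Module.length R (ExtM R N Y n) ≤
      Module.length R (ExtM R (M × N) Y n) := by
  rw [← Module.length_prod]
  exact Module.length_le_of_surjective _ (ExtM.prod_pre_surjective n)

theorem Module.length_le_add_of_exact {M N P : Type*} [AddCommGroup M] [Module R M]
    [AddCommGroup N] [Module R N] [AddCommGroup P] [Module R P] (f : M →ₗ[R] N) (g : N →ₗ[R] P)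
    (h : ∀ y, g y = 0 → ∃ x, f x = y) :
    Module.length R N ≤ Module.length R M + Module.length R P := by
  rw [Module.length_eq_add_of_exact (LinearMap.ker g).subtype g.rangeRestrict
    (Submodule.subtype_injective _) g.surjective_rangeRestrict
    (by rw [← g.ker_rangeRestrict]; exact LinearMap.exact_subtype_ker_map _)]
  refine add_le_add ?_ (Module.length_le_of_injective _ (Submodule.subtype_injective _))
  refine (Module.length_le_of_injective (Submodule.inclusion (p := LinearMap.ker g)
    (p' := LinearMap.range f) fun y hy ↦ h y hy) (Submodule.inclusion_injective _)).trans ?_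
  exact Module.length_le_of_surjective _ f.surjective_rangeRestrict

/-- Factor `g` through its range: the class comes from `Ext^n` of the range, and the vanishing of
`Ext^(n+1)` of the cokernel lifts it to `P`. -/
theorem ExtM.exists_pre_eq_of_exact {M N P Y : Type u} [AddCommGroup M] [Module R M]
    [AddCommGroup N] [Module R N] [AddCommGroup P] [Module R P] [AddCommGroup Y] [Module R Y]
    {f : M →ₗ[R] N} {g : N →ₗ[R] P} (hf : Function.Injective f) (hfg : Function.Exact f g) (n : ℕ)
    (h : Subsingleton (ExtM R (P ⧸ LinearMap.range g) Y (n + 1))) (y : ExtM R N Y n)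
    (hy : ExtM.pre Y f n y = 0) : ∃ x : ExtM R P Y n, ExtM.pre Y g n x = y := by
  have hex : Function.Exact f g.rangeRestrict := by
    rwa [LinearMap.exact_iff, LinearMap.ker_rangeRestrict, ← LinearMap.exact_iff]
  obtain ⟨w, rfl⟩ := (ExtM.pre_exact hf g.surjective_rangeRestrict hex Y n y).mp hy
  obtain ⟨x, rfl⟩ := ExtM.pre_surjective (Submodule.subtype_injective _)
    (Submodule.mkQ_surjective _) (LinearMap.exact_subtype_mkQ (LinearMap.range g)) Y n h w
  exact ⟨x, LinearMap.congr_fun (ExtM.pre_comp (Y := Y) g.rangeRestrict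
    (LinearMap.range g).subtype n) x⟩

theorem eq_zero_of_two_mul_le {ℓ : ℤ → ℕ} (h : ∀ i, 2 * ℓ i ≤ ℓ (i - 1) + ℓ (i + 1)) {a b i : ℤ}
    (ha : ℓ a = 0) (hb : ℓ b = 0) (hai : a ≤ i) (hib : i ≤ b) : ℓ i = 0 := by
  -- Convexity together with `ℓ a = 0` makes `ℓ (a + n) / n` nondecreasing, so a zero further to the
  -- right propagates leftwards.
  have h1 : ∀ n : ℕ, (n + 1) * ℓ (a + n) ≤ n * ℓ (a + n + 1) := fun n ↦ by
    induction n with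
    | zero => simp [ha]
    | succ n ih =>
      have h2 := h (a + n + 1)
      rw [add_sub_cancel_right] at h2
      push_cast
      rw [← add_assoc a]
      nlinarith
  have h2 : ∀ m n : ℕ, ℓ (a + (n + m : ℕ)) = 0 → ℓ (a + n) = 0 := fun m ↦ by
    induction m with
    | zero => exact fun n hn ↦ hn
    | succ m ih =>
      intro n hn
      refine ih n ?_
      have h3 := h1 (n + m)
      rw [add_assoc a, ← Nat.cast_succ, ← Nat.add_assoc] at *
      rw [hn, mul_zero] at h3
      simpa using h3
  obtain ⟨n, rfl⟩ := Int.le.dest hai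
  obtain ⟨m, rfl⟩ := Int.le.dest hib
  exact h2 m n (by push_cast; rwa [← add_assoc])

end FiniteLength

/-! ### The exact sequence of a two-generated inverse, and convexity of lengths. -/

section TwoGeneratedInverse

open IsLocalRing

variable {R : Type u} [CommRing R] [IsDomain R] [IsNoetherianRing R] [IsIntegrallyClosed R]

namespace DivisorialIdeal

/-- The elements `1` and `f` generate the inverse of `D`. -/
structure IsInvGenerator (D : DivisorialIdeal R) (f : FractionRing R) : Prop where
  one_mem : 1 ∈ (D⁻¹).1
  mem : f ∈ (D⁻¹).1
  exists_eq : ∀ x ∈ (D⁻¹).1, ∃ a b : R, x = algebraMap R _ a + algebraMap R _ b * f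

namespace IsInvGenerator

variable {D L L' L'' : DivisorialIdeal R} {f : FractionRing R} (h : IsInvGenerator D f)
  (hL' : L * D = L') (hL'' : L * D⁻¹ = L'')

/-- The map `b ↦ (-f b, b)` from `L * D` to `L × L`. -/
noncomputable def left : L'.mod →ₗ[R] L.mod × L.mod :=
  (-(mulMap (by rw [← hL', mul_inv_cancel_right]) f h.mem)).prod
    (mulMap (by rw [← hL', mul_inv_cancel_right]) 1 h.one_mem)

/-- The map `(a, b) ↦ a + f b` from `L × L` to `L * D⁻¹`. -/
noncomputable def right : L.mod × L.mod →ₗ[R] L''.mod :=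
  (mulMap hL'' 1 h.one_mem).coprod (mulMap hL'' f h.mem)

theorem right_apply (x : L.mod × L.mod) :
    (h.right hL'' x : FractionRing R) = x.1 + x.2 * f := by
  change (x.1 : FractionRing R) * 1 + x.2 * f = _
  rw [mul_one]

theorem left_injective : Function.Injective (h.left hL') := fun _ _ hxy ↦
  mulMap_injective _ 1 h.one_mem one_ne_zero (congrArg Prod.snd hxy)

/-- If `a + b f = 0`, then `b` and `b f` both lie in `L`. As `1` and `f` generate `D⁻¹`, this means
`b D⁻¹ ⊆ L`, that is, `b ∈ L * D`. -/
theorem exact : Function.Exact (h.left hL') (h.right hL'') := by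
  rintro ⟨a, b⟩
  constructor
  · intro hab
    have h1 : (a : FractionRing R) + b * f = 0 :=
      (h.right_apply hL'' (a, b)).symm.trans (congrArg Subtype.val hab)
    have hb : (b : FractionRing R) ∈ L'.1 := by
      rw [← hL', ← inv_inv D, mem_mul_inv_iff]
      intro y hy
      obtain ⟨r, s, rfl⟩ := h.exists_eq y hy
      have h2 : (b : FractionRing R) * (algebraMap R _ r + algebraMap R _ s * f) =
          ((r • b - s • a : L.mod) : FractionRing R) := by
        rw [Submodule.coe_sub, Submodule.coe_smul, Submodule.coe_smul, Algebra.smul_def,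
          Algebra.smul_def]
        linear_combination algebraMap R _ s * h1
      rw [h2]
      exact (r • b - s • a).2
    refine ⟨⟨b, hb⟩, Prod.ext (Subtype.ext ?_) (Subtype.ext (mul_one _))⟩
    change -((b : FractionRing R) * f) = a
    linear_combination -h1
  · rintro ⟨b, hb⟩
    rw [← hb]
    apply Subtype.ext
    rw [right_apply]
    change -((b : FractionRing R) * f) + b * 1 * f = 0
    ring

theorem exists_smul_mem_range (p : Ideal R) [p.IsPrime] (hp : D ∈ locallyPrincipal p) :
    ∃ s ∉ p, ∀ y : L''.mod, s • y ∈ LinearMap.range (h.right hL'') := by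
  obtain ⟨u, s, hu, hs, hu', hs'⟩ := hp
  refine ⟨s, hs, fun y ↦ ?_⟩
  -- Writing `s / u = a + b f` gives `s y = a (y u) + b (y u) f`, and `y u` lies in `L`.
  obtain ⟨a, b, hab⟩ := h.exists_eq _ hs'
  have hy : (y : FractionRing R) * u ∈ L.1 := by
    have := mul_mem y.2 hu'
    have h1 : L'' * D = L := by rw [← hL'', inv_mul_cancel_right]
    rwa [h1] at this
  refine ⟨(a • ⟨_, hy⟩, b • ⟨_, hy⟩), Subtype.ext ?_⟩
  rw [right_apply, Submodule.coe_smul, Submodule.coe_smul, Submodule.coe_smul, Algebra.smul_def,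
    Algebra.smul_def, Algebra.smul_def]
  rw [div_eq_iff hu] at hab
  linear_combination -(y : FractionRing R) * hab

variable [IsLocalRing R]

theorem annihilator_cokernel
    (hD : ∀ p : Ideal R, [p.IsPrime] → p ≠ maximalIdeal R → D ∈ locallyPrincipal p)
    (p : Ideal R) (hp : p.IsPrime)
    (hle : Module.annihilator R (L''.mod ⧸ LinearMap.range (h.right hL'')) ≤ p) :
    p = maximalIdeal R := by
  by_contra hpm
  obtain ⟨s, hs, hs'⟩ := h.exists_smul_mem_range hL'' p (hD p hpm)
  refine hs (hle (Module.mem_annihilator.mpr fun y ↦ ?_))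
  obtain ⟨y, rfl⟩ := Submodule.mkQ_surjective _ y
  rw [← map_smul, Submodule.mkQ_apply, Submodule.Quotient.mk_eq_zero]
  exact hs' y

variable {d : ℕ} (hR : IsGorensteinOfDim R d)

include hR in
theorem exists_pre_right_eq
    (hD : ∀ p : Ideal R, [p.IsPrime] → p ≠ maximalIdeal R → D ∈ locallyPrincipal p)
    (j : ℕ) (hj : j + 1 < d) (y : ExtM R (L.mod × L.mod) R j)
    (hy : ExtM.pre R (h.left hL') j y = 0) :
    ∃ x : ExtM R L''.mod R j, ExtM.pre R (h.right hL'') j x = y :=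
  ExtM.exists_pre_eq_of_exact (h.left_injective hL') (h.exact hL' hL'') j
    (hR.subsingleton_ext_of_support _ (h.annihilator_cokernel hL'' hD) (j + 1) hj) y hy

include h hL' hL'' hR in
-- The convexity inequality: `Ext^j(L'', R) → Ext^j(L × L, R) → Ext^j(L', R)` is exact in the
-- middle, since the cokernel has no `Ext` into `R` in degree `j + 1 < d`.
theorem two_mul_length_le
    (hD : ∀ p : Ideal R, [p.IsPrime] → p ≠ maximalIdeal R → D ∈ locallyPrincipal p)
    (j : ℕ) (hj : j + 1 < d) :
    2 * Module.length R (ExtM R L.mod R j) ≤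
      Module.length R (ExtM R L''.mod R j) + Module.length R (ExtM R L'.mod R j) := by
  rw [two_mul]
  exact (ExtM.length_prod_le j).trans
    (Module.length_le_add_of_exact _ _ (h.exists_pre_right_eq hL' hL'' hR hD j hj))

end IsInvGenerator

variable [IsLocalRing R] {d : ℕ} (hR : IsGorensteinOfDim R d)

/-- At a nonmaximal prime `F` is isomorphic to `E`, whose `Ext^j` vanishes. This is what makes the
lengths finite. -/
theorem annihilator_ext {D E F : DivisorialIdeal R}
    (hD : ∀ p : Ideal R, [p.IsPrime] → p ≠ maximalIdeal R → D ∈ locallyPrincipal p)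
    (hF : E * D = F) (j : ℕ) (hE : Subsingleton (ExtM R E.mod R j)) (p : Ideal R) (hp : p.IsPrime)
    (hle : Module.annihilator R (ExtM R F.mod R j) ≤ p) : p = maximalIdeal R := by
  by_contra hpm
  obtain ⟨φ, ψ, s, hs, h1, -⟩ := exists_maps_of_mem_locallyPrincipal (hD p hpm) hF
  refine hs (hle (Module.mem_annihilator.mpr fun y ↦ ?_))
  rw [← ExtM.pre_smul_id, ← h1, ExtM.pre_comp, LinearMap.comp_apply,
    Subsingleton.elim (ExtM.pre R φ j y) 0, map_zero]

include hR in
theorem subsingleton_ext_residueField_of_lt_two (hd : 2 ≤ d) (D : DivisorialIdeal R) (i : ℕ)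
    (hi : i < 2) : Subsingleton (ExtM R (R ⧸ maximalIdeal R) D.mod i) := by
  rw [← inv_inv D, ExtM.subsingleton_congr_right (invEquivDual D⁻¹)]
  exact hR.subsingleton_ext_dual_of_lt_two hd _ i hi

include hR in
theorem subsingleton_ext_residueField_inv {D : DivisorialIdeal R}
    (hD : ∀ j, 0 < j → Subsingleton (ExtM R D.mod R j)) (i : ℕ) (hi : i < d) :
    Subsingleton (ExtM R (R ⧸ maximalIdeal R) (D⁻¹).mod i) := by
  rw [ExtM.subsingleton_congr_right (invEquivDual D)]
  exact hR.subsingleton_ext_dual _ hD i hi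

include hR in
-- Dualise twice: `D⁻¹` has full depth, hence no higher `Ext` into `R`, hence its dual `D` has full
-- depth.
theorem subsingleton_ext_residueField {D : DivisorialIdeal R}
    (hD : ∀ j, 0 < j → Subsingleton (ExtM R D.mod R j)) (i : ℕ) (hi : i < d) :
    Subsingleton (ExtM R (R ⧸ maximalIdeal R) D.mod i) := by
  rw [← inv_inv D]
  exact subsingleton_ext_residueField_inv hR (fun j hj ↦ hR.subsingleton_ext_of_depth _ d
    (subsingleton_ext_residueField_inv hR hD) j (by omega)) i hi

include hR in
theorem subsingleton_ext_mul_zpow (hd : 2 ≤ d) {D E : DivisorialIdeal R} {f : FractionRing R}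
    (h : IsInvGenerator D f)
    (hD : ∀ p : Ideal R, [p.IsPrime] → p ≠ maximalIdeal R → D ∈ locallyPrincipal p) {a b i : ℤ}
    (ha : ∀ j, 0 < j → Subsingleton (ExtM R (E * D ^ a).mod R j))
    (hb : ∀ j, 0 < j → Subsingleton (ExtM R (E * D ^ b).mod R j)) (hai : a ≤ i) (hib : i ≤ b)
    (j : ℕ) (hj : 0 < j) : Subsingleton (ExtM R (E * D ^ i).mod R j) := by
  -- In the remaining range `j ≥ d - 1`, depth at least two of every divisorial ideal already gives
  -- the vanishing.
  by_cases hjd : j + 1 < d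
  · have hfin : ∀ k : ℤ, Module.length R (ExtM R (E * D ^ k).mod R j) ≠ ⊤ := fun k ↦ by
      have := ExtM.finite (R := R) (E * D ^ k).mod R j
      refine Module.length_ne_top_of_support _ (annihilator_ext (D := D ^ (k - a))
        (fun p _ hp ↦ Subgroup.zpow_mem _ (hD p hp) _) ?_ j (ha j hj))
      rw [mul_assoc, ← zpow_add, add_sub_cancel]
    choose ℓ hℓ using fun k ↦ ENat.ne_top_iff_exists.mp (hfin k)
    have h1 : ∀ k, 2 * ℓ k ≤ ℓ (k - 1) + ℓ (k + 1) := fun k ↦ by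
      have := h.two_mul_length_le (L := E * D ^ k) (L' := E * D ^ (k + 1)) (L'' := E * D ^ (k - 1))
        (by rw [mul_assoc, zpow_add_one]) (by rw [mul_assoc, zpow_sub_one]) hR hD j hjd
      rw [← hℓ, ← hℓ, ← hℓ] at this
      exact_mod_cast this
    have h0 : ∀ k, ℓ k = 0 ↔ Subsingleton (ExtM R (E * D ^ k).mod R j) := fun k ↦ by
      rw [← Module.length_eq_zero_iff (R := R), ← hℓ, Nat.cast_eq_zero]
    exact (h0 i).mp (eq_zero_of_two_mul_le h1 ((h0 a).mpr (ha j hj)) ((h0 b).mpr (hb j hj)) hai hib)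
  · exact hR.subsingleton_ext_of_depth _ 2 (subsingleton_ext_residueField_of_lt_two hR hd _) j
      (by omega)

include hR in
theorem isMaximalCohenMacaulay_mul_zpow (hd : 2 ≤ d) {D E : DivisorialIdeal R} {f : FractionRing R}
    (h : IsInvGenerator D f)
    (hD : ∀ p : Ideal R, [p.IsPrime] → p ≠ maximalIdeal R → D ∈ locallyPrincipal p)
    (hE : ∀ j, 0 < j → Subsingleton (ExtM R E.mod R j)) {n i : ℤ}
    (hn : IsMaximalCohenMacaulay R (E * D ^ n).mod) (hi : (0 ≤ i ∧ i ≤ n) ∨ (n ≤ i ∧ i ≤ 0)) :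
    IsMaximalCohenMacaulay R (E * D ^ i).mod := by
  have h0 : ∀ j, 0 < j → Subsingleton (ExtM R (E * D ^ (0 : ℤ)).mod R j) := by
    rwa [zpow_zero, mul_one]
  have h1 : ∀ j, 0 < j → Subsingleton (ExtM R (E * D ^ n).mod R j) := fun j hj ↦
    hR.subsingleton_ext_of_depth _ d (hn.subsingleton_ext hR.ringKrullDim_eq) j (by omega)
  have h2 : ∀ j, 0 < j → Subsingleton (ExtM R (E * D ^ i).mod R j) :=
    hi.elim (fun hi ↦ subsingleton_ext_mul_zpow hR hd h hD h0 h1 hi.1 hi.2)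
      fun hi ↦ subsingleton_ext_mul_zpow hR hd h hD h1 h0 hi.1 hi.2
  -- At nonmaximal primes `E * D ^ i` and `E * D ^ n` are isomorphic, so the depth condition there
  -- is inherited from exponent `n`.
  refine isMaximalCohenMacaulay_of_subsingleton_ext hR.ringKrullDim_eq
    (subsingleton_ext_residueField hR h2) fun p _ hp ↦ (hn.2 p).trans_eq ?_
  have h3 : E * D ^ n * D ^ (i - n) = E * D ^ i := by
    rw [mul_assoc, ← zpow_add, add_sub_cancel]
  obtain ⟨φ, ψ, s, hs, h4, h5⟩ :=
    exists_maps_of_mem_locallyPrincipal (Subgroup.zpow_mem _ (hD p hp) (i - n)) h3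
  exact moduleDepth_localizedModule_congr p φ ψ s hs h4 h5

end DivisorialIdeal

end TwoGeneratedInverse

/-! ### Vanishing of cokernels, and pairs of maps into a two-generated module. -/

section TwoGenerated

open IsLocalRing

variable {R : Type u} [CommRing R]

theorem ExtM.subsingleton_cokernel {M N P : Type u} [AddCommGroup M] [Module R M]
    [AddCommGroup N] [Module R N] [AddCommGroup P] [Module R P] (T : Type u) [AddCommGroup T]
    [Module R T] {f : M →ₗ[R] N} {g : N →ₗ[R] P} (hf : Function.Injective f)
    (hfg : Function.Exact f g) (n : ℕ) (hP : Subsingleton (ExtM R T P n))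
    (hN : Subsingleton (ExtM R T N (n + 1))) (hM : Subsingleton (ExtM R T M (n + 2))) :
    Subsingleton (ExtM R T (P ⧸ LinearMap.range g) n) := by
  have hex : Function.Exact f g.rangeRestrict := by
    rwa [LinearMap.exact_iff, LinearMap.ker_rangeRestrict, ← LinearMap.exact_iff]
  exact ExtM.post_subsingleton₃ (Submodule.subtype_injective _) (Submodule.mkQ_surjective _)
    (LinearMap.exact_subtype_mkQ (LinearMap.range g)) T n hP
    (ExtM.post_subsingleton₃ hf g.surjective_rangeRestrict hex T (n + 1) hN hM)

variable [IsLocalRing R]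

theorem subsingleton_of_subsingleton_ext_residueField [IsNoetherianRing R] (C : Type u)
    [AddCommGroup C] [Module R C]
    (h : ∀ p : Ideal R, p.IsPrime → Module.annihilator R C ≤ p → p = maximalIdeal R)
    (hC : Subsingleton (ExtM R (R ⧸ maximalIdeal R) C 0)) : Subsingleton C := by
  by_contra hne
  rw [not_subsingleton_iff_nontrivial] at hne
  obtain ⟨n, hn, hn'⟩ := exists_ne_zero_smul_eq_zero C h
  have h1 : residueFieldMap n hn' = 0 :=
    (ExtM.zeroEquiv R (R ⧸ maximalIdeal R) C).injective (Subsingleton.elim _ _)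
  have h2 := LinearMap.congr_fun h1 (Submodule.Quotient.mk 1)
  rw [residueFieldMap_mk, one_smul] at h2
  exact hn h2

variable {M : Type*} [AddCommGroup M] [Module R M]

theorem eq_top_of_sup_smul_top [Module.Finite R M] {N : Submodule R M}
    (h : N ⊔ maximalIdeal R • ⊤ = ⊤) : N = ⊤ :=
  top_le_iff.mp (Submodule.le_of_le_smul_of_le_jacobson_bot Module.Finite.fg_top
    (maximalIdeal_le_jacobson ⊥) h.ge)

/-- The vectors `v`, `w` are independent in `M / mM`, which has dimension at most two. The proof is
an explicit exchange: some coefficient of `v` is a unit, and `w` then replaces the other generator.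
-/
theorem span_pair_eq_top_of_notMem {x y v w : M} (hxy : Submodule.span R {x, y} = ⊤)
    (hv : v ∉ maximalIdeal R • (⊤ : Submodule R M))
    (hw : w ∉ Submodule.span R {v} ⊔ maximalIdeal R • (⊤ : Submodule R M)) :
    Submodule.span R {v, w} = ⊤ := by
  have key : ∀ {x y : M}, Submodule.span R {x, y} = ⊤ → ∀ a c : R, IsUnit a → a • x + c • y = v →
      Submodule.span R {v, w} = ⊤ := by
    intro x y hxy a c ha hac
    obtain ⟨a, rfl⟩ := ha
    have hx : x = (↑a⁻¹ : R) • v - (↑a⁻¹ * c) • y := by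
      rw [← hac, smul_add, smul_smul, smul_smul, Units.inv_mul, one_smul, add_sub_cancel_right]
    obtain ⟨e, h, heh⟩ := Submodule.mem_span_pair.mp (hxy ▸ Submodule.mem_top (x := w))
    have hw' : (e * ↑a⁻¹) • v + (h - e * (↑a⁻¹ * c)) • y = w := by
      rw [← heh, hx]
      module
    have hunit : IsUnit (h - e * (↑a⁻¹ * c)) := by
      by_contra hu
      refine hw (hw' ▸ Submodule.add_mem_sup ?_ (Submodule.smul_mem_smul ?_ Submodule.mem_top))
      · exact Submodule.smul_mem _ _ (Submodule.mem_span_singleton_self v)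
      · exact (mem_maximalIdeal _).mpr hu
    have hvmem : v ∈ Submodule.span R {v, w} := Submodule.subset_span (by simp)
    have hwmem : w ∈ Submodule.span R {v, w} := Submodule.subset_span (by simp)
    have hy : y ∈ Submodule.span R {v, w} := by
      rw [← Submodule.smul_mem_iff_of_isUnit _ hunit, ← add_sub_cancel_left ((e * ↑a⁻¹) • v)
        ((h - e * (↑a⁻¹ * c)) • y), hw']
      exact sub_mem hwmem (Submodule.smul_mem _ _ hvmem)
    rw [← top_le_iff, ← hxy, Submodule.span_le]
    rintro _ (rfl | rfl)
    · rw [hx]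
      exact sub_mem (Submodule.smul_mem _ _ hvmem) (Submodule.smul_mem _ _ hy)
    · exact hy
  obtain ⟨a, c, hac⟩ := Submodule.mem_span_pair.mp (hxy ▸ Submodule.mem_top (x := v))
  by_cases ha : IsUnit a
  · exact key hxy a c ha hac
  · by_cases hc : IsUnit c
    · exact key (by rwa [Set.pair_comm]) c a hc (by rwa [add_comm])
    · refine (hv (hac ▸ add_mem ?_ ?_)).elim <;>
        exact Submodule.smul_mem_smul ((mem_maximalIdeal _).mpr ‹_›) Submodule.mem_top

/-- If neither map is onto, some `α b` lies outside `range β + mM` and some `β c` outside `range α +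
mM`. Two proper subgroups do not cover a group, so one of `b`, `c`, `b + c` has both properties. -/
theorem range_eq_top_or_exists_span_pair_eq_top {B : Type*} [AddCommGroup B] [Module R B]
    {x y : M} (hxy : Submodule.span R {x, y} = ⊤) (α β : B →ₗ[R] M)
    (h : ∀ m, ∃ b c, α b + β c = m) :
    LinearMap.range α = ⊤ ∨ LinearMap.range β = ⊤ ∨ ∃ b, Submodule.span R {α b, β b} = ⊤ := by
  have : Module.Finite R M := ⟨hxy ▸ Submodule.fg_span (Set.toFinite _)⟩
  have key : ∀ {α β : B →ₗ[R] M}, (∀ m, ∃ b c, α b + β c = m) → LinearMap.range β ≠ ⊤ →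
      ∃ b, α b ∉ LinearMap.range β ⊔ maximalIdeal R • ⊤ := by
    intro α β h hβ
    by_contra! hcon
    refine hβ (eq_top_of_sup_smul_top (top_le_iff.mp fun m _ ↦ ?_))
    obtain ⟨b, c, rfl⟩ := h m
    exact add_mem (hcon b) (Submodule.mem_sup_left ⟨c, rfl⟩)
  by_cases hα : LinearMap.range α = ⊤
  · exact .inl hα
  by_cases hβ : LinearMap.range β = ⊤
  · exact .inr (.inl hβ)
  obtain ⟨b, hb⟩ := key h hβ
  obtain ⟨c, hc⟩ := key (fun m ↦ by
    obtain ⟨b, c, rfl⟩ := h m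
    exact ⟨c, b, add_comm _ _⟩) hα
  have hfin : ∀ b, α b ∉ LinearMap.range β ⊔ maximalIdeal R • (⊤ : Submodule R M) →
      β b ∉ LinearMap.range α ⊔ maximalIdeal R • (⊤ : Submodule R M) →
      ∃ b, Submodule.span R {α b, β b} = ⊤ := fun b h1 h2 ↦ by
    refine ⟨b, span_pair_eq_top_of_notMem hxy (fun h ↦ h1 (Submodule.mem_sup_right h))
      fun h ↦ h2 ?_⟩
    have h3 : Submodule.span R {α b} ≤ LinearMap.range α := by
      rw [Submodule.span_singleton_le_iff_mem]
      exact ⟨b, rfl⟩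
    exact sup_le_sup_right h3 (maximalIdeal R • ⊤) h
  right; right
  by_cases h1 : β b ∈ LinearMap.range α ⊔ maximalIdeal R • (⊤ : Submodule R M)
  · by_cases h2 : α c ∈ LinearMap.range β ⊔ maximalIdeal R • (⊤ : Submodule R M)
    · refine hfin (b + c) ?_ ?_
      · rw [map_add]
        exact fun h ↦ hb ((Submodule.add_mem_iff_left _ h2).mp h)
      · rw [map_add]
        exact fun h ↦ hc ((Submodule.add_mem_iff_right _ h1).mp h)
    · exact hfin c h2 hc
  · exact hfin b hb h1

end TwoGenerated

/-! ### Divisor classes and the second assertion. -/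

section Main

open IsLocalRing

variable {R : Type u} [CommRing R] [IsDomain R] [IsNoetherianRing R] [IsIntegrallyClosed R]

theorem DivisorClassGroup.isMaximalCohenMacaulayPoint_mk_iff {D : DivisorialIdeal R} :
    (DivisorClassGroup.mk D).IsMaximalCohenMacaulayPoint ↔ IsMaximalCohenMacaulay R D.mod :=
  ⟨fun ⟨_, h, h'⟩ ↦ h'.congr (DivisorialIdeal.equivOfMkEq h), fun h ↦ ⟨D, rfl, h⟩⟩

theorem DivisorClassGroup.mk_add_zsmul_mk (D E : DivisorialIdeal R) (n : ℤ) :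
    DivisorClassGroup.mk E + n • DivisorClassGroup.mk D = DivisorClassGroup.mk (E * D ^ n) := rfl

variable [IsLocalRing R]

namespace DivisorialIdeal

variable {D E L : DivisorialIdeal R} {f g : FractionRing R} {d : ℕ}

theorem eq_mul_principal {c : (FractionRing R)ˣ} (hc : (c : FractionRing R) ∈ (D⁻¹).1)
    (h : ∀ y ∈ (L * D⁻¹).1, ∃ b ∈ L.1, y = b * c) : L * D⁻¹ = L * principal R c := by
  refine ext_mem fun y ↦ ⟨fun hy ↦ ?_, fun hy ↦ ?_⟩
  · obtain ⟨b, hb, rfl⟩ := h y hy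
    exact mul_mem hb (mem_principal.mpr ⟨1, one_smul _ _⟩)
  · have h1 := mul_mem hy (E := principal R c⁻¹) (mem_principal.mpr ⟨1, one_smul _ _⟩)
    rw [map_inv, mul_inv_cancel_right] at h1
    simpa using mul_mem h1 hc

/-- For `y ∈ D` one has `y = (y c) r⁻¹ b` with `y c ∈ R`, so `b` generates `D`. -/
theorem mem_range_principal_of_mul_mem {b c : FractionRing R} (hb : b ∈ D.1) (hc : c ∈ (D⁻¹).1)
    {r : R} (hr : IsUnit r) (h : b * c = algebraMap R _ r) : D ∈ (principal R).range := by
  obtain ⟨r, rfl⟩ := hr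
  have hr0 : algebraMap R (FractionRing R) r ≠ 0 := by simp
  have hb0 : b ≠ 0 := by
    rintro rfl
    rw [zero_mul] at h
    exact hr0 h.symm
  refine ⟨Units.mk0 b hb0, ext_mem fun y ↦ ⟨fun hy ↦ ?_, fun hy ↦ ?_⟩⟩
  · obtain ⟨s, rfl⟩ := mem_principal.mp hy
    exact Submodule.smul_mem D.mod s hb
  · obtain ⟨s, hs⟩ := mem_inv_iff.mp hc y hy
    refine mem_principal.mpr ⟨s * ↑r⁻¹, ?_⟩
    have h1 : algebraMap R (FractionRing R) r * algebraMap R (FractionRing R) ↑r⁻¹ = 1 := by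
      rw [← map_mul, Units.mul_inv, map_one]
    rw [Algebra.smul_def, map_mul, hs, Units.val_mk0]
    linear_combination y * algebraMap R (FractionRing R) ↑r⁻¹ * h + y * h1

/-- The cokernel of `L × L → L * D⁻¹` is supported at the maximal ideal. Counting depths along the
sequence, with `Ext²(k, L * D) = 0`, shows that it has no socle, so it vanishes. -/
theorem IsInvGenerator.exists_add_mul_eq (h : IsInvGenerator D f) (hR : IsGorensteinOfDim R d)
    (hd : 3 ≤ d)
    (hD : ∀ p : Ideal R, [p.IsPrime] → p ≠ maximalIdeal R → D ∈ locallyPrincipal p)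
    (hL : Subsingleton (ExtM R (R ⧸ maximalIdeal R) (L * D).mod 2)) (y : (L * D⁻¹).mod) :
    ∃ a b : L.mod, (y : FractionRing R) = a + b * f := by
  have hdepth := subsingleton_ext_residueField_of_lt_two hR (by omega)
  have hC := subsingleton_of_subsingleton_ext_residueField _
    (h.annihilator_cokernel (L := L) rfl hD) (ExtM.subsingleton_cokernel _ (h.left_injective rfl)
      (h.exact rfl rfl) 0 (hdepth _ 0 (by omega))
      (ExtM.post_subsingleton_prod 1 (hdepth L 1 (by omega)) (hdepth L 1 (by omega))) hL)
  rw [Submodule.Quotient.subsingleton_iff, LinearMap.range_eq_top] at hC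
  obtain ⟨x, hx⟩ := hC y
  exact ⟨x.1, x.2, by rw [← hx, h.right_apply]⟩

/-- Taking `L = D` writes `1 = a + b f` with `a` and `b f` in `R`; locality makes one of these
products of `D` with `D⁻¹` a unit. -/
theorem IsInvGenerator.mem_range_principal_of_sq (h : IsInvGenerator D f)
    (hR : IsGorensteinOfDim R d) (hd : 3 ≤ d)
    (hD : ∀ p : Ideal R, [p.IsPrime] → p ≠ maximalIdeal R → D ∈ locallyPrincipal p)
    (hL : Subsingleton (ExtM R (R ⧸ maximalIdeal R) (D * D).mod 2)) :
    D ∈ (principal R).range := by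
  have h1 : (1 : FractionRing R) ∈ (D * D⁻¹).1 := by
    rw [mul_inv_cancel]
    exact mem_one.mpr ⟨1, map_one _⟩
  obtain ⟨a, b, hab⟩ := h.exists_add_mul_eq hR hd hD hL ⟨1, h1⟩
  have hcoe : ∀ {x y : FractionRing R}, x ∈ D.1 → y ∈ (D⁻¹).1 →
      ∃ r : R, algebraMap R (FractionRing R) r = x * y := fun {x y} hx hy ↦ by
    rw [mul_comm]
    exact mem_inv_iff.mp hy x hx
  obtain ⟨r, hr⟩ := hcoe a.2 h.one_mem
  obtain ⟨s, hs⟩ := hcoe b.2 h.mem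
  have hrs : r + s = 1 := by
    apply IsFractionRing.injective R (FractionRing R)
    rw [map_add, hr, hs, map_one, mul_one]
    exact hab.symm
  rcases isUnit_or_isUnit_of_add_one hrs with hu | hu
  · exact mem_range_principal_of_mul_mem a.2 h.one_mem hu hr.symm
  · exact mem_range_principal_of_mul_mem b.2 h.mem hu hs.symm

theorem IsInvGenerator.mem_range_principal (hDf : IsInvGenerator D f) (hEg : IsInvGenerator E g)
    (hR : IsGorensteinOfDim R d) (hd : 3 ≤ d)
    (hD : ∀ p : Ideal R, [p.IsPrime] → p ≠ maximalIdeal R → D ∈ locallyPrincipal p)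
    (hE : ∀ j, 0 < j → Subsingleton (ExtM R E.mod R j))
    (h1 : IsMaximalCohenMacaulay R (E * D ^ (2 : ℤ)).mod)
    (h2 : IsMaximalCohenMacaulay R (E * D ^ (-2 : ℤ)).mod) : D ∈ (principal R).range := by
  -- This choice makes `L * D⁻¹` the two-generated ideal `E⁻¹` and `L * D` the dual of `E * D ^
  -- (-2)`.
  obtain ⟨L, hL⟩ : ∃ L, L = E⁻¹ * D := ⟨_, rfl⟩
  have hLD : L * D = (E * D ^ (-2 : ℤ))⁻¹ := by
    rw [hL, mul_inv, zpow_neg, inv_inv, mul_assoc, zpow_two]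
  have hLE : L * D⁻¹ = E⁻¹ := by rw [hL, mul_inv_cancel_right]
  have hadd := hDf.exists_add_mul_eq (L := L) hR hd hD (by
    rw [hLD]
    refine subsingleton_ext_residueField_inv hR (fun j hj ↦ ?_) 2 (by omega)
    exact hR.subsingleton_ext_of_depth _ d (h2.subsingleton_ext hR.ringKrullDim_eq) j (by omega))
  let α : L.mod →ₗ[R] (E⁻¹).mod := mulMap hLE 1 hDf.one_mem
  let β : L.mod →ₗ[R] (E⁻¹).mod := mulMap hLE f hDf.mem
  have hspan : Submodule.span R {(⟨1, hEg.one_mem⟩ : (E⁻¹).mod), ⟨g, hEg.mem⟩} = ⊤ := by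
    refine top_le_iff.mp fun y _ ↦ Submodule.mem_span_pair.mpr ?_
    obtain ⟨a, b, hab⟩ := hEg.exists_eq y y.2
    refine ⟨a, b, Subtype.ext ?_⟩
    rw [hab, Submodule.coe_add, Submodule.coe_smul, Submodule.coe_smul, Algebra.smul_def,
      Algebra.smul_def, mul_one]
  -- If `L c = E⁻¹ = L * D⁻¹`, cancelling `L` in the group of divisorial ideals shows that `D⁻¹` is
  -- generated by `c`.
  have hprin : ∀ {c : FractionRing R} (hc : c ∈ (D⁻¹).1),
      LinearMap.range (mulMap hLE c hc) = ⊤ → D ∈ (principal R).range := by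
    intro c hc htop
    rw [LinearMap.range_eq_top] at htop
    have hc0 : c ≠ 0 := by
      rintro rfl
      obtain ⟨y, hy, hy0⟩ := (E⁻¹).exists_ne_zero
      obtain ⟨x, hx⟩ := htop ⟨y, hy⟩
      exact hy0 ((congrArg Subtype.val hx).symm.trans (mul_zero _))
    have h3 := eq_mul_principal (c := Units.mk0 c hc0) (L := L) hc fun y hy ↦ by
      obtain ⟨x, hx⟩ := htop ⟨y, hLE ▸ hy⟩
      exact ⟨x, x.2, (congrArg Subtype.val hx).symm⟩
    exact inv_mem_iff.mp ⟨_, (mul_left_cancel h3).symm⟩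
  rcases range_eq_top_or_exists_span_pair_eq_top hspan α β (fun y ↦ by
    obtain ⟨a, b, hab⟩ := hadd ⟨y, hLE.symm ▸ y.2⟩
    refine ⟨a, b, Subtype.ext ?_⟩
    rw [Submodule.coe_add, mulMap_apply, mulMap_apply, mul_one]
    exact hab.symm) with h3 | h3 | ⟨b, h3⟩
  · exact hprin _ h3
  · exact hprin _ h3
  · have hb0 : (b : FractionRing R) ≠ 0 := fun h0 ↦ by
      obtain ⟨y, hy, hy0⟩ := (E⁻¹).exists_ne_zero
      obtain ⟨r, s, hrs⟩ := Submodule.mem_span_pair.mp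
          (h3.ge (Submodule.mem_top (x := (⟨y, hy⟩ : (E⁻¹).mod))))
      refine hy0 ((congrArg Subtype.val hrs).symm.trans ?_)
      rw [Submodule.coe_add, Submodule.coe_smul, Submodule.coe_smul, mulMap_apply, mulMap_apply, h0]
      simp
    -- Here `b` and `b f` generate `E⁻¹` while `1` and `f` generate `D⁻¹`, so `E` and `D` have the
    -- same class.
    have hE' : E⁻¹ = principal R (Units.mk0 _ hb0) * D⁻¹ := by
      refine ext_mem fun y ↦ ⟨fun hy ↦ ?_, fun hy ↦ ?_⟩
      · obtain ⟨r, s, hrs⟩ := Submodule.mem_span_pair.mp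
            (h3.ge (Submodule.mem_top (x := (⟨y, hy⟩ : (E⁻¹).mod))))
        have h4 : y = (b : FractionRing R) * (r • 1 + s • f) := by
          refine (congrArg Subtype.val hrs).symm.trans ?_
          rw [Submodule.coe_add, Submodule.coe_smul, Submodule.coe_smul, mulMap_apply,
            mulMap_apply, mul_add, mul_smul_comm, mul_smul_comm]
        rw [h4]
        exact mul_mem (mem_principal.mpr ⟨1, one_smul _ _⟩)
          ((D⁻¹).mod.add_mem (Submodule.smul_mem _ r hDf.one_mem) (Submodule.smul_mem _ s hDf.mem))
      · rw [← hLE]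
        refine mul_mono (fun x hx ↦ ?_) hy
        obtain ⟨s, rfl⟩ := mem_principal.mp hx
        exact Submodule.smul_mem L.mod s b.2
    -- The first assertion, between exponents `0` and `2`, makes `E * D` maximal Cohen-Macaulay, and
    -- `E * D` has the class of `D * D`.
    have h4 := isMaximalCohenMacaulay_mul_zpow hR (by omega) hDf hD hE h1 (i := 1)
      (.inl (by omega))
    have h5 : DivisorClassGroup.mk (E * D ^ (1 : ℤ)) = DivisorClassGroup.mk (D * D) := by
      refine congrArg Additive.ofMul (QuotientGroup.eq.mpr ⟨Units.mk0 _ hb0, ?_⟩)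
      rw [mul_inv, hE', zpow_one, ← mul_assoc, inv_mul_cancel_right, inv_mul_cancel_right]
    exact hDf.mem_range_principal_of_sq hR hd hD
      ((h4.congr (equivOfMkEq h5)).subsingleton_ext hR.ringKrullDim_eq 2 (by omega))

end DivisorialIdeal

end Main

theorem mainTheorem8 (R : Type u) [CommRing R] [IsDomain R] [IsLocalRing R] [IsNoetherianRing R]
    [IsIntegrallyClosed R] (hR : IsGorensteinLocalRing R) (hdim : 3 ≤ ringKrullDim R)
    (I J : Ideal R) (hI : I.IsGorenstein) (hJ : J.IsGorenstein)
    (hI1 : I.height = 1) (hJ1 : J.height = 1)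
    (hfree : IsLocallyFreeOnPuncturedSpectrum R I)
    (cI cJ : DivisorClassGroup R)
    (hcI : cI = DivisorClassGroup.ofIdeal I (Ideal.ne_bot_of_height_one hI1))
    (hcJ : cJ = DivisorClassGroup.ofIdeal J (Ideal.ne_bot_of_height_one hJ1)) :
    ((∀ n : ℤ, 0 ≤ n → (cJ + n • cI).IsMaximalCohenMacaulayPoint →
        ∀ i : ℤ, 0 ≤ i → i ≤ n → (cJ + i • cI).IsMaximalCohenMacaulayPoint) ∧
      (∀ n : ℤ, n ≤ 0 → (cJ + n • cI).IsMaximalCohenMacaulayPoint →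
        ∀ i : ℤ, n ≤ i → i ≤ 0 → (cJ + i • cI).IsMaximalCohenMacaulayPoint)) ∧
    ((cJ + (2 : ℤ) • cI).IsMaximalCohenMacaulayPoint ∧
        (cJ - (2 : ℤ) • cI).IsMaximalCohenMacaulayPoint → cI = 0 ∧ I.IsPrincipal) := by
  obtain ⟨d, hR⟩ := hR.exists_isGorensteinOfDim
  have hd : 3 ≤ d := by
    rw [hR.ringKrullDim_eq] at hdim
    exact_mod_cast hdim
  have hI0 := Ideal.ne_bot_of_height_one hI1
  have hJ0 := Ideal.ne_bot_of_height_one hJ1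
  obtain ⟨D, hD⟩ : ∃ D, D = DivisorialIdeal.ofIdeal I hI0 := ⟨_, rfl⟩
  obtain ⟨E, hE⟩ : ∃ E, E = DivisorialIdeal.ofIdeal J hJ0 := ⟨_, rfl⟩
  have hcI' : cI = DivisorClassGroup.mk D := by rw [hcI, hD]; rfl
  have hcJ' : cJ = DivisorClassGroup.mk E := by rw [hcJ, hE]; rfl
  obtain ⟨f, hf, hf'⟩ := DivisorialIdeal.exists_generator_ofIdeal_inv hI0 hR hI hI1
  obtain ⟨g, hg, hg'⟩ := DivisorialIdeal.exists_generator_ofIdeal_inv hJ0 hR hJ hJ1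
  have hDf : DivisorialIdeal.IsInvGenerator D f :=
    ⟨by simpa [hD] using DivisorialIdeal.algebraMap_mem_ofIdeal_inv hI0 1, hD ▸ hf, hD ▸ hf'⟩
  have hEg : DivisorialIdeal.IsInvGenerator E g :=
    ⟨by simpa [hE] using DivisorialIdeal.algebraMap_mem_ofIdeal_inv hJ0 1, hE ▸ hg, hE ▸ hg'⟩
  have hloc : ∀ p : Ideal R, [p.IsPrime] → p ≠ IsLocalRing.maximalIdeal R →
      D ∈ DivisorialIdeal.locallyPrincipal p := fun p _ hp ↦ by
    have := hfree p hp
    exact hD ▸ DivisorialIdeal.ofIdeal_mem_locallyPrincipal hI0 p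
  have hEext : ∀ j, 0 < j → Subsingleton (ExtM R E.mod R j) := fun j hj ↦
    hE ▸ DivisorialIdeal.subsingleton_ext_ofIdeal hJ0 hR hJ hJ1 j hj
  have hpoint : ∀ n : ℤ, (cJ + n • cI).IsMaximalCohenMacaulayPoint ↔
      IsMaximalCohenMacaulay R (E * D ^ n).mod := fun n ↦ by
    rw [hcI', hcJ', DivisorClassGroup.mk_add_zsmul_mk,
      DivisorClassGroup.isMaximalCohenMacaulayPoint_mk_iff]
  simp only [sub_eq_add_neg, ← neg_smul, hpoint]
  refine ⟨⟨fun n _ hn i h0 h1 ↦ ?_, fun n _ hn i h0 h1 ↦ ?_⟩, fun ⟨h1, h2⟩ ↦ ?_⟩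
  · exact DivisorialIdeal.isMaximalCohenMacaulay_mul_zpow hR (by omega) hDf hloc hEext hn
      (.inl ⟨h0, h1⟩)
  · exact DivisorialIdeal.isMaximalCohenMacaulay_mul_zpow hR (by omega) hDf hloc hEext hn
      (.inr ⟨h0, h1⟩)
  · have hprin := hDf.mem_range_principal hEg hR hd hloc hEext h1 h2
    refine ⟨?_, ?_⟩
    · rw [hcI']
      exact congrArg Additive.ofMul ((QuotientGroup.eq_one_iff D).mpr hprin)
    · obtain ⟨x, hx⟩ := hprin
      -- Since `I` equals its divisorial hull, a generator of `D` already lies in `I` and generates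
      -- it.
      have hmem : ∀ z : FractionRing R, (∃ r : R, r • (x : FractionRing R) = z) ↔
          ∃ y ∈ I, algebraMap R _ y = z := fun z ↦ by
        rw [← DivisorialIdeal.mem_principal, hx, hD, DivisorialIdeal.mem_ofIdeal_iff hI0 hR hI hI1]
      obtain ⟨y, hy, hyx⟩ := (hmem x).mp ⟨1, one_smul _ _⟩
      refine ⟨y, le_antisymm (fun z hz ↦ ?_) ?_⟩
      · obtain ⟨r, hr⟩ := (hmem _).mpr ⟨z, hz, rfl⟩
        refine Submodule.mem_span_singleton.mpr ⟨r, IsFractionRing.injective R (FractionRing R) ?_⟩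
        rw [smul_eq_mul, map_mul, hyx, ← hr, Algebra.smul_def]
      · exact (Submodule.span_singleton_le_iff_mem y I).mpr hy
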